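/- **Setting.** Let $p\ge 2$ be even and let $(\alpha_n)_{n\ge0}$ be complex numbers with $|\alpha_n|<1$ and $\alpha_{n+p}=\alpha_n$ for all $n$. Put $\rho_n=(1-|\alpha_n|^2)^{1/2}$. Let $\varphi_n$ be the orthonormal polynomials given by $\varphi_0=1$, $\varphi_{n+1}(z)=\rho_n^{-1}(z\varphi_n(z)-\bar\alpha_n\varphi_n^*(z))$, where $\varphi_n^*(z)=z^n\overline{\varphi_n(1/\bar z)}$, and let $\psi_n$ be the polynomials obtained in the same way from $(-\alpha_n)$. Put $$A_k(z)=\frac1{\rho_k}\begin{pmatrix} z&-\bar\alpha_k\\-z\alpha_k&1\end{pmatrix},\qquad T_p(z)=A_{p-1}(z)\cdots A_0(z),\qquad \Delta(z)=z^{-p/2}\,\mathrm{Tr}\,T_p(z).$$ The bands are the arcs that make up $B=\{z:|z|=1,\ \Delta(z)\in[-2,2]\}$. For $z\ne0$ off $B$ let $\Gamma_+(z)$ and $\Gamma_-(z)=1/\Gamma_+(z)$ be the eigenvalues of $z^{-p/2}T_p(z)$, with $|\Gamma_+(z)|>|\Gamma_-(z)|$, and let $$P_+=\frac{z^{-p/2}T_p-\Gamma_-\mathbf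 1}{\Gamma_+-\Gamma_-},\quad a=\tfrac12\Big\langle\tbinom11,P_+\tbinom11\Big\rangle,\quad b=\tfrac12\Big\langle\tbinom1{-1},P_+\tbinom11\Big\rangle.$$ For an integer $b\ge0$ (not to be confused with the function $b(z)$) let $$j_b(z)=a(z)\varphi_b(z)+b(z)\psi_b(z),\qquad \tilde\jmath_b(z)=(1-a(z))\varphi_b(z)-b(z)\psi_b(z),$$ so that $\varphi_{mp+b}(z)=z^{mp/2}\big(j_b(z)\Gamma_+(z)^m+\tilde\jmath_b(z)\Gamma_-(z)^m\big)$ for all $m\ge0$. At a point $e^{i\theta}\in B$ the values of $\Gamma_+$, $j_b$, $\tilde\jmath_b$ are the limits, in the Riemann sphere $\mathbb C\cup\{\infty\}$, of their values at $re^{i\theta}$ as $r\uparrow1$. Let $dk$ be the (logarithmic) equilibrium measure of $B$. Fix a real $x_1$ with $\Delta(e^{ix_1})=2$, for example such a left endpoint of a band, and for $\theta\in[x_1,x_1+2\pi]$ let $k(\theta)=dk(\{e^{i\phi}: x_1<\phi<\theta\})$. **Proposition.** (i) For every $\theta\in[x_1,x_1+2\pi]$ with $e^{i\theta}\in B$,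 the limit $\Gamma_+(e^{i\theta})$ exists and $$\Gamma_+(e^{i\theta})=\exp(-i\pi p\,k(\theta)).$$ (ii) For every $b\ge0$ and every point $e^{i\theta}\in B$, the limits $j_b(e^{i\theta})$ and $\tilde\jmath_b(e^{i\theta})$ exist in $\mathbb C\cup\{\infty\}$, and they are not both $0$. (iii) For every $b\ge0$ and every $e^{i\theta}$ in the interior of $B$ relative to the unit circle (in particular in the interior of each band), $\tilde\jmath_b(e^{i\theta})$ is finite and nonzero. -/

import Mathlib

open Filter Topology MeasureTheory Polynomial

noncomputable section

namespace PeriodicOPUC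

/-! ### Orthonormal polynomials on the unit circle from their Verblunsky coefficients -/

/-- `ρ_n = (1 - |α_n|²)^{1/2}`. -/
def rho (α : ℕ → ℂ) (n : ℕ) : ℝ := Real.sqrt (1 - ‖α n‖ ^ 2)

/-- The Szegő dual of degree `n`: `P*(z) = z^n conj (P (1 / conj z))`, i.e. the coefficients are
conjugated and put in reverse order. -/
def szegoDual (n : ℕ) (P : ℂ[X]) : ℂ[X] := (P.map (starRingEnd ℂ)).reflect n

/-- The orthonormal polynomials `φ_n`:
`φ_0 = 1`, `φ_{n+1}(z) = ρ_n⁻¹ (z φ_n(z) - conj α_n φ_n*(z))`. -/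
def phi (α : ℕ → ℂ) : ℕ → ℂ[X]
  | 0 => 1
  | n + 1 => C ((rho α n : ℂ)⁻¹) *
      (X * phi α n - C (starRingEnd ℂ (α n)) * szegoDual n (phi α n))

/-- The second kind polynomials `ψ_n`: Verblunsky coefficients `-α_n`. -/
def psi (α : ℕ → ℂ) (n : ℕ) : ℂ[X] := phi (fun k => -α k) n

/-! ### Transfer matrices, discriminant, bands -/

/-- The one-step transfer matrix `A_k(z)`. -/
def stepMatrix (α : ℕ → ℂ) (k : ℕ) (z : ℂ) : Matrix (Fin 2) (Fin 2) ℂ :=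
  ((rho α k : ℂ)⁻¹) • !![z, -(starRingEnd ℂ (α k)); -(z * α k), 1]

/-- `T_n(z) = A_{n-1}(z) ⋯ A_0(z)`. -/
def transfer (α : ℕ → ℂ) : ℕ → ℂ → Matrix (Fin 2) (Fin 2) ℂ
  | 0, _ => 1
  | n + 1, z => stepMatrix α n z * transfer α n z

/-- `z^{-p/2} T_p(z)` (used for even `p`). -/
def monodromy (α : ℕ → ℂ) (p : ℕ) (z : ℂ) : Matrix (Fin 2) (Fin 2) ℂ :=
  (z ^ (p / 2))⁻¹ • transfer α p z

/-- The discriminant `Δ(z) = z^{-p/2} Tr T_p(z)`. -/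
def floquetDiscr (α : ℕ → ℂ) (p : ℕ) (z : ℂ) : ℂ := (monodromy α p z).trace

/-- The union of the bands: the points of the unit circle where `Δ ∈ [-2, 2]`. -/
def bands (α : ℕ → ℂ) (p : ℕ) : Set ℂ :=
  {z | ‖z‖ = 1 ∧ ∃ t : ℝ, t ∈ Set.Icc (-2 : ℝ) 2 ∧ floquetDiscr α p z = t}

/-- The interior of the union of the bands relative to the unit circle. It contains the interior
of every single band, and also the closed gaps. -/
def bandsInterior (α : ℕ → ℂ) (p : ℕ) : Set ℂ :=
  {z | z ∈ bands α p ∧ ∀ᶠ w in 𝓝[Metric.sphere (0 : ℂ) 1] z, w ∈ bands α p}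

/-! ### The eigenvalues `Γ_±` and the spectral projections -/

/-- A square root of `(Δ(z)/2)² - 1`. Its choice is immaterial. -/
def discrRoot (α : ℕ → ℂ) (p : ℕ) (z : ℂ) : ℂ :=
  ((floquetDiscr α p z / 2) ^ 2 - 1) ^ (1 / 2 : ℂ)

open Classical in
/-- `Γ_+(z)`: off the bands, the eigenvalue `Δ/2 ± √((Δ/2)² - 1)` of `z^{-p/2} T_p(z)` of the
larger modulus. -/
def gammaPlus (α : ℕ → ℂ) (p : ℕ) (z : ℂ) : ℂ :=
  if ‖floquetDiscr α p z / 2 - discrRoot α p z‖ ≤ ‖floquetDiscr α p z / 2 + discrRoot α p z‖ then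
    floquetDiscr α p z / 2 + discrRoot α p z
  else floquetDiscr α p z / 2 - discrRoot α p z

/-- `Γ_-(z)`: the other eigenvalue of `z^{-p/2} T_p(z)`. -/
def gammaMinus (α : ℕ → ℂ) (p : ℕ) (z : ℂ) : ℂ := floquetDiscr α p z - gammaPlus α p z

/-- `P_+ = (z^{-p/2} T_p(z) - Γ_- 1) / (Γ_+ - Γ_-)`. -/
def projPlus (α : ℕ → ℂ) (p : ℕ) (z : ℂ) : Matrix (Fin 2) (Fin 2) ℂ :=
  (gammaPlus α p z - gammaMinus α p z)⁻¹ •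
    (monodromy α p z - gammaMinus α p z • (1 : Matrix (Fin 2) (Fin 2) ℂ))

/-- `a(z) = ½ ⟨(1,1), P_+ (1,1)⟩`. -/
def coeffA (α : ℕ → ℂ) (p : ℕ) (z : ℂ) : ℂ :=
  1 / 2 * (![1, 1] ⬝ᵥ (projPlus α p z).mulVec ![1, 1])

/-- `b(z) = ½ ⟨(1,-1), P_+ (1,1)⟩`. -/
def coeffB (α : ℕ → ℂ) (p : ℕ) (z : ℂ) : ℂ :=
  1 / 2 * (![1, -1] ⬝ᵥ (projPlus α p z).mulVec ![1, 1])

/-- `j_b = a φ_b + b ψ_b`, the coefficient of `z^{mp/2} Γ_+^m` in `φ_{mp+b}`. -/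
def jost (α : ℕ → ℂ) (p b : ℕ) (z : ℂ) : ℂ :=
  coeffA α p z * (phi α b).eval z + coeffB α p z * (psi α b).eval z

/-- `j̃_b = (1 - a) φ_b - b ψ_b`, the coefficient of `z^{mp/2} Γ_-^m` in `φ_{mp+b}`. -/
def jostTilde (α : ℕ → ℂ) (p b : ℕ) (z : ℂ) : ℂ :=
  (1 - coeffA α p z) * (phi α b).eval z - coeffB α p z * (psi α b).eval z

/-- `L`, a complex number or `∞`, is the boundary value of `f` at `ζ` from inside the unit disk:
the limit of `f (r ζ)` as `r ↑ 1`, taken in the Riemann sphere. (At an endpoint of a band `j_b`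
and `j̃_b` usually have a pole.) -/
def RadialLimit (f : ℂ → ℂ) (ζ : ℂ) (L : OnePoint ℂ) : Prop :=
  Tendsto (fun r : ℝ => ((f ((r : ℂ) * ζ) : ℂ) : OnePoint ℂ)) (𝓝[<] (1 : ℝ)) (𝓝 L)

/-! ### Equilibrium measure -/

/-- The logarithmic energy `∬ log (1 / |z - w|) dμ(z) dμ(w)`, as the difference of the integrals
of the positive part (which is `∞` on the diagonal) and of the negative part. -/
def logEnergy (μ : Measure ℂ) : EReal :=
  ((∫⁻ z, ∫⁻ w, (-ENNReal.log (edist z w)).toENNReal ∂μ ∂μ : ENNReal) : EReal) -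
    ((∫⁻ z, ∫⁻ w, (ENNReal.log (edist z w)).toENNReal ∂μ ∂μ : ENNReal) : EReal)

/-- `μ` is an equilibrium measure of the compact set `K`: a probability measure carried by `K`, of
finite logarithmic energy, with the least energy among all probability measures carried by `K`. -/
def IsEquilibriumMeasure (K : Set ℂ) (μ : Measure ℂ) : Prop :=
  IsProbabilityMeasure μ ∧ μ Kᶜ = 0 ∧ logEnergy μ < ⊤ ∧
    ∀ ν : Measure ℂ, IsProbabilityMeasure ν → ν Kᶜ = 0 → logEnergy μ ≤ logEnergy ν

open Classical in
/-- The equilibrium measure of a compact set of positive capacity (`0` if there is none). -/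
def equilibriumMeasure (K : Set ℂ) : Measure ℂ :=
  if h : ∃ μ, IsEquilibriumMeasure K μ then h.choose else 0

/-- `k(θ) = dk {e^{iφ} | x₁ < φ < θ}`, where `dk` is the equilibrium measure of the bands. -/
def kFun (α : ℕ → ℂ) (p : ℕ) (x₁ θ : ℝ) : ℝ :=
  (equilibriumMeasure (bands α p)).real
    ((fun φ : ℝ => Complex.exp (φ * Complex.I)) '' Set.Ioo x₁ θ)

end PeriodicOPUC

end

open PeriodicOPUC

/-!
Everything rests on one property of the monodromy matrix `z^{-p/2} T_p`: it preserves the indefinite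
form `hform v = |v 0|² - |v 1|²` on the unit circle, decreases it strictly inside and increases it
strictly outside; inside, by at least `1 - |z|` times the Euclidean norm squared of `v`. An
eigenvalue of modulus one can therefore occur on the circle only, so
`Δ` takes values in `[-2, 2]` on the circle only (`norm_eq_one_of_floquetDiscr_eq`). In the disk
`Γ_+` and `Γ_-` are thus separated, and `z^{p/2} Γ_+` is analytic there (`regGamma`).

*Existence of the limits.* `j_b` and `j̃_b` have the form `(Y ± W / (z^{p/2} (Γ_+ - Γ_-))) / 2` with
polynomials `Y`, `W`, and `z^p (Γ_+ - Γ_-)²` is a polynomial. The square of the quotient is a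
rational function, which has a limit in the Riemann sphere along each radius; by continuity the
quotient itself has one (`exists_radialLimit`). As `j_b + j̃_b = φ_b` has no zero on the circle, the
two limits do not both vanish (`exists_radialLimit_jost`).

*Interior points.* At a point `ζ` of the interior of the bands `|Γ_+(rζ)| = 1 + O(1 - r)`; where
`Δ(ζ) = ±2` this holds because `Δ` has an extremum along the circle, hence a critical point
(`exists_norm_gammaPlus_sub_le`). Comparing the change of `hform` on an eigenvector with the defect
shows that the two eigenvectors `P_+ e` and `(1 - P_+) e`, `e = (1, 1)`, stay within fixed cones on
opposite sides of the null cone of `hform`. As their sum is fixed they are bounded, so their limits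
are finite, and `c = lim (1 - P_+) e` is nonzero with `hform c > 0`. Since `T_b(ζ)` preserves
`hform`, the first component of `T_b(ζ) c`, the limit of `j̃_b`, is not zero
(`exists_radialLimit_jostTilde_ne_zero`).

*Boundary values of `Γ_+`.* For `t = 2 cos (2πk/N)` the zeros of `Δ - t` lie in the bands, and the
product of `x + 1/x - 2 cos (2πk/N)` over `k` is explicit. A weak limit of the corresponding
zero-counting measures is a probability measure `ν` on the bands with Thouless' formula
`p ∫ log |1 - z w̄| dν(w) = log |z^{p/2} Γ_+(z)| + log ∏ ρ_k` in the disk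
(`exists_hasThoulessFormula`). As `|Γ_+| = 1` on the bands, the potential of `ν` is constant
there. The energy with the kernel `-log |1 - r z w̄|`, expanded in the moments of the measures, is
positive definite; with `r ↑ 1` it follows that `ν` has minimal energy and that every minimizer has
the moments of `ν`, hence the same potential. So the equilibrium measure exists, has no atoms and
satisfies Thouless' formula (`equilibriumMeasure_bands`). By the maximum principle the formula
holds without absolute values up to a constant factor, and on the boundary
`arg (1 - e^{iθ} w̄)` grows like `θ / 2` except for a jump of `-π` at `e^{iθ} = w`. Integrating this
from `x₁`, where `Γ_+ = 1`, to `θ` produces the phase `-π p k(θ)`; the drift `p θ / 2` is cancelled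
by the factor `z^{p/2}` (`radialLimit_gammaPlus`).
-/

namespace PeriodicOPUC

open Matrix

/-! ### The transfer matrices and an indefinite form -/

/-- The indefinite hermitian form `|v₀|² - |v₁|²`, which the transfer matrices preserve on the unit
circle. -/
noncomputable def hform (v : Fin 2 → ℂ) : ℝ := ‖v 0‖ ^ 2 - ‖v 1‖ ^ 2

/-- The square of the Euclidean norm on `ℂ²`. (`Fin 2 → ℂ` carries the sup norm.) -/
noncomputable def nsq (v : Fin 2 → ℂ) : ℝ := ‖v 0‖ ^ 2 + ‖v 1‖ ^ 2

lemma nsq_nonneg (v : Fin 2 → ℂ) : 0 ≤ nsq v := by unfold nsq; positivity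

lemma nsq_pos {v : Fin 2 → ℂ} (hv : v ≠ 0) : 0 < nsq v := by
  refine lt_of_le_of_ne (nsq_nonneg v) fun h => hv ?_
  have h0 : ‖v 0‖ ^ 2 = 0 := by unfold nsq at h; nlinarith [sq_nonneg ‖v 0‖, sq_nonneg ‖v 1‖]
  have h1 : ‖v 1‖ ^ 2 = 0 := by unfold nsq at h; nlinarith [sq_nonneg ‖v 0‖, sq_nonneg ‖v 1‖]
  ext i
  fin_cases i
  · simpa using h0
  · simpa using h1

lemma hform_smul (c : ℂ) (v : Fin 2 → ℂ) : hform (c • v) = ‖c‖ ^ 2 * hform v := by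
  simp [hform, mul_pow]; ring

lemma rho_pos {α : ℕ → ℂ} {k : ℕ} (h : ‖α k‖ < 1) : 0 < rho α k := by
  refine Real.sqrt_pos.2 ?_
  nlinarith [norm_nonneg (α k)]

lemma rho_sq {α : ℕ → ℂ} {k : ℕ} (h : ‖α k‖ < 1) : rho α k ^ 2 = 1 - ‖α k‖ ^ 2 :=
  Real.sq_sqrt (by nlinarith [norm_nonneg (α k)])

lemma hform_stepMatrix {α : ℕ → ℂ} {k : ℕ} (h : ‖α k‖ < 1) (z : ℂ) (v : Fin 2 → ℂ) :
    hform (stepMatrix α k z *ᵥ v) = ‖z‖ ^ 2 * ‖v 0‖ ^ 2 - ‖v 1‖ ^ 2 := by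
  have h1 := rho_sq h
  have h2 := rho_pos h
  have key : ∀ a b c : ℂ, ‖a - (starRingEnd ℂ) c * b‖ ^ 2 - ‖-(c * a) + b‖ ^ 2 =
      (1 - ‖c‖ ^ 2) * (‖a‖ ^ 2 - ‖b‖ ^ 2) := by
    intro a b c
    simp only [← Complex.normSq_eq_norm_sq, Complex.normSq_apply, Complex.sub_re, Complex.sub_im,
      Complex.mul_re, Complex.mul_im, Complex.add_re, Complex.add_im, Complex.neg_re,
      Complex.neg_im, Complex.conj_re, Complex.conj_im]
    ring
  have h3 := key (z * v 0) (v 1) (α k)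
  rw [stepMatrix, Matrix.smul_mulVec, hform_smul]
  have e0 : (!![z, -(starRingEnd ℂ) (α k); -(z * α k), 1] *ᵥ v) 0 =
      z * v 0 - (starRingEnd ℂ) (α k) * v 1 := by
    simp [Matrix.mulVec, dotProduct, Fin.sum_univ_two]; ring
  have e1 : (!![z, -(starRingEnd ℂ) (α k); -(z * α k), 1] *ᵥ v) 1 =
      -(α k * (z * v 0)) + v 1 := by
    simp [Matrix.mulVec, dotProduct, Fin.sum_univ_two]; ring
  rw [hform, e0, e1, h3, ← h1, norm_inv, Complex.norm_real, Real.norm_of_nonneg h2.le]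
  field_simp
  rw [norm_mul, mul_pow]

lemma hform_transfer_of_norm_eq_one {α : ℕ → ℂ} (hα : ∀ n, ‖α n‖ < 1) {z : ℂ} (hz : ‖z‖ = 1)
    (n : ℕ) (v : Fin 2 → ℂ) : hform (transfer α n z *ᵥ v) = hform v := by
  induction n with
  | zero => simp [transfer]
  | succ n ih =>
    rw [transfer, ← Matrix.mulVec_mulVec, hform_stepMatrix (hα n), hz, ← ih, hform]
    ring

/-- Inside the unit disk the transfer matrices, normalized by their determinants, decrease `hform`.
The defect `(1 - |z|) nsq v` is that of the first step alone; the later steps do not increase the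
form. -/
lemma hform_transfer_le {α : ℕ → ℂ} (hα : ∀ n, ‖α n‖ < 1) {z : ℂ} (hz : ‖z‖ ≤ 1)
    (n : ℕ) (v : Fin 2 → ℂ) :
    hform (transfer α (n + 1) z *ᵥ v) ≤ ‖z‖ ^ (n + 1) * (hform v - (1 - ‖z‖) * nsq v) := by
  have step : ∀ (k : ℕ) (w : Fin 2 → ℂ),
      hform (stepMatrix α k z *ᵥ w) ≤ ‖z‖ * (hform w - (1 - ‖z‖) * nsq w) := by
    intro k w
    rw [hform_stepMatrix (hα k), hform, nsq]
    nlinarith [mul_nonneg (sq_nonneg (1 - ‖z‖)) (sq_nonneg ‖w 1‖)]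
  induction n with
  | zero => simpa [transfer] using step 0 v
  | succ n ih =>
    rw [transfer, ← Matrix.mulVec_mulVec]
    refine (step _ _).trans ?_
    have h1 := nsq_nonneg (transfer α (n + 1) z *ᵥ v)
    have h0 := norm_nonneg z
    calc _ ≤ ‖z‖ * hform (transfer α (n + 1) z *ᵥ v) := by
          refine mul_le_mul_of_nonneg_left ?_ h0
          nlinarith
      _ ≤ ‖z‖ * (‖z‖ ^ (n + 1) * (hform v - (1 - ‖z‖) * nsq v)) :=
          mul_le_mul_of_nonneg_left ih h0
      _ = _ := by ring

/-- Outside the unit disk the transfer matrices, normalized by their determinants, increase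
`hform`. -/
lemma le_hform_transfer {α : ℕ → ℂ} (hα : ∀ n, ‖α n‖ < 1) {z : ℂ} (hz : 1 ≤ ‖z‖)
    (n : ℕ) (v : Fin 2 → ℂ) :
    ‖z‖ ^ n * (‖z‖ * hform v + (‖z‖ - 1) * nsq v) ≤ hform (transfer α (n + 1) z *ᵥ v) := by
  have step : ∀ (k : ℕ) (w : Fin 2 → ℂ),
      ‖z‖ * hform w + (‖z‖ - 1) * nsq w ≤ hform (stepMatrix α k z *ᵥ w) := by
    intro k w
    rw [hform_stepMatrix (hα k), hform, nsq]
    nlinarith [mul_nonneg (sq_nonneg (1 - ‖z‖)) (sq_nonneg ‖w 0‖)]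
  induction n with
  | zero => simpa [transfer] using step 0 v
  | succ n ih =>
    rw [transfer, ← Matrix.mulVec_mulVec]
    refine le_trans ?_ (step _ _)
    have h1 := nsq_nonneg (transfer α (n + 1) z *ᵥ v)
    have h0 := norm_nonneg z
    have h2 := mul_le_mul_of_nonneg_left ih h0
    rw [pow_succ]
    nlinarith

lemma det_transfer {α : ℕ → ℂ} (hα : ∀ n, ‖α n‖ < 1) (n : ℕ) (z : ℂ) :
    (transfer α n z).det = z ^ n := by
  induction n with
  | zero => simp [transfer]
  | succ n ih =>
    have h1 := rho_sq (hα n)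
    have h2 : (rho α n : ℂ) ≠ 0 := by exact_mod_cast (rho_pos (hα n)).ne'
    have h3 : (rho α n : ℂ) ^ 2 = 1 - α n * (starRingEnd ℂ) (α n) := by
      rw [Complex.mul_conj, Complex.normSq_eq_norm_sq]; exact_mod_cast h1
    have h4 : (stepMatrix α n z).det = z := by
      rw [stepMatrix, Matrix.det_smul, Matrix.det_fin_two_of, Fintype.card_fin, inv_pow]
      rw [inv_mul_eq_iff_eq_mul₀ (pow_ne_zero _ h2), h3]
      ring
    rw [transfer, Matrix.det_mul, h4, ih, pow_succ']

/-! ### The monodromy matrix: `Δ ∈ [-2, 2]` only on the circle -/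

section Monodromy

variable {α : ℕ → ℂ} {p : ℕ}

lemma norm_pow_half_sq (hpe : Even p) (z : ℂ) : ‖z ^ (p / 2)‖ ^ 2 = ‖z‖ ^ p := by
  obtain ⟨q, rfl⟩ := hpe
  rw [norm_pow, ← pow_mul]; congr 1; omega

lemma det_monodromy (hα : ∀ n, ‖α n‖ < 1) (hpe : Even p) {z : ℂ} (hz : z ≠ 0) :
    (monodromy α p z).det = 1 := by
  rw [monodromy, Matrix.det_smul, det_transfer hα, Fintype.card_fin, inv_pow, ← pow_mul,
    Nat.div_mul_cancel hpe.two_dvd, inv_mul_cancel₀ (pow_ne_zero _ hz)]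

lemma hform_monodromy (hpe : Even p) (z : ℂ) (v : Fin 2 → ℂ) :
    hform (monodromy α p z *ᵥ v) = (‖z‖ ^ p)⁻¹ * hform (transfer α p z *ᵥ v) := by
  rw [monodromy, Matrix.smul_mulVec, hform_smul, norm_inv, inv_pow, norm_pow_half_sq hpe]

lemma hform_monodromy_le (hα : ∀ n, ‖α n‖ < 1) (hp : 0 < p) (hpe : Even p) {z : ℂ} (hz : z ≠ 0)
    (hz1 : ‖z‖ ≤ 1) (v : Fin 2 → ℂ) :
    hform (monodromy α p z *ᵥ v) ≤ hform v - (1 - ‖z‖) * nsq v := by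
  obtain ⟨n, rfl⟩ : ∃ n, p = n + 1 := ⟨p - 1, by omega⟩
  rw [hform_monodromy hpe, inv_mul_le_iff₀ (pow_pos (norm_pos_iff.2 hz) _)]
  exact hform_transfer_le hα hz1 n v

lemma lt_hform_monodromy (hα : ∀ n, ‖α n‖ < 1) (hp : 0 < p) (hpe : Even p) {z : ℂ}
    (hz1 : 1 < ‖z‖) {v : Fin 2 → ℂ} (hv : v ≠ 0) :
    hform v < hform (monodromy α p z *ᵥ v) := by
  obtain ⟨n, rfl⟩ : ∃ n, p = n + 1 := ⟨p - 1, by omega⟩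
  have h0 : 0 < ‖z‖ := by linarith
  rw [hform_monodromy hpe, lt_inv_mul_iff₀ (pow_pos h0 _)]
  refine lt_of_lt_of_le ?_ (le_hform_transfer hα hz1.le n v)
  have := mul_pos (pow_pos h0 n) (mul_pos (sub_pos.2 hz1) (nsq_pos hv))
  rw [pow_succ]
  nlinarith

/-- For a real `t ∈ [-2, 2]`, a root of `x² - t x + 1` on the unit circle. -/
lemma exists_unimodular_root {t : ℝ} (ht : t ∈ Set.Icc (-2 : ℝ) 2) :
    ∃ l : ℂ, ‖l‖ = 1 ∧ l ^ 2 - t * l + 1 = 0 := by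
  have h : 0 ≤ 1 - (t / 2) ^ 2 := by nlinarith [ht.1, ht.2]
  refine ⟨⟨t / 2, Real.sqrt (1 - (t / 2) ^ 2)⟩, ?_, ?_⟩
  · have : ‖(⟨t / 2, Real.sqrt (1 - (t / 2) ^ 2)⟩ : ℂ)‖ ^ 2 = 1 := by
      rw [← Complex.normSq_eq_norm_sq, Complex.normSq_mk, Real.mul_self_sqrt h]; ring
    nlinarith [norm_nonneg (⟨t / 2, Real.sqrt (1 - (t / 2) ^ 2)⟩ : ℂ)]
  · have := Real.mul_self_sqrt h
    apply Complex.ext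
    · simp only [pow_two] at this ⊢; simp; linarith
    · simp [pow_two]; ring

/-- The discriminant takes values in `[-2, 2]` on the unit circle only: for such a value the
monodromy matrix has an eigenvector whose `hform` it preserves. -/
lemma norm_eq_one_of_floquetDiscr_eq (hα : ∀ n, ‖α n‖ < 1) (hp : 0 < p) (hpe : Even p) {z : ℂ}
    (hz : z ≠ 0) {t : ℝ} (ht : t ∈ Set.Icc (-2 : ℝ) 2) (h : floquetDiscr α p z = t) :
    ‖z‖ = 1 := by
  obtain ⟨l, hl1, hl⟩ := exists_unimodular_root ht
  have hdet : (monodromy α p z - l • (1 : Matrix (Fin 2) (Fin 2) ℂ)).det = 0 := by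
    have h1 := det_monodromy hα hpe hz
    rw [floquetDiscr, Matrix.trace_fin_two] at h
    rw [Matrix.det_fin_two] at h1 ⊢
    simp
    linear_combination hl + h1 - l * h
  obtain ⟨v, hv, hv0⟩ := Matrix.exists_mulVec_eq_zero_iff.2 hdet
  have hev : monodromy α p z *ᵥ v = l • v := by
    rw [Matrix.sub_mulVec, Matrix.smul_mulVec, Matrix.one_mulVec, sub_eq_zero] at hv0
    exact hv0
  have heq : hform (monodromy α p z *ᵥ v) = hform v := by rw [hev, hform_smul, hl1]; ring
  rcases lt_trichotomy ‖z‖ 1 with h1 | h1 | h1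
  · have := hform_monodromy_le hα hp hpe hz h1.le v
    have := mul_pos (sub_pos.2 h1) (nsq_pos hv)
    linarith
  · exact h1
  · have := lt_hform_monodromy hα hp hpe h1 hv
    linarith

/-! ### The eigenvalues `Γ_±` -/

lemma discrRoot_sq (z : ℂ) : discrRoot α p z ^ 2 = (floquetDiscr α p z / 2) ^ 2 - 1 := by
  rw [discrRoot, ← Complex.cpow_nat_mul]; norm_num

lemma gammaPlus_add_gammaMinus (z : ℂ) :
    gammaPlus α p z + gammaMinus α p z = floquetDiscr α p z := by
  rw [gammaMinus]; ring

lemma gammaPlus_mul_gammaMinus (z : ℂ) : gammaPlus α p z * gammaMinus α p z = 1 := by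
  have := discrRoot_sq (α := α) (p := p) z
  unfold gammaMinus gammaPlus
  split_ifs <;> linear_combination -this

lemma norm_gammaMinus_le (z : ℂ) : ‖gammaMinus α p z‖ ≤ ‖gammaPlus α p z‖ := by
  unfold gammaMinus gammaPlus
  have h1 : ∀ x y : ℂ, x - (x / 2 + y) = x / 2 - y := fun x y => by ring
  have h2 : ∀ x y : ℂ, x - (x / 2 - y) = x / 2 + y := fun x y => by ring
  split_ifs with h
  · rwa [h1]
  · rw [h2]; exact (not_le.1 h).le

lemma one_le_norm_gammaPlus (z : ℂ) : 1 ≤ ‖gammaPlus α p z‖ := by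
  have h1 := norm_gammaMinus_le (α := α) (p := p) z
  have h2 : ‖gammaPlus α p z‖ * ‖gammaMinus α p z‖ = 1 := by
    rw [← norm_mul, gammaPlus_mul_gammaMinus, norm_one]
  nlinarith [norm_nonneg (gammaPlus α p z), norm_nonneg (gammaMinus α p z)]

lemma gammaPlus_ne_zero (z : ℂ) : gammaPlus α p z ≠ 0 := by
  have := one_le_norm_gammaPlus (α := α) (p := p) z
  exact norm_pos_iff.1 (by linarith)

lemma gammaMinus_eq_inv (z : ℂ) : gammaMinus α p z = (gammaPlus α p z)⁻¹ :=
  eq_inv_of_mul_eq_one_right (gammaPlus_mul_gammaMinus z)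

/-- Two numbers of modulus and product `1` are conjugate, so their sum is in `[-2, 2]`. -/
lemma mem_Icc_of_norm_eq_one {x y : ℂ} (hxy : x * y = 1) (hx : ‖x‖ = 1) :
    ∃ t : ℝ, t ∈ Set.Icc (-2 : ℝ) 2 ∧ x + y = t := by
  have hy : y = (starRingEnd ℂ) x := by
    have h1 : x * (starRingEnd ℂ) x = 1 := by
      rw [Complex.mul_conj, Complex.normSq_eq_norm_sq, hx]; norm_num
    have h0 : x ≠ 0 := left_ne_zero_of_mul_eq_one hxy
    exact mul_left_cancel₀ h0 (hxy.trans h1.symm)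
  refine ⟨2 * x.re, ?_, ?_⟩
  · have := Complex.abs_re_le_norm x
    rw [hx, abs_le] at this
    constructor <;> linarith [this.1, this.2]
  · rw [hy, Complex.add_conj]

lemma one_lt_norm_gammaPlus (hα : ∀ n, ‖α n‖ < 1) (hp : 0 < p) (hpe : Even p) {z : ℂ}
    (hz : z ≠ 0) (hz1 : ‖z‖ ≠ 1) : 1 < ‖gammaPlus α p z‖ := by
  refine lt_of_le_of_ne (one_le_norm_gammaPlus z) fun h => hz1 ?_
  obtain ⟨t, ht, h1⟩ := mem_Icc_of_norm_eq_one (gammaPlus_mul_gammaMinus z) h.symm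
  rw [gammaPlus_add_gammaMinus] at h1
  exact norm_eq_one_of_floquetDiscr_eq hα hp hpe hz ht h1

/-- `Γ_+` is the only root of modulus larger than `1` of the characteristic polynomial. -/
lemma eq_gammaPlus {z x y : ℂ} (hxy : x * y = 1) (hs : x + y = floquetDiscr α p z)
    (hx : 1 < ‖x‖) : gammaPlus α p z = x := by
  have h : (gammaPlus α p z - x) * (gammaPlus α p z - y) = 0 := by
    have h1 := gammaPlus_mul_gammaMinus (α := α) (p := p) z
    have h2 := gammaPlus_add_gammaMinus (α := α) (p := p) z
    linear_combination hxy - h1 + gammaPlus α p z * (h2 - hs)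
  rcases mul_eq_zero.1 h with h | h
  · exact sub_eq_zero.1 h
  · exfalso
    have h1 := one_le_norm_gammaPlus (α := α) (p := p) z
    rw [sub_eq_zero.1 h] at h1
    have h2 : ‖x‖ * ‖y‖ = 1 := by rw [← norm_mul, hxy, norm_one]
    nlinarith

end Monodromy

/-! ### The transfer matrices as matrices of polynomials -/

/-- The transfer matrix `T_n` with polynomial entries. -/
noncomputable def transferPoly (α : ℕ → ℂ) : ℕ → Matrix (Fin 2) (Fin 2) ℂ[X]
  | 0 => 1
  | n + 1 => !![C ((rho α n : ℂ)⁻¹) * X, -C ((rho α n : ℂ)⁻¹ * (starRingEnd ℂ) (α n));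
      -(C ((rho α n : ℂ)⁻¹ * α n) * X), C ((rho α n : ℂ)⁻¹)] * transferPoly α n

/-- The polynomial `z^{p/2} Δ(z) = Tr T_p(z)`. -/
noncomputable def discrPoly (α : ℕ → ℂ) (p : ℕ) : ℂ[X] := (transferPoly α p).trace

/-- `∏_{k<n} ρ_k⁻¹`, the leading and the constant coefficient of the polynomial `Tr T_n` for
`n > 0`, as a complex number. -/
noncomputable def leadConst (α : ℕ → ℂ) (n : ℕ) : ℂ := ∏ k ∈ Finset.range n, (rho α k : ℂ)⁻¹

section TransferPoly

variable {α : ℕ → ℂ} {p : ℕ}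

lemma leadConst_ne_zero (hα : ∀ n, ‖α n‖ < 1) (n : ℕ) : leadConst α n ≠ 0 :=
  Finset.prod_ne_zero_iff.2 fun k _ => inv_ne_zero (by exact_mod_cast (rho_pos (hα k)).ne')

lemma transferPoly_succ_zero (n : ℕ) (j : Fin 2) : transferPoly α (n + 1) 0 j =
    C ((rho α n : ℂ)⁻¹) * (X * transferPoly α n 0 j) -
      C ((rho α n : ℂ)⁻¹ * (starRingEnd ℂ) (α n)) * transferPoly α n 1 j := by
  rw [transferPoly, Matrix.mul_apply, Fin.sum_univ_two]
  simp [-map_mul]; ring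

lemma transferPoly_succ_one (n : ℕ) (j : Fin 2) : transferPoly α (n + 1) 1 j =
    C ((rho α n : ℂ)⁻¹) * transferPoly α n 1 j -
      C ((rho α n : ℂ)⁻¹ * α n) * (X * transferPoly α n 0 j) := by
  rw [transferPoly, Matrix.mul_apply, Fin.sum_univ_two]
  simp [-map_mul]; ring

lemma eval_transferPoly (n : ℕ) (z : ℂ) (i j : Fin 2) :
    (transferPoly α n i j).eval z = transfer α n z i j := by
  induction n generalizing i j with
  | zero => simp [transferPoly, transfer, Matrix.one_apply]; split_ifs <;> simp
  | succ n ih =>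
    rw [transfer, Matrix.mul_apply, Fin.sum_univ_two]
    fin_cases i
    · simp only [Fin.zero_eta, transferPoly_succ_zero, eval_sub, eval_mul, eval_C, eval_X, ih,
        stepMatrix, Matrix.smul_apply]
      simp; ring
    · simp only [Fin.mk_one, transferPoly_succ_one, eval_sub, eval_mul, eval_C, eval_X, ih,
        stepMatrix, Matrix.smul_apply]
      simp; ring

lemma natDegree_transferPoly_le (n : ℕ) (i j : Fin 2) : (transferPoly α n i j).natDegree ≤ n := by
  induction n generalizing i j with
  | zero =>
    rw [transferPoly, Matrix.one_apply]
    split_ifs <;> simp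
  | succ n ih =>
    have hX : (X * transferPoly α n 0 j).natDegree ≤ n + 1 := by
      refine natDegree_mul_le.trans ?_
      have := ih 0 j
      rw [natDegree_X]; omega
    have h1 : (transferPoly α n 1 j).natDegree ≤ n + 1 := (ih 1 j).trans n.le_succ
    fin_cases i
    · simp only [Fin.zero_eta, transferPoly_succ_zero]
      exact (natDegree_sub_le_of_le ((natDegree_C_mul_le _ _).trans hX)
        ((natDegree_C_mul_le _ _).trans h1)).trans_eq (max_self _)
    · simp only [Fin.mk_one, transferPoly_succ_one]
      exact (natDegree_sub_le_of_le ((natDegree_C_mul_le _ _).trans h1)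
        ((natDegree_C_mul_le _ _).trans hX)).trans_eq (max_self _)

lemma coeff_top_transferPoly (n : ℕ) : (transferPoly α n 0 0).coeff n = leadConst α n ∧
    (transferPoly α n 0 1).coeff n = 0 := by
  induction n with
  | zero => simp [transferPoly, leadConst]
  | succ n ih =>
    have h := fun j => coeff_eq_zero_of_natDegree_lt
      ((natDegree_transferPoly_le (α := α) n 1 j).trans_lt n.lt_succ_self)
    rw [transferPoly_succ_zero, transferPoly_succ_zero]
    simp only [coeff_sub, coeff_C_mul, coeff_X_mul, h, ih.1, ih.2]
    simp [leadConst, Finset.prod_range_succ, mul_comm]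

lemma coeff_zero_transferPoly (n : ℕ) : (transferPoly α n 1 0).coeff 0 = 0 ∧
    (transferPoly α n 1 1).coeff 0 = leadConst α n := by
  induction n with
  | zero => simp [transferPoly, leadConst]
  | succ n ih =>
    rw [transferPoly_succ_one, transferPoly_succ_one]
    simp only [coeff_sub, coeff_C_mul, coeff_X_mul_zero, ih.1, ih.2]
    simp [leadConst, Finset.prod_range_succ, mul_comm]

lemma discrPoly_eq : discrPoly α p = transferPoly α p 0 0 + transferPoly α p 1 1 :=
  Matrix.trace_fin_two _

lemma coeff_top_discrPoly (hp : 0 < p) : (discrPoly α p).coeff p = leadConst α p := by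
  obtain ⟨n, rfl⟩ : ∃ n, p = n + 1 := ⟨p - 1, by omega⟩
  have h := coeff_eq_zero_of_natDegree_lt
    ((natDegree_transferPoly_le (α := α) n 1 1).trans_lt n.lt_succ_self)
  rw [discrPoly_eq, coeff_add, (coeff_top_transferPoly _).1, transferPoly_succ_one]
  simp only [coeff_sub, coeff_C_mul, coeff_X_mul, h, (coeff_top_transferPoly n).2]
  simp

lemma coeff_zero_discrPoly (hp : 0 < p) : (discrPoly α p).coeff 0 = leadConst α p := by
  obtain ⟨n, rfl⟩ : ∃ n, p = n + 1 := ⟨p - 1, by omega⟩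
  rw [discrPoly_eq, coeff_add, (coeff_zero_transferPoly _).2, transferPoly_succ_zero]
  simp only [coeff_sub, coeff_C_mul, coeff_X_mul_zero, (coeff_zero_transferPoly n).1]
  simp

lemma natDegree_discrPoly_le : (discrPoly α p).natDegree ≤ p := by
  rw [discrPoly_eq]
  exact natDegree_add_le_of_degree_le (natDegree_transferPoly_le _ _ _)
    (natDegree_transferPoly_le _ _ _)

lemma eval_discrPoly (z : ℂ) (hz : z ≠ 0) :
    (discrPoly α p).eval z = z ^ (p / 2) * floquetDiscr α p z := by
  rw [discrPoly_eq, eval_add, eval_transferPoly, eval_transferPoly, floquetDiscr, monodromy,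
    Matrix.trace_smul, smul_eq_mul, mul_inv_cancel_left₀ (pow_ne_zero _ hz), Matrix.trace_fin_two]

lemma floquetDiscr_eq (z : ℂ) :
    floquetDiscr α p z = (z ^ (p / 2))⁻¹ * (discrPoly α p).eval z := by
  rw [discrPoly_eq, eval_add, eval_transferPoly, eval_transferPoly, floquetDiscr, monodromy,
    Matrix.trace_smul, smul_eq_mul, Matrix.trace_fin_two]

/-! ### Orthonormal polynomials and transfer matrices -/

lemma natDegree_phi_le (n : ℕ) : (phi α n).natDegree ≤ n := by
  induction n with
  | zero => simp [phi]
  | succ n ih =>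
    rw [phi]
    refine (natDegree_C_mul_le _ _).trans
      ((natDegree_sub_le_of_le (m := n + 1) (n := n + 1) ?_ ?_).trans_eq (max_self _))
    · refine natDegree_mul_le.trans ?_
      rw [natDegree_X]; omega
    · refine (natDegree_C_mul_le _ _).trans ?_
      rw [szegoDual]
      refine natDegree_reflect_le.trans (max_le n.le_succ ?_)
      rw [natDegree_map]; omega

lemma szegoDual_phi_succ (n : ℕ) : szegoDual (n + 1) (phi α (n + 1)) =
    C ((rho α n : ℂ)⁻¹) * (szegoDual n (phi α n) - C (α n) * (X * phi α n)) := by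
  have hdeg := natDegree_phi_le (α := α) n
  ext i
  rw [szegoDual, phi, coeff_reflect, coeff_map, coeff_C_mul, coeff_C_mul, coeff_sub, coeff_sub,
    coeff_C_mul, coeff_C_mul, map_mul, map_sub, map_mul, szegoDual, coeff_reflect, coeff_reflect,
    coeff_map, coeff_map]
  simp only [map_inv₀, Complex.conj_ofReal, Complex.conj_conj]
  congr 1
  rcases i with _ | i
  · rw [revAt_le (Nat.zero_le _), revAt_le (Nat.zero_le _), coeff_X_mul_zero]
    simp only [Nat.sub_zero, coeff_X_mul]
    rw [revAt_eq_self_of_lt n.lt_succ_self,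
      coeff_eq_zero_of_natDegree_lt (hdeg.trans_lt n.lt_succ_self)]
  · rw [coeff_X_mul]
    rcases lt_trichotomy i n with hi | hi | hi
    · obtain ⟨k, rfl⟩ : ∃ k, n = i + 1 + k := ⟨n - (i + 1), by omega⟩
      rw [revAt_le (show i + 1 ≤ i + 1 + k + 1 by omega),
        revAt_le (show i + 1 ≤ i + 1 + k by omega)]
      have e1 : i + 1 + k + 1 - (i + 1) = k + 1 := by omega
      have e2 : i + 1 + k - (i + 1) = k := by omega
      rw [e1, e2, coeff_X_mul, revAt_le (by omega)]
      have e3 : i + 1 + k - (k + 1) = i := by omega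
      rw [e3]
    · subst hi
      rw [revAt_le le_rfl, Nat.sub_self, coeff_X_mul_zero, revAt_eq_self_of_lt i.lt_succ_self,
        revAt_le (Nat.zero_le _), Nat.sub_zero,
        coeff_eq_zero_of_natDegree_lt (hdeg.trans_lt i.lt_succ_self)]
    · rw [revAt_eq_self_of_lt (by omega), revAt_eq_self_of_lt (by omega), coeff_X_mul,
        coeff_eq_zero_of_natDegree_lt (show (phi α n).natDegree < i by omega),
        coeff_eq_zero_of_natDegree_lt (show (phi α n).natDegree < i + 1 by omega)]

lemma transfer_mulVec_one_one (n : ℕ) (z : ℂ) : transfer α n z *ᵥ ![1, 1] =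
    ![(phi α n).eval z, (szegoDual n (phi α n)).eval z] := by
  induction n with
  | zero => simp [transfer, phi, szegoDual]
  | succ n ih =>
    rw [transfer, ← Matrix.mulVec_mulVec, ih, szegoDual_phi_succ, phi, stepMatrix,
      Matrix.smul_mulVec]
    ext i
    fin_cases i
    · simp [-mul_eq_mul_left_iff]; ring
    · simp [-mul_eq_mul_left_iff]; ring

/-- Changing the sign of the Verblunsky coefficients conjugates the transfer matrices by
`diag (1, -1)`. -/
lemma transfer_neg (n : ℕ) (z : ℂ) : transfer (fun k => -α k) n z =
    !![1, 0; 0, -1] * transfer α n z * !![1, 0; 0, -1] := by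
  have hJ : (!![1, 0; 0, -1] * !![1, 0; 0, -1] : Matrix (Fin 2) (Fin 2) ℂ) = 1 := by
    ext i j; fin_cases i <;> fin_cases j <;> simp
  induction n with
  | zero => simp [transfer, hJ]
  | succ n ih =>
    have hs : stepMatrix (fun k => -α k) n z =
        !![1, 0; 0, -1] * stepMatrix α n z * !![1, 0; 0, -1] := by
      have : rho (fun k => -α k) n = rho α n := by simp [rho]
      rw [stepMatrix, stepMatrix, this]
      ext i j
      fin_cases i <;> fin_cases j <;> simp
    rw [transfer, transfer, ih, hs]
    calc _ = !![1, 0; 0, -1] * stepMatrix α n z * (!![1, 0; 0, -1] * !![1, 0; 0, -1]) *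
          (transfer α n z * !![1, 0; 0, -1]) := by simp only [Matrix.mul_assoc]
      _ = _ := by rw [hJ]; simp only [Matrix.mul_assoc, Matrix.mul_one]

lemma transfer_mulVec_one_neg_one (n : ℕ) (z : ℂ) : (transfer α n z *ᵥ ![1, -1]) 0 =
    (psi α n).eval z := by
  have h := congrFun (transfer_mulVec_one_one (α := fun k => -α k) n z) 0
  rw [transfer_neg, Matrix.mul_assoc, ← Matrix.mulVec_mulVec, ← Matrix.mulVec_mulVec] at h
  simp [Matrix.mulVec, dotProduct, Fin.sum_univ_two] at h
  simpa [Matrix.mulVec, dotProduct, Fin.sum_univ_two, psi] using h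

/-- The polynomials `φ_n` have no zeros on the unit circle, since `hform (φ_n, φ_n*) = 0` there and
`T_n` is invertible. -/
lemma eval_phi_ne_zero (hα : ∀ n, ‖α n‖ < 1) {z : ℂ} (hz : ‖z‖ = 1) (n : ℕ) :
    (phi α n).eval z ≠ 0 := by
  intro h0
  have h1 := hform_transfer_of_norm_eq_one hα hz n ![1, 1]
  rw [transfer_mulVec_one_one] at h1
  have h2 : (szegoDual n (phi α n)).eval z = 0 := by simpa [hform, h0] using h1
  have h3 := transfer_mulVec_one_one (α := α) n z
  rw [h0, h2] at h3
  have hdet : (transfer α n z).det = 0 :=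
    Matrix.exists_mulVec_eq_zero_iff.1 ⟨![1, 1], by simp, by rw [h3]; simp⟩
  rw [det_transfer hα] at hdet
  have hz0 : z ≠ 0 := by rintro rfl; simp at hz
  exact pow_ne_zero n hz0 hdet

lemma jost_eq (b : ℕ) (z : ℂ) : jost α p b z =
    (transfer α b z *ᵥ (projPlus α p z *ᵥ ![1, 1])) 0 := by
  have h : projPlus α p z *ᵥ ![1, 1] = coeffA α p z • ![1, 1] + coeffB α p z • ![1, -1] := by
    ext i
    fin_cases i <;> simp [coeffA, coeffB, dotProduct, Fin.sum_univ_two] <;> ring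
  rw [h, Matrix.mulVec_add, Matrix.mulVec_smul, Matrix.mulVec_smul, jost, Pi.add_apply,
    Pi.smul_apply, Pi.smul_apply, transfer_mulVec_one_neg_one, transfer_mulVec_one_one]
  simp

lemma jost_add_jostTilde (b : ℕ) (z : ℂ) :
    jost α p b z + jostTilde α p b z = (phi α b).eval z := by
  rw [jost, jostTilde]; ring

end TransferPoly

/-! ### Radial limits of rational functions and of their square roots -/

lemma tendsto_coe_infty_of_norm {ι : Type*} {l : Filter ι} {f : ι → ℂ}
    (h : Tendsto (fun i => ‖f i‖) l atTop) :
    Tendsto (fun i => (f i : OnePoint ℂ)) l (𝓝 OnePoint.infty) := by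
  have h1 : Tendsto f l (Filter.coclosedCompact ℂ) := by
    rw [Filter.coclosedCompact_eq_cocompact, ← Metric.cobounded_eq_cocompact]
    exact tendsto_norm_atTop_iff_cobounded.1 h
  exact OnePoint.tendsto_coe_infty.comp h1

lemma tendsto_norm_of_coe_infty {ι : Type*} {l : Filter ι} {f : ι → ℂ}
    (h : Tendsto (fun i => (f i : OnePoint ℂ)) l (𝓝 OnePoint.infty)) :
    Tendsto (fun i => ‖f i‖) l atTop := by
  rw [tendsto_norm_atTop_iff_cobounded, Metric.cobounded_eq_cocompact,
    ← Filter.coclosedCompact_eq_cocompact, ← OnePoint.comap_coe_nhds_infty]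
  exact tendsto_comap_iff.2 h

lemma tendsto_coe_iff {ι : Type*} {l : Filter ι} {f : ι → ℂ} {c : ℂ} :
    Tendsto (fun i => (f i : OnePoint ℂ)) l (𝓝 (c : OnePoint ℂ)) ↔ Tendsto f l (𝓝 c) :=
  (OnePoint.isOpenEmbedding_coe.tendsto_nhds_iff).symm

lemma tendsto_radius (ζ : ℂ) : Tendsto (fun r : ℝ => (r : ℂ) * ζ) (𝓝[<] 1) (𝓝 ζ) := by
  have : Continuous fun r : ℝ => (r : ℂ) * ζ := by fun_prop
  have h := this.tendsto 1
  simp only [Complex.ofReal_one, one_mul] at h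
  exact h.mono_left nhdsWithin_le_nhds

lemma radius_mem {ζ : ℂ} (hζ : ‖ζ‖ = 1) {r : ℝ} (hr : r ∈ Set.Ioo (0 : ℝ) 1) :
    (r : ℂ) * ζ ≠ 0 ∧ ‖(r : ℂ) * ζ‖ = r ∧ ‖(r : ℂ) * ζ‖ < 1 := by
  have hζ0 : ζ ≠ 0 := by rintro rfl; simp at hζ
  have h : ‖(r : ℂ) * ζ‖ = r := by
    rw [norm_mul, hζ, mul_one, Complex.norm_real, Real.norm_of_nonneg hr.1.le]
  exact ⟨mul_ne_zero (by exact_mod_cast hr.1.ne') hζ0, h, h.trans_lt hr.2⟩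

lemma norm_radius_sub {ζ : ℂ} (hζ : ‖ζ‖ = 1) {r : ℝ} (hr : r ∈ Set.Ioo (0 : ℝ) 1) :
    ‖(r : ℂ) * ζ - ζ‖ = 1 - r := by
  have : (r : ℂ) * ζ - ζ = ((r - 1 : ℝ) : ℂ) * ζ := by push_cast; ring
  rw [this, norm_mul, hζ, mul_one, Complex.norm_real, Real.norm_eq_abs, abs_of_nonpos
    (by linarith [hr.2])]
  ring

lemma tendsto_eval_radius (A : ℂ[X]) (ζ : ℂ) :
    Tendsto (fun r : ℝ => A.eval ((r : ℂ) * ζ)) (𝓝[<] 1) (𝓝 (A.eval ζ)) :=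
  (A.continuous.tendsto ζ).comp (tendsto_radius ζ)

lemma eventually_mem_Ioo : ∀ᶠ r : ℝ in 𝓝[<] 1, r ∈ Set.Ioo (0 : ℝ) 1 :=
  Ioo_mem_nhdsLT one_pos

/-- A rational function has a radial limit in the Riemann sphere at every point. -/
lemma exists_tendsto_eval_div {A B : ℂ[X]} (hB : B ≠ 0) {ζ : ℂ} (hζ : ζ ≠ 0) :
    ∃ L : OnePoint ℂ, Tendsto (fun r : ℝ =>
      ((A.eval ((r : ℂ) * ζ) / B.eval ((r : ℂ) * ζ) : ℂ) : OnePoint ℂ)) (𝓝[<] 1) (𝓝 L) := by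
  rcases eq_or_ne A 0 with rfl | hA
  · exact ⟨((0 : ℂ) : OnePoint ℂ), by simp⟩
  obtain ⟨A1, hA1, hA1'⟩ := exists_eq_pow_rootMultiplicity_mul_and_not_dvd A hA ζ
  obtain ⟨B1, hB1, hB1'⟩ := exists_eq_pow_rootMultiplicity_mul_and_not_dvd B hB ζ
  rw [dvd_iff_isRoot, IsRoot.def] at hA1' hB1'
  set m := rootMultiplicity ζ A
  set n := rootMultiplicity ζ B
  have hlim : Tendsto (fun r : ℝ => A1.eval ((r : ℂ) * ζ) / B1.eval ((r : ℂ) * ζ)) (𝓝[<] 1)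
      (𝓝 (A1.eval ζ / B1.eval ζ)) :=
    (tendsto_eval_radius A1 ζ).div (tendsto_eval_radius B1 ζ) hB1'
  have hd : Tendsto (fun r : ℝ => (r : ℂ) * ζ - ζ) (𝓝[<] 1) (𝓝 0) := by
    simpa using (tendsto_radius ζ).sub_const ζ
  have hne : ∀ᶠ r : ℝ in 𝓝[<] 1, (r : ℂ) * ζ - ζ ≠ 0 := by
    filter_upwards [eventually_mem_Ioo] with r hr h
    have h1 : ((r : ℂ) - 1) * ζ = 0 := by rw [← h]; ring
    rcases mul_eq_zero.1 h1 with h2 | h2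
    · have : r = 1 := by exact_mod_cast sub_eq_zero.1 h2
      exact hr.2.ne this
    · exact hζ h2
  have hAe : ∀ z, A.eval z = (z - ζ) ^ m * A1.eval z := fun z => by
    conv_lhs => rw [hA1]
    simp
  have hBe : ∀ z, B.eval z = (z - ζ) ^ n * B1.eval z := fun z => by
    conv_lhs => rw [hB1]
    simp
  rcases le_or_gt n m with hnm | hnm
  · obtain ⟨k, hk⟩ := Nat.exists_eq_add_of_le hnm
    refine ⟨(((0 : ℂ) ^ k * (A1.eval ζ / B1.eval ζ) : ℂ) : OnePoint ℂ), ?_⟩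
    rw [tendsto_coe_iff]
    refine ((hd.pow k).mul hlim).congr' ?_
    filter_upwards [hne] with r hr
    rw [hAe, hBe, hk, pow_add]
    generalize (r : ℂ) * ζ - ζ = x at hr ⊢
    have hx := pow_ne_zero n hr
    field_simp
  · obtain ⟨k, hk⟩ := Nat.exists_eq_add_of_lt hnm
    refine ⟨OnePoint.infty, tendsto_coe_infty_of_norm ?_⟩
    have h0 : Tendsto (fun r : ℝ => ‖((r : ℂ) * ζ - ζ)⁻¹‖) (𝓝[<] 1) atTop := by
      simp_rw [norm_inv]
      refine tendsto_inv_nhdsGT_zero.comp (tendsto_nhdsWithin_iff.2 ⟨?_, ?_⟩)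
      · simpa using hd.norm
      · filter_upwards [hne] with r hr using norm_pos_iff.2 hr
    have h1 : Tendsto (fun r : ℝ => ‖((r : ℂ) * ζ - ζ)⁻¹‖ ^ (k + 1)) (𝓝[<] 1) atTop :=
      (tendsto_pow_atTop k.succ_ne_zero).comp h0
    have h2 := h1.atTop_mul_pos (norm_pos_iff.2 (div_ne_zero hA1' hB1')) hlim.norm
    refine h2.congr' ?_
    filter_upwards [hne] with r hr
    rw [hAe, hBe, hk, ← norm_pow, ← norm_mul]
    congr 1
    rw [show m + k + 1 = m + (k + 1) by ring, pow_add]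
    generalize (r : ℂ) * ζ - ζ = x at hr ⊢
    have hx := pow_ne_zero m hr
    have hx' := pow_ne_zero (k + 1) hr
    rw [inv_pow]
    field_simp
    ring

/-- A continuous function whose square tends to `1` tends to `1` or to `-1`. -/
lemma exists_tendsto_of_sq_tendsto_one {g : ℝ → ℂ} (hg : ContinuousOn g (Set.Ioo 0 1))
    (h : Tendsto (fun r => g r ^ 2) (𝓝[<] 1) (𝓝 1)) :
    ∃ ε : ℂ, ε ^ 2 = 1 ∧ Tendsto g (𝓝[<] 1) (𝓝 ε) := by
  have hev : ∀ᶠ r in 𝓝[<] (1 : ℝ), ‖g r ^ 2 - 1‖ < 1 := by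
    have := (tendsto_iff_norm_sub_tendsto_zero.1 h).eventually (gt_mem_nhds one_pos)
    exact this
  obtain ⟨r₀, hr₀, hsub⟩ := (mem_nhdsLT_iff_exists_Ioo_subset' (show (0 : ℝ) < 1 by norm_num)).1
    (hev.and eventually_mem_Ioo)
  have hre : ∀ r ∈ Set.Ioo r₀ 1, (g r).re ≠ 0 := by
    intro r hr h0
    have h1 := (hsub hr).1
    have h2 := (Complex.abs_re_le_norm (g r ^ 2 - 1)).trans_lt h1
    simp [pow_two, h0] at h2
    rw [abs_lt] at h2
    nlinarith [mul_self_nonneg (g r).im]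
  have hcont : ContinuousOn (fun r => (g r).re) (Set.Ioo r₀ 1) :=
    Complex.continuous_re.comp_continuousOn (hg.mono fun r hr => (hsub hr).2)
  have hconv : ∀ {f : ℝ → ℂ}, Tendsto (fun r => f r ^ 2) (𝓝[<] 1) (𝓝 1) →
      (∀ᶠ r in 𝓝[<] (1 : ℝ), 0 < (f r).re) → Tendsto f (𝓝[<] 1) (𝓝 1) := by
    intro f hf hpos
    rw [tendsto_iff_norm_sub_tendsto_zero] at hf ⊢
    refine tendsto_of_tendsto_of_tendsto_of_le_of_le' tendsto_const_nhds hf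
      (Eventually.of_forall fun _ => norm_nonneg _) ?_
    filter_upwards [hpos] with r hr
    have h1 : 1 ≤ ‖f r + 1‖ := by
      have := Complex.re_le_norm (f r + 1)
      simp at this
      linarith
    calc ‖f r - 1‖ ≤ ‖f r - 1‖ * ‖f r + 1‖ := le_mul_of_one_le_right (norm_nonneg _) h1
      _ = ‖f r ^ 2 - 1‖ := by rw [← norm_mul]; congr 1; ring
  have hIoo : Set.Ioo r₀ 1 ∈ 𝓝[<] (1 : ℝ) := Ioo_mem_nhdsLT hr₀
  by_cases hp : ∃ a ∈ Set.Ioo r₀ 1, 0 < (g a).re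
  · obtain ⟨a, ha, ha0⟩ := hp
    refine ⟨1, by norm_num, hconv h ?_⟩
    filter_upwards [hIoo] with r hr
    by_contra hneg
    obtain ⟨c, hc, hc0⟩ := isPreconnected_Ioo.intermediate_value hr ha hcont
      (show (0 : ℝ) ∈ Set.Icc (g r).re (g a).re from ⟨not_lt.1 hneg, ha0.le⟩)
    exact hre c hc hc0
  · push Not at hp
    refine ⟨-1, by norm_num, ?_⟩
    have := hconv (f := fun r => -g r) (by simpa using h) (by
      filter_upwards [hIoo] with r hr
      have := lt_of_le_of_ne (hp r hr) (hre r hr)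
      simpa using this)
    simpa using this.neg

/-- A continuous function whose square converges does so itself: it cannot jump between the two
square roots of the limit. -/
lemma exists_tendsto_of_sq_tendsto {g : ℝ → ℂ} (hg : ContinuousOn g (Set.Ioo 0 1)) {c : ℂ}
    (h : Tendsto (fun r => g r ^ 2) (𝓝[<] 1) (𝓝 c)) :
    ∃ d : ℂ, d ^ 2 = c ∧ Tendsto g (𝓝[<] 1) (𝓝 d) := by
  rcases eq_or_ne c 0 with rfl | hc
  · refine ⟨0, by norm_num, ?_⟩
    rw [tendsto_zero_iff_norm_tendsto_zero] at h ⊢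
    simp only [norm_pow] at h
    have := (Real.continuous_sqrt.tendsto 0).comp h
    simpa [Function.comp_def, Real.sqrt_sq (norm_nonneg _)] using this
  · obtain ⟨d, hd⟩ := IsAlgClosed.exists_pow_nat_eq c two_pos
    have hd0 : d ≠ 0 := by rintro rfl; simp at hd; exact hc hd.symm
    have h1 : Tendsto (fun r => (g r / d) ^ 2) (𝓝[<] 1) (𝓝 1) := by
      have := h.div_const c
      rw [div_self hc] at this
      simpa [div_pow, hd] using this
    obtain ⟨ε, hε, hlim⟩ := exists_tendsto_of_sq_tendsto_one (hg.div_const d) h1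
    refine ⟨ε * d, by rw [mul_pow, hε, hd, one_mul], ?_⟩
    simpa [div_mul_cancel₀ _ hd0] using hlim.mul_const d

/-! ### Analyticity of `z^{p/2} Γ_+` in the unit disk -/

section Floquet

variable {α : ℕ → ℂ} {p : ℕ}

lemma floquetDiscr_ne_real (hα : ∀ n, ‖α n‖ < 1) (hp : 0 < p) (hpe : Even p) {z : ℂ}
    (hz : z ≠ 0) (hz1 : ‖z‖ < 1) {t : ℝ} (ht : t ∈ Set.Icc (-2 : ℝ) 2) :
    floquetDiscr α p z ≠ t := fun h =>
  hz1.ne (norm_eq_one_of_floquetDiscr_eq hα hp hpe hz ht h)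

lemma eval_discrPoly_ne_zero (hα : ∀ n, ‖α n‖ < 1) (hp : 0 < p) (hpe : Even p) {z : ℂ}
    (hz1 : ‖z‖ < 1) : (discrPoly α p).eval z ≠ 0 := by
  rcases eq_or_ne z 0 with rfl | hz
  · rw [← coeff_zero_eq_eval_zero, coeff_zero_discrPoly hp]
    exact leadConst_ne_zero hα p
  · rw [eval_discrPoly z hz]
    refine mul_ne_zero (pow_ne_zero _ hz) ?_
    simpa using floquetDiscr_ne_real hα hp hpe hz hz1 (t := 0) (by norm_num)

lemma pow_half_sq (hpe : Even p) (z : ℂ) : (z ^ (p / 2)) ^ 2 = z ^ p := by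
  rw [← pow_mul, Nat.div_mul_cancel hpe.two_dvd]

/-- In the unit disk `1 - 4 / Δ²` avoids the nonpositive real axis, so its principal square root is
analytic. -/
lemma mem_slitPlane_of_disc (hα : ∀ n, ‖α n‖ < 1) (hp : 0 < p) (hpe : Even p) {z : ℂ}
    (hz1 : ‖z‖ < 1) :
    1 - 4 * z ^ p / (discrPoly α p).eval z ^ 2 ∈ Complex.slitPlane := by
  rcases eq_or_ne z 0 with rfl | hz
  · simp [hp.ne']
  have hP := eval_discrPoly_ne_zero hα hp hpe hz1
  by_contra hn
  rw [Complex.mem_slitPlane_iff_not_le_zero, not_not, Complex.le_def] at hn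
  obtain ⟨hre, him⟩ := hn
  set u := 4 * z ^ p / (discrPoly α p).eval z ^ 2 with hu
  have hu1 : u = (u.re : ℂ) := by
    apply Complex.ext
    · simp
    · simp at him ⊢; exact him
  have hre' : 1 ≤ u.re := by simpa using hre
  have hΔ : floquetDiscr α p z ^ 2 * u = 4 := by
    rw [hu, eval_discrPoly z hz, mul_pow, pow_half_sq hpe]
    have h1 := pow_ne_zero p hz
    have h2 : floquetDiscr α p z ≠ 0 := by
      simpa using floquetDiscr_ne_real hα hp hpe hz hz1 (t := 0) (by norm_num)
    field_simp
  have hs : 0 < Real.sqrt u.re := Real.sqrt_pos.2 (by linarith)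
  have hs1 : 1 ≤ Real.sqrt u.re := Real.one_le_sqrt.2 hre'
  have hsq : (Real.sqrt u.re : ℂ) ^ 2 = u := by
    rw [← Complex.ofReal_pow, Real.sq_sqrt (by linarith)]; exact hu1.symm
  have hfac : (floquetDiscr α p z * Real.sqrt u.re - 2) *
      (floquetDiscr α p z * Real.sqrt u.re + 2) = 0 := by
    linear_combination hΔ + floquetDiscr α p z ^ 2 * hsq
  have hs0 : (Real.sqrt u.re : ℂ) ≠ 0 := by exact_mod_cast hs.ne'
  have hle : 2 / Real.sqrt u.re ≤ 2 := div_le_self (by norm_num) hs1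
  have hpos : 0 < 2 / Real.sqrt u.re := by positivity
  rcases mul_eq_zero.1 hfac with h | h
  · refine floquetDiscr_ne_real hα hp hpe hz hz1 (t := 2 / Real.sqrt u.re)
      ⟨by linarith, hle⟩ ?_
    push_cast
    rw [eq_div_iff hs0]; linear_combination h
  · refine floquetDiscr_ne_real hα hp hpe hz hz1 (t := -(2 / Real.sqrt u.re))
      ⟨by linarith, by linarith⟩ ?_
    push_cast
    rw [← neg_div, eq_div_iff hs0]; linear_combination h

/-- The analytic function on the unit disk that equals `z^{p/2} Γ_+(z)` off the origin. With
`P = z^{p/2} Δ` it is `P (1 + √(1 - 4 / Δ²)) / 2`, where `4 / Δ² = 4 z^p / P²` has no pole in the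
disk and the principal root, having positive real part, singles out the larger eigenvalue. -/
noncomputable def regGamma (α : ℕ → ℂ) (p : ℕ) (z : ℂ) : ℂ :=
  (discrPoly α p).eval z / 2 * (1 + (1 - 4 * z ^ p / (discrPoly α p).eval z ^ 2) ^ (1 / 2 : ℂ))

lemma differentiableOn_regGamma (hα : ∀ n, ‖α n‖ < 1) (hp : 0 < p) (hpe : Even p) :
    DifferentiableOn ℂ (regGamma α p) (Metric.ball 0 1) := by
  intro z hz
  have hz1 : ‖z‖ < 1 := by simpa using hz
  refine DifferentiableAt.differentiableWithinAt ?_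
  have h0 := eval_discrPoly_ne_zero hα hp hpe hz1
  have hd : DifferentiableAt ℂ (fun z => (discrPoly α p).eval z) z :=
    (discrPoly α p).differentiable z
  have h1 : DifferentiableAt ℂ (fun z => 1 - 4 * z ^ p / (discrPoly α p).eval z ^ 2) z :=
    (((differentiableAt_id.pow p).const_mul 4).div (hd.pow 2) (pow_ne_zero 2 h0)).const_sub 1
  exact (hd.div_const 2).mul
    ((h1.cpow (differentiableAt_const _) (mem_slitPlane_of_disc hα hp hpe hz1)).const_add 1)

lemma regGamma_zero (hp : 0 < p) : regGamma α p 0 = leadConst α p := by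
  rw [regGamma, ← coeff_zero_eq_eval_zero, coeff_zero_discrPoly hp, zero_pow hp.ne']
  norm_num

lemma regGamma_eq (hα : ∀ n, ‖α n‖ < 1) (hp : 0 < p) (hpe : Even p) {z : ℂ}
    (hz : z ≠ 0) (hz1 : ‖z‖ < 1) : regGamma α p z = z ^ (p / 2) * gammaPlus α p z := by
  have hm := mem_slitPlane_of_disc hα hp hpe hz1
  set u := 1 - 4 * z ^ p / (discrPoly α p).eval z ^ 2 with hu
  set s := u ^ (1 / 2 : ℂ) with hs
  have hss : s ^ 2 = u := by rw [hs, ← Complex.cpow_nat_mul]; norm_num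
  have hΔ : floquetDiscr α p z ≠ 0 := by
    simpa using floquetDiscr_ne_real hα hp hpe hz hz1 (t := 0) (by norm_num)
  have hzp := pow_ne_zero p hz
  have hu' : u = 1 - 4 / floquetDiscr α p z ^ 2 := by
    rw [hu, eval_discrPoly z hz, mul_pow, pow_half_sq hpe]
    field_simp
  have hre : 0 < s.re := by
    rw [hs, Complex.cpow_def_of_ne_zero (Complex.slitPlane_ne_zero hm), Complex.exp_re]
    refine mul_pos (Real.exp_pos _) (Real.cos_pos_of_mem_Ioo ?_)
    have h1 := Complex.mem_slitPlane_iff_arg.1 hm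
    have h2 := Complex.neg_pi_lt_arg u
    have h3 := lt_of_le_of_ne (Complex.arg_le_pi u) h1.1
    have : (Complex.log u * (1 / 2 : ℂ)).im = u.arg / 2 := by
      simp [Complex.mul_im, Complex.log_im, Complex.log_re]; ring
    rw [this]
    constructor <;> linarith
  set x := floquetDiscr α p z / 2 * (1 + s) with hx
  set y := floquetDiscr α p z / 2 * (1 - s) with hy
  have hxy : x * y = 1 := by
    have h1 : floquetDiscr α p z ^ 2 * s ^ 2 = floquetDiscr α p z ^ 2 - 4 := by
      rw [hss, hu']; field_simp
    rw [hx, hy]; linear_combination -h1 / 4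
  have hsum : x + y = floquetDiscr α p z := by rw [hx, hy]; ring
  have hlt : ‖y‖ < ‖x‖ := by
    rw [hx, hy, norm_mul, norm_mul]
    refine mul_lt_mul_of_pos_left ?_ (norm_pos_iff.2 (div_ne_zero hΔ two_ne_zero))
    refine lt_of_pow_lt_pow_left₀ 2 (norm_nonneg _) ?_
    simp only [← Complex.normSq_eq_norm_sq, Complex.normSq_apply]
    simp
    nlinarith
  have hx1 : 1 < ‖x‖ := by
    have h1 : ‖x‖ * ‖y‖ = 1 := by rw [← norm_mul, hxy, norm_one]
    nlinarith [norm_nonneg x, norm_nonneg y]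
  rw [eq_gammaPlus hxy hsum hx1, regGamma, ← hu, ← hs, hx, eval_discrPoly z hz]
  ring

lemma continuousOn_gammaPlus_radius (hα : ∀ n, ‖α n‖ < 1) (hp : 0 < p) (hpe : Even p) {ζ : ℂ}
    (hζ : ‖ζ‖ = 1) : ContinuousOn (fun r : ℝ => gammaPlus α p (r * ζ)) (Set.Ioo 0 1) := by
  have hmem : ∀ r ∈ Set.Ioo (0 : ℝ) 1, (r : ℂ) * ζ ≠ 0 ∧ ‖(r : ℂ) * ζ‖ < 1 :=
    fun r hr => ⟨(radius_mem hζ hr).1, (radius_mem hζ hr).2.2⟩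
  have hc : Continuous fun r : ℝ => (r : ℂ) * ζ := by fun_prop
  have h1 : ContinuousOn (fun r : ℝ => (((r : ℂ) * ζ) ^ (p / 2))⁻¹ * regGamma α p (r * ζ))
      (Set.Ioo 0 1) := by
    refine ContinuousOn.mul ?_ ?_
    · exact ContinuousOn.inv₀ (hc.pow _).continuousOn fun r hr => pow_ne_zero _ (hmem r hr).1
    · exact (differentiableOn_regGamma hα hp hpe).continuousOn.comp hc.continuousOn
        fun r hr => by simpa using (hmem r hr).2
  refine h1.congr fun r hr => ?_
  beta_reduce
  rw [regGamma_eq hα hp hpe (hmem r hr).1 (hmem r hr).2,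
    inv_mul_cancel_left₀ (pow_ne_zero _ (hmem r hr).1)]

/-! ### Existence of the radial limits -/

/-- `Γ_+ - Γ_-`, a square root of `Δ² - 4`. -/
noncomputable def gammaDiff (α : ℕ → ℂ) (p : ℕ) (z : ℂ) : ℂ := gammaPlus α p z - gammaMinus α p z

lemma gammaDiff_sq (z : ℂ) : gammaDiff α p z ^ 2 = floquetDiscr α p z ^ 2 - 4 := by
  have h1 := gammaPlus_mul_gammaMinus (α := α) (p := p) z
  rw [gammaDiff, ← gammaPlus_add_gammaMinus]
  linear_combination -4 * h1

lemma gammaMinus_eq (z : ℂ) : gammaMinus α p z = (floquetDiscr α p z - gammaDiff α p z) / 2 := by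
  rw [gammaDiff, ← gammaPlus_add_gammaMinus]; ring

lemma gammaPlus_eq (z : ℂ) : gammaPlus α p z = (floquetDiscr α p z + gammaDiff α p z) / 2 := by
  rw [gammaDiff, ← gammaPlus_add_gammaMinus]; ring

lemma gammaDiff_ne_zero (hα : ∀ n, ‖α n‖ < 1) (hp : 0 < p) (hpe : Even p) {z : ℂ}
    (hz : z ≠ 0) (hz1 : ‖z‖ < 1) : gammaDiff α p z ≠ 0 := by
  intro h
  have h1 := one_lt_norm_gammaPlus hα hp hpe hz hz1.ne
  have h2 := gammaPlus_mul_gammaMinus (α := α) (p := p) z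
  have h3 : gammaMinus α p z = gammaPlus α p z := (sub_eq_zero.1 h).symm
  rw [h3] at h2
  have h4 : ‖gammaPlus α p z‖ * ‖gammaPlus α p z‖ = 1 := by rw [← norm_mul, h2, norm_one]
  nlinarith

lemma gammaDiff_sq_mul (hpe : Even p) {z : ℂ} (hz : z ≠ 0) :
    (z ^ (p / 2) * gammaDiff α p z) ^ 2 = (discrPoly α p ^ 2 - C 4 * X ^ p).eval z := by
  rw [mul_pow, gammaDiff_sq, pow_half_sq hpe]
  simp only [eval_sub, eval_pow, eval_mul, eval_C, eval_X]
  rw [eval_discrPoly z hz, mul_pow, pow_half_sq hpe]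
  ring

lemma continuousOn_gammaDiff_radius (hα : ∀ n, ‖α n‖ < 1) (hp : 0 < p) (hpe : Even p) {ζ : ℂ}
    (hζ : ‖ζ‖ = 1) : ContinuousOn (fun r : ℝ => gammaDiff α p (r * ζ)) (Set.Ioo 0 1) := by
  have h := continuousOn_gammaPlus_radius hα hp hpe hζ
  refine (h.sub (h.inv₀ fun r _ => gammaPlus_ne_zero _)).congr fun r _ => ?_
  simp [gammaDiff, gammaMinus_eq_inv]

/-- At every point of the circle, a function of the form `(Y + W / (z^{p/2} (Γ_+ - Γ_-))) / 2` with
polynomials `Y` and `W` has a radial limit in the Riemann sphere. -/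
lemma exists_radialLimit (hα : ∀ n, ‖α n‖ < 1) (hp : 0 < p) (hpe : Even p) {ζ : ℂ}
    (hζ : ‖ζ‖ = 1) (Y W : ℂ[X]) {f : ℂ → ℂ}
    (hf : ∀ z, z ≠ 0 → ‖z‖ < 1 →
      f z = (Y.eval z + W.eval z / (z ^ (p / 2) * gammaDiff α p z)) / 2) :
    ∃ L, RadialLimit f ζ L := by
  have hζ0 : ζ ≠ 0 := by rintro rfl; simp at hζ
  set q : ℝ → ℂ := fun r => W.eval (r * ζ) / ((r * ζ) ^ (p / 2) * gammaDiff α p (r * ζ)) with hq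
  have hfq : ∀ᶠ r : ℝ in 𝓝[<] 1, f (r * ζ) = (Y.eval (r * ζ) + q r) / 2 := by
    filter_upwards [eventually_mem_Ioo] with r hr
    exact hf _ (radius_mem hζ hr).1 (radius_mem hζ hr).2.2
  have hB : discrPoly α p ^ 2 - C 4 * X ^ p ≠ 0 := by
    intro h0
    have h1 := congrArg (eval 0) h0
    simp only [eval_sub, eval_pow, eval_mul, eval_C, eval_X, zero_pow hp.ne', mul_zero, sub_zero,
      eval_zero] at h1
    exact pow_ne_zero 2 (eval_discrPoly_ne_zero hα hp hpe (by simp)) h1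
  have hq2 : ∀ r ∈ Set.Ioo (0 : ℝ) 1,
      (W ^ 2).eval (r * ζ) / (discrPoly α p ^ 2 - C 4 * X ^ p).eval (r * ζ) = q r ^ 2 := by
    intro r hr
    rw [hq, div_pow, gammaDiff_sq_mul hpe (radius_mem hζ hr).1, eval_pow]
  have hqc : ContinuousOn q (Set.Ioo 0 1) := by
    have hc : Continuous fun r : ℝ => (r : ℂ) * ζ := by fun_prop
    refine ((W.continuous.comp hc).continuousOn).div
      ((hc.pow _).continuousOn.mul (continuousOn_gammaDiff_radius hα hp hpe hζ)) fun r hr => ?_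
    have h := radius_mem hζ hr
    exact mul_ne_zero (pow_ne_zero _ h.1) (gammaDiff_ne_zero hα hp hpe h.1 h.2.2)
  obtain ⟨L, hL⟩ := exists_tendsto_eval_div (A := W ^ 2) hB hζ0
  have hL' : Tendsto (fun r : ℝ => ((q r ^ 2 : ℂ) : OnePoint ℂ)) (𝓝[<] 1) (𝓝 L) := by
    refine hL.congr' ?_
    filter_upwards [eventually_mem_Ioo] with r hr
    rw [hq2 r hr]
  have hY := tendsto_eval_radius Y ζ
  induction L using OnePoint.rec with
  | infty =>
    refine ⟨OnePoint.infty, tendsto_coe_infty_of_norm ?_⟩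
    have h1 := tendsto_norm_of_coe_infty hL'
    simp only [norm_pow] at h1
    have h2 : Tendsto (fun r => ‖q r‖) (𝓝[<] (1 : ℝ)) atTop := by
      refine tendsto_atTop_mono' _ ?_ (Real.tendsto_sqrt_atTop.comp h1)
      exact Eventually.of_forall fun r => (Real.sqrt_sq (norm_nonneg _)).le
    have h3 : Tendsto (fun r : ℝ => (‖q r‖ + -‖Y.eval ((r : ℂ) * ζ)‖) / 2) (𝓝[<] 1) atTop :=
      (h2.atTop_add hY.norm.neg).atTop_div_const two_pos
    refine tendsto_atTop_mono' _ ?_ h3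
    filter_upwards [hfq] with r hr
    have e : ‖(Y.eval ((r : ℂ) * ζ) + q r) / 2‖ = ‖Y.eval ((r : ℂ) * ζ) + q r‖ / 2 := by simp
    rw [hr, e]
    have := norm_sub_le_norm_add (q r) (Y.eval ((r : ℂ) * ζ))
    rw [add_comm (q r)] at this
    linarith
  | coe c =>
    rw [tendsto_coe_iff] at hL'
    obtain ⟨d, -, hd⟩ := exists_tendsto_of_sq_tendsto hqc hL'
    refine ⟨(((Y.eval ζ + d) / 2 : ℂ) : OnePoint ℂ), tendsto_coe_iff.2 ?_⟩
    exact ((hY.add hd).div_const 2).congr' (hfq.mono fun r hr => hr.symm)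

lemma tendsto_floquetDiscr {ζ : ℂ} (hζ : ζ ≠ 0) :
    Tendsto (fun r : ℝ => floquetDiscr α p (r * ζ)) (𝓝[<] 1) (𝓝 (floquetDiscr α p ζ)) := by
  simp_rw [floquetDiscr_eq]
  exact (((tendsto_radius ζ).pow _).inv₀ (pow_ne_zero _ hζ)).mul (tendsto_eval_radius _ ζ)

/-- `Γ_+` has a finite radial limit at every point of the circle, and it is an eigenvalue of the
monodromy matrix there. -/
lemma exists_tendsto_gammaPlus (hα : ∀ n, ‖α n‖ < 1) (hp : 0 < p) (hpe : Even p) {ζ : ℂ}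
    (hζ : ‖ζ‖ = 1) : ∃ g : ℂ, g ^ 2 - floquetDiscr α p ζ * g + 1 = 0 ∧
      Tendsto (fun r : ℝ => gammaPlus α p (r * ζ)) (𝓝[<] 1) (𝓝 g) := by
  have hζ0 : ζ ≠ 0 := by rintro rfl; simp at hζ
  have hΔ := tendsto_floquetDiscr (α := α) (p := p) hζ0
  have h2 : Tendsto (fun r : ℝ => gammaDiff α p (r * ζ) ^ 2) (𝓝[<] 1)
      (𝓝 (floquetDiscr α p ζ ^ 2 - 4)) := by
    simp_rw [gammaDiff_sq]
    exact (hΔ.pow 2).sub_const 4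
  obtain ⟨d, hd2, hd⟩ := exists_tendsto_of_sq_tendsto
    (continuousOn_gammaDiff_radius hα hp hpe hζ) h2
  refine ⟨(floquetDiscr α p ζ + d) / 2, by linear_combination hd2 / 4, ?_⟩
  simp_rw [gammaPlus_eq]
  exact (hΔ.add hd).div_const 2

/-- On the bands the eigenvalues of the monodromy matrix have modulus `1`. -/
lemma norm_eq_one_of_root {g : ℂ} {t : ℝ} (ht : t ∈ Set.Icc (-2 : ℝ) 2)
    (h : g ^ 2 - t * g + 1 = 0) : ‖g‖ = 1 := by
  have hre := congrArg Complex.re h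
  have him := congrArg Complex.im h
  simp [pow_two] at hre him
  have h1 : g.im * (2 * g.re - t) = 0 := by linarith
  have h2 : ‖g‖ ^ 2 = 1 := by
    rw [← Complex.normSq_eq_norm_sq, Complex.normSq_apply]
    rcases mul_eq_zero.1 h1 with h3 | h3
    · rw [h3] at hre ⊢
      have h4 : (g.re - t / 2) ^ 2 = t ^ 2 / 4 - 1 := by nlinarith
      have h5 : t ^ 2 ≤ 4 := by nlinarith [ht.1, ht.2]
      have h6 : g.re - t / 2 = 0 := by
        have := sq_nonneg (g.re - t / 2)
        exact pow_eq_zero_iff two_ne_zero |>.1 (by linarith)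
      nlinarith
    · obtain rfl : t = 2 * g.re := by linarith
      linarith
  nlinarith [norm_nonneg g]

/-! ### The Jost functions as algebraic functions -/

/-- The component `i` of `T_b (2 T_p - z^{p/2} Δ) (1, 1)`, the coefficient of
`1 / (z^{p/2} (Γ_+ - Γ_-))` in `2 T_b P_+ (1, 1)`. -/
noncomputable def numPoly (α : ℕ → ℂ) (p b : ℕ) (i : Fin 2) : ℂ[X] :=
  ∑ k, transferPoly α b i k *
    (2 * (transferPoly α p k 0 + transferPoly α p k 1) - discrPoly α p)

/-- The component `i` of `T_b (1, 1)`, the polynomial part of `2 T_b P_+ (1, 1)`. -/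
noncomputable def basePoly (α : ℕ → ℂ) (b : ℕ) (i : Fin 2) : ℂ[X] :=
  transferPoly α b i 0 + transferPoly α b i 1

lemma projPlus_mulVec_apply (hα : ∀ n, ‖α n‖ < 1) (hp : 0 < p) (hpe : Even p) {z : ℂ}
    (hz : z ≠ 0) (hz1 : ‖z‖ < 1) (k : Fin 2) : (projPlus α p z *ᵥ ![1, 1]) k =
      (1 + (2 * (transfer α p z k 0 + transfer α p z k 1) - (discrPoly α p).eval z) /
        (z ^ (p / 2) * gammaDiff α p z)) / 2 := by
  have hS := gammaDiff_ne_zero hα hp hpe hz hz1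
  have hzq := pow_ne_zero (p / 2) hz
  have h : (projPlus α p z *ᵥ ![1, 1]) k = (gammaDiff α p z)⁻¹ *
      ((z ^ (p / 2))⁻¹ * (transfer α p z k 0 + transfer α p z k 1) - gammaMinus α p z) := by
    rw [projPlus, Matrix.smul_mulVec, Matrix.sub_mulVec, Matrix.smul_mulVec, Matrix.one_mulVec,
      monodromy, Matrix.smul_mulVec, Pi.smul_apply, Pi.sub_apply, Pi.smul_apply, Pi.smul_apply]
    rw [show gammaPlus α p z - gammaMinus α p z = gammaDiff α p z from rfl]
    fin_cases k <;> simp [Matrix.mulVec, dotProduct, Fin.sum_univ_two]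
  rw [h, gammaMinus_eq, eval_discrPoly z hz]
  field_simp
  ring

lemma transfer_mulVec_projPlus (hα : ∀ n, ‖α n‖ < 1) (hp : 0 < p) (hpe : Even p) {z : ℂ}
    (hz : z ≠ 0) (hz1 : ‖z‖ < 1) (b : ℕ) (i : Fin 2) :
    (transfer α b z *ᵥ (projPlus α p z *ᵥ ![1, 1])) i =
      ((basePoly α b i).eval z + (numPoly α p b i).eval z /
        (z ^ (p / 2) * gammaDiff α p z)) / 2 := by
  have h : ∀ v : Fin 2 → ℂ, (transfer α b z *ᵥ v) i =
      transfer α b z i 0 * v 0 + transfer α b z i 1 * v 1 := fun v => by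
    simp [Matrix.mulVec, dotProduct, Fin.sum_univ_two]
  rw [h, projPlus_mulVec_apply hα hp hpe hz hz1, projPlus_mulVec_apply hα hp hpe hz hz1,
    numPoly, Fin.sum_univ_two, basePoly]
  simp only [eval_add, eval_sub, eval_mul, eval_transferPoly]
  simp
  ring

lemma transfer_mulVec_projMinus (hα : ∀ n, ‖α n‖ < 1) (hp : 0 < p) (hpe : Even p) {z : ℂ}
    (hz : z ≠ 0) (hz1 : ‖z‖ < 1) (b : ℕ) (i : Fin 2) :
    (transfer α b z *ᵥ (![1, 1] - projPlus α p z *ᵥ ![1, 1])) i =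
      ((basePoly α b i).eval z + (-numPoly α p b i).eval z /
        (z ^ (p / 2) * gammaDiff α p z)) / 2 := by
  rw [Matrix.mulVec_sub, Pi.sub_apply, transfer_mulVec_projPlus hα hp hpe hz hz1]
  have h : (transfer α b z *ᵥ ![1, 1]) i = (basePoly α b i).eval z := by
    simp [Matrix.mulVec, dotProduct, Fin.sum_univ_two, basePoly, eval_transferPoly]
  rw [h, eval_neg]
  ring

lemma jostTilde_eq (b : ℕ) (z : ℂ) : jostTilde α p b z =
    (transfer α b z *ᵥ (![1, 1] - projPlus α p z *ᵥ ![1, 1])) 0 := by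
  rw [Matrix.mulVec_sub, Pi.sub_apply, ← jost_eq, transfer_mulVec_one_one,
    eq_sub_of_add_eq' (jost_add_jostTilde (α := α) (p := p) b z)]
  simp

/-- `j_b` and `j̃_b` have radial limits in the Riemann sphere at every point of the circle; these do
not both vanish, because `j_b + j̃_b = φ_b`. -/
theorem exists_radialLimit_jost (hα : ∀ n, ‖α n‖ < 1) (hp : 0 < p) (hpe : Even p) (b : ℕ) {ζ : ℂ}
    (hζ : ‖ζ‖ = 1) : ∃ J J' : OnePoint ℂ,
      RadialLimit (jost α p b) ζ J ∧ RadialLimit (jostTilde α p b) ζ J' ∧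
      ¬ (J = ((0 : ℂ) : OnePoint ℂ) ∧ J' = ((0 : ℂ) : OnePoint ℂ)) := by
  obtain ⟨J, hJ⟩ := exists_radialLimit hα hp hpe hζ (basePoly α b 0) (numPoly α p b 0)
    (f := jost α p b) fun z hz hz1 => by
      rw [jost_eq, transfer_mulVec_projPlus hα hp hpe hz hz1]
  obtain ⟨J', hJ'⟩ := exists_radialLimit hα hp hpe hζ (basePoly α b 0) (-numPoly α p b 0)
    (f := jostTilde α p b) fun z hz hz1 => by
      rw [jostTilde_eq, transfer_mulVec_projMinus hα hp hpe hz hz1]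
  refine ⟨J, J', hJ, hJ', ?_⟩
  rintro ⟨rfl, rfl⟩
  have h1 := (tendsto_coe_iff.1 hJ).add (tendsto_coe_iff.1 hJ')
  simp only [jost_add_jostTilde, add_zero] at h1
  exact eval_phi_ne_zero hα hζ b (tendsto_nhds_unique (tendsto_eval_radius _ ζ) h1)

/-! ### The rate of convergence of `Γ_+` at interior points of the bands -/

/-- If `z^{p/2} (Δ(z) - Δ(ζ))` has a zero of order at least `k` at `ζ`, then
`Δ(rζ) - Δ(ζ) = O((1-r)^k)`. -/
lemma exists_norm_floquetDiscr_sub_le {ζ : ℂ} (hζ : ‖ζ‖ = 1) {k : ℕ} {Q : ℂ[X]}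
    (hQ : discrPoly α p - C (floquetDiscr α p ζ) * X ^ (p / 2) = (X - C ζ) ^ k * Q) :
    ∃ K > 0, ∀ᶠ r : ℝ in 𝓝[<] 1,
      ‖floquetDiscr α p (r * ζ) - floquetDiscr α p ζ‖ ≤ K * (1 - r) ^ k := by
  have hζ0 : ζ ≠ 0 := by rintro rfl; simp at hζ
  have h1 : Tendsto (fun r : ℝ => ‖(((r : ℂ) * ζ) ^ (p / 2))⁻¹ * Q.eval (r * ζ)‖) (𝓝[<] 1)
      (𝓝 ‖(ζ ^ (p / 2))⁻¹ * Q.eval ζ‖) :=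
    ((((tendsto_radius ζ).pow _).inv₀ (pow_ne_zero _ hζ0)).mul (tendsto_eval_radius _ ζ)).norm
  refine ⟨‖(ζ ^ (p / 2))⁻¹ * Q.eval ζ‖ + 1, by positivity, ?_⟩
  filter_upwards [h1.eventually (gt_mem_nhds (lt_add_one _)), eventually_mem_Ioo] with r hr hr1
  have hz := (radius_mem hζ hr1).1
  have h2 := congrArg (eval ((r : ℂ) * ζ)) hQ
  simp only [eval_sub, eval_mul, eval_pow, eval_C, eval_X, eval_discrPoly _ hz] at h2
  have h3 : floquetDiscr α p (r * ζ) - floquetDiscr α p ζ =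
      ((r : ℂ) * ζ - ζ) ^ k * ((((r : ℂ) * ζ) ^ (p / 2))⁻¹ * Q.eval (r * ζ)) := by
    have := pow_ne_zero (p / 2) hz
    field_simp
    linear_combination h2
  rw [h3, norm_mul, norm_pow, norm_radius_sub hζ hr1, mul_comm]
  exact mul_le_mul_of_nonneg_right hr.le (pow_nonneg (by linarith [hr1.2]) _)

lemma exists_discrPoly_factor {ζ : ℂ} (hζ : ζ ≠ 0) :
    ∃ Q, discrPoly α p - C (floquetDiscr α p ζ) * X ^ (p / 2) = (X - C ζ) * Q := by
  have : (X - C ζ) ∣ discrPoly α p - C (floquetDiscr α p ζ) * X ^ (p / 2) := by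
    rw [dvd_iff_isRoot, IsRoot.def]
    simp only [eval_sub, eval_mul, eval_pow, eval_C, eval_X, eval_discrPoly _ hζ]
    ring
  exact this

/-- At an interior point of the bands where `Δ = ±2`, the discriminant has a critical point. -/
lemma exists_discrPoly_factor_sq {ζ : ℂ} (hζ : ζ ∈ bandsInterior α p)
    (hD : floquetDiscr α p ζ ^ 2 = 4) :
    ∃ Q, discrPoly α p - C (floquetDiscr α p ζ) * X ^ (p / 2) = (X - C ζ) ^ 2 * Q := by
  obtain ⟨⟨hζ1, -⟩, hev⟩ := hζ
  have hζ0 : ζ ≠ 0 := by rintro rfl; simp at hζ1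
  obtain ⟨Q, hQ⟩ := exists_discrPoly_factor (α := α) (p := p) hζ0
  suffices h : (X - C ζ) ∣ Q by
    obtain ⟨R, rfl⟩ := h
    exact ⟨R, by rw [hQ]; ring⟩
  rw [dvd_iff_isRoot, IsRoot.def]
  -- Along the circle `Δ - Δ(ζ)` is real and of one sign near `ζ`, so its derivative, which is a
  -- nonzero multiple of `Q(ζ)`, vanishes.
  set γ : ℝ → ℂ := fun t => ζ * Complex.exp (t * Complex.I) with hγ
  have hγ1 : ∀ t, ‖γ t‖ = 1 := fun t => by
    rw [hγ]; simp [hζ1, Complex.norm_exp_ofReal_mul_I]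
  have hγ0 : γ 0 = ζ := by simp [hγ]
  have hγn : ∀ t, γ t ≠ 0 := fun t h => by simpa [h] using hγ1 t
  have hγd : HasDerivAt γ (ζ * Complex.I) 0 := by
    have h1 : HasDerivAt (fun t : ℝ => (t : ℂ) * Complex.I) (1 * Complex.I) 0 :=
      (Complex.ofRealCLM.hasDerivAt (x := (0 : ℝ))).mul_const Complex.I
    have h2 := (h1.cexp).const_mul ζ
    simpa using h2
  have hγc : Continuous γ := by rw [hγ]; fun_prop
  set F : ℝ → ℂ := fun t => floquetDiscr α p (γ t) - floquetDiscr α p ζ with hF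
  have hFe : F = fun t => (γ t - ζ) * ((γ t ^ (p / 2))⁻¹ * Q.eval (γ t)) := by
    funext t
    have h2 := congrArg (eval (γ t)) hQ
    simp only [eval_sub, eval_mul, eval_pow, eval_C, eval_X, eval_discrPoly _ (hγn t)] at h2
    have := pow_ne_zero (p / 2) (hγn t)
    rw [hF]
    field_simp
    linear_combination h2
  -- Continuity of the second factor is enough, as the first one vanishes at `0`.
  have hFd : HasDerivAt F (ζ * Complex.I * ((ζ ^ (p / 2))⁻¹ * Q.eval ζ)) 0 := by
    have hcont : ContinuousAt (fun t => (γ t ^ (p / 2))⁻¹ * Q.eval (γ t)) 0 :=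
      ((hγc.pow _).continuousAt.inv₀ (pow_ne_zero _ (hγn 0))).mul
        (Q.continuous.comp hγc).continuousAt
    rw [hFe, hasDerivAt_iff_tendsto_slope_zero]
    have h1 := hasDerivAt_iff_tendsto_slope_zero.1 hγd
    have h2 := h1.mul (hcont.tendsto.mono_left nhdsWithin_le_nhds)
    rw [hγ0] at h2
    refine h2.congr fun t => ?_
    simp [hγ0]
    ring
  have hbands : ∀ᶠ t in 𝓝 (0 : ℝ), γ t ∈ bands α p := by
    have : Tendsto γ (𝓝 0) (𝓝[Metric.sphere 0 1] ζ) := by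
      refine tendsto_nhdsWithin_iff.2 ⟨hγ0 ▸ hγc.tendsto 0, Eventually.of_forall fun t => ?_⟩
      simpa using hγ1 t
    exact this.eventually hev
  have hD' : floquetDiscr α p ζ = 2 ∨ floquetDiscr α p ζ = -2 := by
    have : (floquetDiscr α p ζ - 2) * (floquetDiscr α p ζ + 2) = 0 := by linear_combination hD
    rcases mul_eq_zero.1 this with h | h
    · exact Or.inl (sub_eq_zero.1 h)
    · exact Or.inr (eq_neg_of_add_eq_zero_left h)
  have hF0 : F 0 = 0 := by simp [hF, hγ0]
  set F' := ζ * Complex.I * ((ζ ^ (p / 2))⁻¹ * Q.eval ζ) with hF'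
  have hred : HasDerivAt (fun t => (F t).re) F'.re 0 :=
    Complex.reCLM.hasFDerivAt.comp_hasDerivAt (0 : ℝ) hFd
  have himd : HasDerivAt (fun t => (F t).im) F'.im 0 :=
    Complex.imCLM.hasFDerivAt.comp_hasDerivAt (0 : ℝ) hFd
  have him : F'.im = 0 := by
    refine IsLocalMax.hasDerivAt_eq_zero ?_ himd
    filter_upwards [hbands] with t ht
    obtain ⟨-, x, -, hx⟩ := ht
    rw [hF0]
    rcases hD' with h | h <;> simp [hF, hx, h]
  have hre : F'.re = 0 := by
    rcases hD' with h | h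
    · refine IsLocalMax.hasDerivAt_eq_zero ?_ hred
      filter_upwards [hbands] with t ht
      obtain ⟨-, x, hx1, hx⟩ := ht
      rw [hF0]
      simpa [hF, hx, h] using hx1.2
    · refine IsLocalMin.hasDerivAt_eq_zero ?_ hred
      filter_upwards [hbands] with t ht
      obtain ⟨-, x, hx1, hx⟩ := ht
      rw [hF0]
      have := hx1.1
      simp [hF, hx, h]
      linarith
  have h0 : F' = 0 := Complex.ext hre him
  rw [hF'] at h0
  have h1 := pow_ne_zero (p / 2) hζ0
  simpa [hζ0] using h0

/-- At an interior point of the bands, `Γ_+` approaches its boundary value at a linear rate. -/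
lemma exists_norm_gammaPlus_sub_le {ζ g : ℂ} (hζ : ζ ∈ bandsInterior α p)
    (hg : g ^ 2 - floquetDiscr α p ζ * g + 1 = 0)
    (hlim : Tendsto (fun r : ℝ => gammaPlus α p (r * ζ)) (𝓝[<] 1) (𝓝 g)) :
    ∃ K > 0, ∀ᶠ r : ℝ in 𝓝[<] 1, ‖gammaPlus α p (r * ζ) - g‖ ≤ K * (1 - r) := by
  have hζ1 : ‖ζ‖ = 1 := hζ.1.1
  have hζ0 : ζ ≠ 0 := by rintro rfl; simp at hζ1
  have hg0 : g ≠ 0 := by rintro rfl; simp at hg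
  have hD : floquetDiscr α p ζ = g + g⁻¹ := by field_simp; linear_combination -hg
  -- If `g ≠ 1/g` the second factor below stays away from `0`, and `Δ(rζ) - Δ(ζ) = O(1 - r)`
  -- suffices; if `g = 1/g` the left side is a square, and `O((1 - r)²)` is needed.
  have hid : ∀ z, (gammaPlus α p z - g) * (gammaPlus α p z - g⁻¹) =
      gammaPlus α p z * (floquetDiscr α p z - floquetDiscr α p ζ) := by
    intro z
    have h1 := gammaPlus_mul_gammaMinus (α := α) (p := p) z
    rw [← gammaPlus_add_gammaMinus, hD]
    have : g * g⁻¹ = 1 := mul_inv_cancel₀ hg0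
    linear_combination this - h1
  have hM : ∀ᶠ r : ℝ in 𝓝[<] 1, ‖gammaPlus α p (r * ζ)‖ < ‖g‖ + 1 :=
    hlim.norm.eventually (gt_mem_nhds (lt_add_one _))
  by_cases hgg : g = g⁻¹
  · obtain ⟨Q, hQ⟩ := exists_discrPoly_factor_sq hζ (by
      rw [hD, ← hgg]
      have : g * g = 1 := by nth_rewrite 2 [hgg]; exact mul_inv_cancel₀ hg0
      linear_combination 4 * this)
    obtain ⟨K, hK, hev⟩ := exists_norm_floquetDiscr_sub_le hζ1 hQ
    refine ⟨Real.sqrt ((‖g‖ + 1) * K), by positivity, ?_⟩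
    filter_upwards [hev, hM, eventually_mem_Ioo] with r hr hrM hr1
    have h1 := hid (r * ζ)
    rw [← hgg, ← pow_two] at h1
    have h2 : ‖gammaPlus α p (r * ζ) - g‖ ^ 2 ≤ (‖g‖ + 1) * (K * (1 - r) ^ 2) := by
      rw [← norm_pow, h1, norm_mul]
      exact mul_le_mul hrM.le hr (norm_nonneg _) (by positivity)
    refine le_of_sq_le_sq ?_ (mul_nonneg (Real.sqrt_nonneg _) (by linarith [hr1.2]))
    rw [mul_pow, Real.sq_sqrt (by positivity)]
    linarith
  · obtain ⟨Q, hQ⟩ := exists_discrPoly_factor (α := α) (p := p) hζ0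
    rw [← pow_one (X - C ζ)] at hQ
    obtain ⟨K, hK, hev⟩ := exists_norm_floquetDiscr_sub_le hζ1 hQ
    have hc : 0 < ‖g - g⁻¹‖ := norm_pos_iff.2 (sub_ne_zero.2 hgg)
    have hlow : ∀ᶠ r : ℝ in 𝓝[<] 1, ‖g - g⁻¹‖ / 2 < ‖gammaPlus α p (r * ζ) - g⁻¹‖ :=
      (hlim.sub_const g⁻¹).norm.eventually (lt_mem_nhds (half_lt_self hc))
    refine ⟨(‖g‖ + 1) * K / (‖g - g⁻¹‖ / 2), by positivity, ?_⟩
    filter_upwards [hev, hM, hlow, eventually_mem_Ioo] with r hr hrM hrl hr1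
    rw [pow_one] at hr
    rw [div_mul_eq_mul_div, le_div_iff₀ (by positivity)]
    calc ‖gammaPlus α p (r * ζ) - g‖ * (‖g - g⁻¹‖ / 2)
        ≤ ‖gammaPlus α p (r * ζ) - g‖ * ‖gammaPlus α p (r * ζ) - g⁻¹‖ := by gcongr
      _ = ‖gammaPlus α p (r * ζ)‖ * ‖floquetDiscr α p (r * ζ) - floquetDiscr α p ζ‖ := by
          rw [← norm_mul, hid, norm_mul]
      _ ≤ (‖g‖ + 1) * (K * (1 - r)) := by gcongr
      _ = _ := by ring

/-! ### Eigenvectors and invariant cones at interior points -/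

lemma monodromy_mul_self (hα : ∀ n, ‖α n‖ < 1) (hpe : Even p) {z : ℂ} (hz : z ≠ 0) :
    monodromy α p z * monodromy α p z =
      floquetDiscr α p z • monodromy α p z - 1 := by
  have h1 := det_monodromy hα hpe hz
  rw [floquetDiscr, Matrix.trace_fin_two]
  rw [Matrix.det_fin_two] at h1
  ext i j
  fin_cases i <;> fin_cases j <;> simp [Matrix.mul_apply, Fin.sum_univ_two]
  · linear_combination -h1
  · ring
  · ring
  · linear_combination -h1

lemma monodromy_mulVec_projPlus (hα : ∀ n, ‖α n‖ < 1) (hpe : Even p) {z : ℂ} (hz : z ≠ 0)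
    (v : Fin 2 → ℂ) : monodromy α p z *ᵥ (projPlus α p z *ᵥ v) =
      gammaPlus α p z • (projPlus α p z *ᵥ v) := by
  have h : monodromy α p z * projPlus α p z = gammaPlus α p z • projPlus α p z := by
    have h1 : monodromy α p z * (monodromy α p z - gammaMinus α p z • 1) =
        gammaPlus α p z • (monodromy α p z - gammaMinus α p z • 1) := by
      rw [Matrix.mul_sub, monodromy_mul_self hα hpe hz, Matrix.mul_smul, Matrix.mul_one, smul_sub,
        smul_smul, gammaPlus_mul_gammaMinus, ← gammaPlus_add_gammaMinus, add_smul, one_smul]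
      abel
    rw [projPlus, Matrix.mul_smul, h1, smul_comm]
  rw [Matrix.mulVec_mulVec, h, Matrix.smul_mulVec]

lemma monodromy_mulVec_projMinus (hα : ∀ n, ‖α n‖ < 1) (hp : 0 < p) (hpe : Even p) {z : ℂ}
    (hz : z ≠ 0) (hz1 : ‖z‖ < 1) (v : Fin 2 → ℂ) :
    monodromy α p z *ᵥ (v - projPlus α p z *ᵥ v) =
      gammaMinus α p z • (v - projPlus α p z *ᵥ v) := by
  have h0 := gammaDiff_ne_zero hα hp hpe hz hz1
  have h : gammaDiff α p z • (projPlus α p z *ᵥ v) =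
      monodromy α p z *ᵥ v - gammaMinus α p z • v := by
    have h1 : gammaPlus α p z - gammaMinus α p z = gammaDiff α p z := rfl
    rw [projPlus, Matrix.smul_mulVec, h1, smul_inv_smul₀ h0, Matrix.sub_mulVec,
      Matrix.smul_mulVec, Matrix.one_mulVec]
  rw [Matrix.mulVec_sub, monodromy_mulVec_projPlus hα hpe hz, smul_sub]
  have h2 : monodromy α p z *ᵥ v = gammaDiff α p z • (projPlus α p z *ᵥ v) +
      gammaMinus α p z • v := by rw [h]; abel
  rw [h2, gammaDiff, sub_smul]
  abel

/-- Eigenvectors of the monodromy matrix for an eigenvalue within `O(1 - |z|)` of the unit circle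
are uniformly transversal to the null cone of `hform`. -/
lemma nsq_le_of_eigenvector (hα : ∀ n, ‖α n‖ < 1) (hp : 0 < p) (hpe : Even p) {z l : ℂ}
    (hz : z ≠ 0) (hz1 : ‖z‖ ≤ 1) {v : Fin 2 → ℂ} (h : monodromy α p z *ᵥ v = l • v) :
    (1 - ‖z‖) * nsq v ≤ (1 - ‖l‖ ^ 2) * hform v := by
  have := hform_monodromy_le hα hp hpe hz hz1 v
  rw [h, hform_smul] at this
  linarith

/-- If `v` and `e - v`, `e = (1, 1)`, lie in opposite cones about the null cone, then `v` is
bounded in terms of the opening of the cones. -/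
lemma norm_le_of_cones {v : Fin 2 → ℂ} {K : ℝ} (hK : 0 < K) (h1 : nsq v ≤ K * hform v)
    (h2 : nsq (![1, 1] - v) ≤ K * -hform (![1, 1] - v)) (i : Fin 2) : ‖v i‖ ≤ 3 * K := by
  have hd : hform v - hform (![1, 1] - v) = 2 * ((v 0).re - (v 1).re) := by
    simp only [hform, ← Complex.normSq_eq_norm_sq, Complex.normSq_apply]
    simp
    ring
  have h3 := nsq_nonneg (![1, 1] - v)
  have h4 := Complex.re_le_norm (v 0)
  have h5 := (neg_le_abs _).trans (Complex.abs_re_le_norm (v 1))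
  have h6 : ‖v 0‖ ^ 2 + ‖v 1‖ ^ 2 ≤ 2 * K * (‖v 0‖ + ‖v 1‖) := by
    have : nsq v ≤ K * (2 * ((v 0).re - (v 1).re)) := by rw [← hd]; linarith
    rw [nsq] at this
    nlinarith
  by_contra hn
  fin_cases i
  · simp at hn
    nlinarith [sq_nonneg (‖v 1‖ - K)]
  · simp at hn
    nlinarith [sq_nonneg (‖v 0‖ - K)]

/-- At interior points of the bands `j̃_b` has a finite, nonzero radial limit: the eigenvectors
`(1 - P_+) e` and `P_+ e`, `e = (1, 1)`, stay in opposite cones about the null cone of `hform`. -/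
theorem exists_radialLimit_jostTilde_ne_zero (hα : ∀ n, ‖α n‖ < 1) (hp : 0 < p) (hpe : Even p)
    (b : ℕ) {ζ : ℂ} (hζ : ζ ∈ bandsInterior α p) :
    ∃ w : ℂ, w ≠ 0 ∧ RadialLimit (jostTilde α p b) ζ (w : OnePoint ℂ) := by
  have hζ1 : ‖ζ‖ = 1 := hζ.1.1
  have hζ0 : ζ ≠ 0 := by rintro rfl; simp at hζ1
  obtain ⟨g, hg, hlim⟩ := exists_tendsto_gammaPlus hα hp hpe hζ1
  have hg1 : ‖g‖ = 1 := by
    obtain ⟨-, t, ht, htΔ⟩ := hζ.1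
    exact norm_eq_one_of_root ht (by rw [← htΔ]; exact hg)
  obtain ⟨K₀, hK₀, hev⟩ := exists_norm_gammaPlus_sub_le hζ hg hlim
  set K := K₀ * (2 + K₀) with hKdef
  have hK : 0 < K := by positivity
  set v : ℝ → Fin 2 → ℂ := fun r => ![1, 1] - projPlus α p (r * ζ) *ᵥ ![1, 1] with hv
  have hcone : ∀ᶠ r : ℝ in 𝓝[<] 1, nsq (v r) ≤ K * hform (v r) ∧
      nsq (![1, 1] - v r) ≤ K * -hform (![1, 1] - v r) := by
    filter_upwards [hev, eventually_mem_Ioo] with r hr hr1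
    obtain ⟨hz, hzr, hz1⟩ := radius_mem hζ1 hr1
    have hr0 : 0 < 1 - r := by linarith [hr1.2]
    set x := ‖gammaPlus α p (r * ζ)‖ with hx
    have hx1 : 1 < x := one_lt_norm_gammaPlus hα hp hpe hz hz1.ne
    have hx2 : x ≤ 1 + K₀ * (1 - r) := by
      have := norm_le_norm_add_norm_sub' (gammaPlus α p (r * ζ)) g
      rw [hg1] at this
      linarith
    have hx3 : x ^ 2 - 1 ≤ K * (1 - r) := by
      have h1 : K₀ * (1 - r) ≤ K₀ := by nlinarith [hr1.1]
      have h2 : (x - 1) * (x + 1) ≤ (K₀ * (1 - r)) * (2 + K₀) :=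
        mul_le_mul (by linarith) (by linarith) (by linarith) (by positivity)
      rw [hKdef]; nlinarith
    have hy : ‖gammaMinus α p (r * ζ)‖ = x⁻¹ := by rw [gammaMinus_eq_inv, norm_inv]
    have hy1 : 0 < 1 - (x⁻¹) ^ 2 := by
      have : x⁻¹ < 1 := inv_lt_one_of_one_lt₀ hx1
      have : 0 < x⁻¹ := by positivity
      nlinarith
    have hy2 : 1 - (x⁻¹) ^ 2 ≤ x ^ 2 - 1 := by
      have h0 : x * x⁻¹ = 1 := mul_inv_cancel₀ (by linarith)
      nlinarith [sq_nonneg (x - x⁻¹)]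
    have hm := nsq_le_of_eigenvector hα hp hpe hz hz1.le
      (monodromy_mulVec_projMinus hα hp hpe hz hz1 ![1, 1])
    have hpl := nsq_le_of_eigenvector hα hp hpe hz hz1.le
      (monodromy_mulVec_projPlus hα hpe hz ![1, 1])
    have hvp : projPlus α p (r * ζ) *ᵥ ![1, 1] = ![1, 1] - v r := by rw [hv]; simp
    rw [hvp] at hpl
    change _ * nsq (v r) ≤ _ * hform (v r) at hm
    rw [hzr, hy] at hm
    rw [hzr, ← hx] at hpl
    have hn1 := nsq_nonneg (v r)
    have hn2 := nsq_nonneg (![1, 1] - v r)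
    have hh1 : 0 ≤ hform (v r) := by
      have h0 : 0 ≤ (1 - x⁻¹ ^ 2) * hform (v r) := (mul_nonneg hr0.le hn1).trans hm
      exact nonneg_of_mul_nonneg_right h0 hy1
    have hh2 : 0 ≤ -hform (![1, 1] - v r) := by
      have h0 : 0 ≤ (x ^ 2 - 1) * -hform (![1, 1] - v r) := by
        have := (mul_nonneg hr0.le hn2).trans hpl
        linarith
      exact nonneg_of_mul_nonneg_right h0 (hy1.trans_le hy2)
    constructor
    · refine le_of_mul_le_mul_left ?_ hr0
      refine hm.trans ?_
      calc _ ≤ K * (1 - r) * hform (v r) :=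
            mul_le_mul_of_nonneg_right (hy2.trans hx3) hh1
        _ = _ := by ring
    · refine le_of_mul_le_mul_left ?_ hr0
      refine hpl.trans ?_
      calc _ = (x ^ 2 - 1) * -hform (![1, 1] - v r) := by ring
        _ ≤ K * (1 - r) * -hform (![1, 1] - v r) := mul_le_mul_of_nonneg_right hx3 hh2
        _ = _ := by ring
  -- The limits exist in the Riemann sphere, and the cones exclude `∞`.
  have hconv : ∀ i, ∃ c : ℂ, Tendsto (fun r => v r i) (𝓝[<] 1) (𝓝 c) := by
    intro i
    obtain ⟨L, hL⟩ := exists_radialLimit hα hp hpe hζ1 (basePoly α 0 i) (-numPoly α p 0 i)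
      (f := fun z => (![1, 1] - projPlus α p z *ᵥ ![1, 1] : Fin 2 → ℂ) i) fun z hz hz1 => by
        rw [← transfer_mulVec_projMinus hα hp hpe hz hz1, transfer, Matrix.one_mulVec]
    induction L using OnePoint.rec with
    | infty =>
      exfalso
      have h1 := (tendsto_norm_of_coe_infty hL).eventually (eventually_gt_atTop (3 * K))
      obtain ⟨r, hr1, hr2⟩ := (h1.and hcone).exists
      exact absurd (norm_le_of_cones hK hr2.1 hr2.2 i) (not_le.2 hr1)
    | coe c => exact ⟨c, tendsto_coe_iff.1 hL⟩
  choose c hc using hconv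
  have hform_lim : ∀ {u : ℝ → Fin 2 → ℂ} {w : Fin 2 → ℂ},
      (∀ i, Tendsto (fun r => u r i) (𝓝[<] (1 : ℝ)) (𝓝 (w i))) →
      Tendsto (fun r => hform (u r)) (𝓝[<] 1) (𝓝 (hform w)) ∧
      Tendsto (fun r => nsq (u r)) (𝓝[<] 1) (𝓝 (nsq w)) := fun h =>
    ⟨((h 0).norm.pow 2).sub ((h 1).norm.pow 2), ((h 0).norm.pow 2).add ((h 1).norm.pow 2)⟩
  have hl1 := hform_lim (u := v) (w := c) hc
  have hl2 := hform_lim (u := fun r => ![1, 1] - v r) (w := ![1, 1] - c)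
    fun i => tendsto_const_nhds.sub (hc i)
  have hc1 : nsq c ≤ K * hform c :=
    le_of_tendsto_of_tendsto hl1.2 (hl1.1.const_mul K) (hcone.mono fun r hr => hr.1)
  have hc2 : nsq (![1, 1] - c) ≤ K * -hform (![1, 1] - c) :=
    le_of_tendsto_of_tendsto hl2.2 (hl2.1.neg.const_mul K) (hcone.mono fun r hr => hr.2)
  have hexp : ∀ (z : ℂ) (u : Fin 2 → ℂ), (transfer α b z *ᵥ u) 0 =
      (transferPoly α b 0 0).eval z * u 0 + (transferPoly α b 0 1).eval z * u 1 := fun z u => by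
    simp [Matrix.mulVec, dotProduct, Fin.sum_univ_two, eval_transferPoly]
  refine ⟨(transfer α b ζ *ᵥ c) 0, fun h0 => ?_, tendsto_coe_iff.2 ?_⟩
  · have h1 := hform_transfer_of_norm_eq_one hα hζ1 b c
    have h2 : hform c ≤ 0 := by
      rw [← h1, hform, h0]
      simp
    have h3 : nsq c ≤ 0 := hc1.trans (mul_nonpos_of_nonneg_of_nonpos hK.le h2)
    have h4 : c = 0 := by
      by_contra hne
      exact absurd (nsq_pos hne) (not_lt.2 h3)
    rw [h4, sub_zero] at hc2
    norm_num [nsq, hform] at hc2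
  · simp_rw [jostTilde_eq, hexp]
    exact ((tendsto_eval_radius _ ζ).mul (hc 0)).add ((tendsto_eval_radius _ ζ).mul (hc 1))

end Floquet

/-! ### Uniform measures and weak limits -/

/-- The uniform distribution on a finite family of points. -/
lemma exists_uniform_measure {E ι : Type*} [Fintype ι] [Nonempty ι] [MeasurableSpace E]
    [TopologicalSpace E] [BorelSpace E] (x : ι → E) :
    ∃ μ : ProbabilityMeasure E, ∀ f : E → ℝ, Continuous f →
      ∫ w, f w ∂(μ : Measure E) = (Fintype.card ι : ℝ)⁻¹ * ∑ i, f (x i) := by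
  have hc : (Fintype.card ι : ENNReal) ≠ 0 := by simp
  set μ : Measure E := (Fintype.card ι : ENNReal)⁻¹ • ∑ i, Measure.dirac (x i) with hμ
  have hp : IsProbabilityMeasure μ := ⟨by
    simp [hμ, Measure.smul_apply, ENNReal.inv_mul_cancel hc (ENNReal.natCast_ne_top _)]⟩
  refine ⟨⟨μ, hp⟩, fun f hf => ?_⟩
  have hi : ∀ i ∈ Finset.univ, Integrable f (Measure.dirac (x i)) := fun i _ =>
    integrable_dirac' hf.stronglyMeasurable (by simp)
  rw [ProbabilityMeasure.coe_mk, hμ, integral_smul_measure, integral_finsetSum_measure hi]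
  simp [integral_dirac' f _ hf.stronglyMeasurable]

/-- A sequence of probability measures on a compact space has a weak limit along an ultrafilter;
it integrates correctly every continuous function whose integrals converge. -/
lemma exists_weak_limit {E : Type*} [TopologicalSpace E] [T2Space E] [CompactSpace E]
    [MeasurableSpace E] [BorelSpace E] (μ : ℕ → ProbabilityMeasure E) :
    ∃ ν : ProbabilityMeasure E, ∀ f : E → ℝ, Continuous f → ∀ c : ℝ,
      Tendsto (fun n => ∫ w, f w ∂(μ n : Measure E)) atTop (𝓝 c) →
      ∫ w, f w ∂(ν : Measure E) = c := by
  obtain ⟨ν, -, hν⟩ := (isCompact_univ (X := ProbabilityMeasure E)).ultrafilter_le_nhds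
    ((Ultrafilter.of atTop).map μ) (by simp)
  refine ⟨ν, fun f hf c hc => ?_⟩
  have h1 : Tendsto μ ((Ultrafilter.of atTop : Ultrafilter ℕ) : Filter ℕ) (𝓝 ν) := hν
  have h2 := ProbabilityMeasure.tendsto_iff_forall_integral_tendsto.1 h1
    (BoundedContinuousFunction.mkOfCompact ⟨f, hf⟩)
  exact tendsto_nhds_unique h2 (hc.mono_left (Ultrafilter.of_le atTop))

/-! ### The zeros of `Δ - t` -/

section Floquet

variable {α : ℕ → ℂ} {p : ℕ}

lemma isCompact_bands : IsCompact (bands α p) := by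
  have hc : ContinuousOn (floquetDiscr α p) (Metric.sphere 0 1) := by
    have h : floquetDiscr α p = fun z => (z ^ (p / 2))⁻¹ * (discrPoly α p).eval z :=
      funext fun z => floquetDiscr_eq z
    rw [h]
    refine ContinuousOn.mul (ContinuousOn.inv₀ (continuous_pow _).continuousOn fun z hz => ?_)
      (discrPoly α p).continuous.continuousOn
    refine pow_ne_zero _ ?_
    rintro rfl
    simp at hz
  have hI : IsClosed ((fun t : ℝ => (t : ℂ)) '' Set.Icc (-2) 2) :=
    (isCompact_Icc.image Complex.continuous_ofReal).isClosed
  have h1 := hc.preimage_isClosed_of_isClosed Metric.isClosed_sphere hI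
  refine (isCompact_sphere (0 : ℂ) 1).of_isClosed_subset ?_ ?_
  · convert h1 using 1
    ext z
    simp [bands, eq_comm]
  · intro z hz
    simpa using hz.1

lemma coeff_top_discrPoly_sub (hp : 0 < p) (t : ℝ) :
    (discrPoly α p - C (t : ℂ) * X ^ (p / 2)).coeff p = leadConst α p := by
  rw [coeff_sub, coeff_top_discrPoly hp, coeff_C_mul, coeff_X_pow,
    if_neg (by omega), mul_zero, sub_zero]

/-- For `t ∈ [-2, 2]` the polynomial `z^{p/2} (Δ(z) - t)` has `p` zeros, all of them in the
bands. -/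
lemma exists_roots (hα : ∀ n, ‖α n‖ < 1) (hp : 0 < p) (hpe : Even p) {t : ℝ}
    (ht : t ∈ Set.Icc (-2 : ℝ) 2) : ∃ x : Fin p → bands α p, ∀ z : ℂ,
      (discrPoly α p).eval z - t * z ^ (p / 2) = leadConst α p * ∏ j, (z - x j) := by
  set Q := discrPoly α p - C (t : ℂ) * X ^ (p / 2) with hQ
  have hcoeff := coeff_top_discrPoly_sub (α := α) hp t
  rw [← hQ] at hcoeff
  have hdeg : Q.natDegree = p := by
    refine le_antisymm ?_ (le_natDegree_of_ne_zero (by rw [hcoeff]; exact leadConst_ne_zero hα p))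
    refine (natDegree_sub_le_of_le natDegree_discrPoly_le
      ((natDegree_C_mul_X_pow_le _ _).trans (Nat.div_le_self p 2))).trans_eq (max_self p)
  have hsplit := IsAlgClosed.splits Q
  have hcard : Q.roots.toList.length = p := by
    rw [Multiset.length_toList, ← hsplit.natDegree_eq_card_roots, hdeg]
  have hmem : ∀ w ∈ Q.roots, w ∈ bands α p := by
    intro w hw
    have hw0 : (discrPoly α p).eval w = t * w ^ (p / 2) := by
      have := isRoot_of_mem_roots hw
      rw [IsRoot.def, hQ, eval_sub, eval_mul, eval_C, eval_pow, eval_X, sub_eq_zero] at this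
      exact this
    have hwn : w ≠ 0 := by
      rintro rfl
      rw [zero_pow (by have := hpe.two_dvd; have := Nat.le_of_dvd hp this; omega), mul_zero] at hw0
      exact eval_discrPoly_ne_zero hα hp hpe (by simp) hw0
    have hwΔ : floquetDiscr α p w = t := by
      rw [floquetDiscr_eq, hw0]
      field_simp
    exact ⟨norm_eq_one_of_floquetDiscr_eq hα hp hpe hwn ht hwΔ, t, ht, hwΔ⟩
  refine ⟨fun j => ⟨Q.roots.toList.get (j.cast hcard.symm), hmem _ ?_⟩, fun z => ?_⟩
  · exact Multiset.mem_toList.1 (List.get_mem _ _)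
  · have h1 := hsplit.eval_eq_prod_roots z
    rw [leadingCoeff, hdeg, hcoeff] at h1
    have h2 : (Q.roots.map (fun a => z - a)).prod =
        ∏ j : Fin p, (z - Q.roots.toList.get (j.cast hcard.symm)) := by
      rw [← Fintype.prod_equiv (finCongr hcard)
        (fun j => z - Q.roots.toList[(j : ℕ)]) _ (fun j => by simp),
        Fin.prod_univ_fun_getElem Q.roots.toList (fun a => z - a)]
      conv_lhs => rw [← Multiset.coe_toList Q.roots]
      rw [Multiset.map_coe, Multiset.prod_coe]
    rw [← h2, ← h1, hQ]
    simp

/-- `∏_{μ^N = 1} |x + 1/x - 2 Re μ| = |x^N - 1| |x^{-N} - 1|`. -/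
lemma prod_norm_sub_two_re {N : ℕ} (hN : 0 < N) {x y : ℂ} (hxy : x * y = 1) :
    ∏ μ ∈ nthRootsFinset N (1 : ℂ), ‖x + y - ((2 * μ.re : ℝ) : ℂ)‖ =
      ‖x ^ N - 1‖ * ‖y ^ N - 1‖ := by
  have h := Complex.isPrimitiveRoot_exp N hN.ne'
  have h1 := h.pow_sub_pow_eq_prod_sub_mul x 1 hN
  have h2 := h.pow_sub_pow_eq_prod_sub_mul y 1 hN
  simp only [one_pow, mul_one] at h1 h2
  rw [h1, h2, norm_prod, norm_prod, ← Finset.prod_mul_distrib]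
  refine Finset.prod_congr rfl fun μ hμ => ?_
  rw [mem_nthRootsFinset hN] at hμ
  have hμ1 : ‖μ‖ = 1 := Complex.norm_eq_one_of_pow_eq_one hμ hN.ne'
  have hμ2 : μ * (starRingEnd ℂ) μ = 1 := by
    rw [Complex.mul_conj, Complex.normSq_eq_norm_sq, hμ1]; norm_num
  have h3 : ((2 * μ.re : ℝ) : ℂ) = μ + (starRingEnd ℂ) μ := (Complex.add_conj μ).symm
  have h4 : x + y - ((2 * μ.re : ℝ) : ℂ) = -(starRingEnd ℂ) μ * ((x - μ) * (y - μ)) := by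
    rw [h3]
    linear_combination (starRingEnd ℂ μ) * hxy + (- x - y + μ) * hμ2
  rw [h4, norm_mul, norm_neg, RCLike.norm_conj, hμ1, one_mul, norm_mul]

/-! ### The limiting distribution of the zeros of `Δ - t` -/

lemma two_re_mem_Icc {μ : ℂ} (hμ : ‖μ‖ = 1) : 2 * μ.re ∈ Set.Icc (-2 : ℝ) 2 := by
  have := Complex.abs_re_le_norm μ
  rw [hμ, abs_le] at this
  constructor <;> linarith [this.1, this.2]

/-- For `x y = 1`, `|x| > 1`: the mean of `log |x + y - 2 Re μ|` over the `N`-th roots of unity `μ`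
tends to `log |x|`. -/
lemma tendsto_log_prod {x y : ℂ} (hxy : x * y = 1) (hx : 1 < ‖x‖) :
    Tendsto (fun N : ℕ => ((N + 1 : ℕ) : ℝ)⁻¹ *
      Real.log (‖x ^ (N + 1) - 1‖ * ‖y ^ (N + 1) - 1‖)) atTop (𝓝 (Real.log ‖x‖)) := by
  have hx0 : x ≠ 0 := left_ne_zero_of_mul_eq_one hxy
  have hy1 : ‖y‖ < 1 := by
    have : ‖x‖ * ‖y‖ = 1 := by rw [← norm_mul, hxy, norm_one]
    nlinarith [norm_nonneg y]
  have hyN : ∀ N : ℕ, y ^ (N + 1) - 1 ≠ 0 := by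
    intro N h
    have : ‖y ^ (N + 1)‖ = 1 := by rw [sub_eq_zero.1 h, norm_one]
    rw [norm_pow] at this
    exact (pow_lt_one₀ (norm_nonneg y) hy1 N.succ_ne_zero).ne this
  have hxN : ∀ N : ℕ, ‖x ^ (N + 1) - 1‖ = ‖x‖ ^ (N + 1) * ‖y ^ (N + 1) - 1‖ := by
    intro N
    have h1 : x ^ (N + 1) * y ^ (N + 1) = 1 := by rw [← mul_pow, hxy, one_pow]
    rw [← norm_pow, ← norm_mul, mul_sub, h1, mul_one, norm_sub_rev]
  have h1 : Tendsto (fun N : ℕ => ((N + 1 : ℕ) : ℝ)⁻¹) atTop (𝓝 0) :=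
    (tendsto_inv_atTop_zero.comp tendsto_natCast_atTop_atTop).comp (tendsto_add_atTop_nat 1)
  have h2 : Tendsto (fun N : ℕ => Real.log ‖y ^ (N + 1) - 1‖) atTop (𝓝 0) := by
    have h3 : Tendsto (fun N : ℕ => ‖y ^ (N + 1) - 1‖) atTop (𝓝 1) := by
      have := ((tendsto_pow_atTop_nhds_zero_of_norm_lt_one hy1).comp
        (tendsto_add_atTop_nat 1)).sub_const 1 |>.norm
      simpa using this
    have := (Real.continuousAt_log one_ne_zero).tendsto.comp h3
    simpa [Function.comp_def] using this
  have h4 := (tendsto_const_nhds (x := Real.log ‖x‖)).add ((h1.mul h2).const_mul 2)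
  simp only [mul_zero, add_zero] at h4
  refine h4.congr fun N => ?_
  have e1 : ‖y ^ (N + 1) - 1‖ ≠ 0 := norm_ne_zero_iff.2 (hyN N)
  have e2 : ‖x‖ ≠ 0 := norm_ne_zero_iff.2 hx0
  have e3 : ((N + 1 : ℕ) : ℝ) ≠ 0 := by positivity
  rw [hxN, Real.log_mul (mul_ne_zero (pow_ne_zero _ e2) e1) e1, Real.log_mul (pow_ne_zero _ e2) e1,
    Real.log_pow]
  field_simp
  ring

/-- A weak limit of the zero-counting measures of `∏ (Δ - 2 Re μ)`, the product over the `N`-th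
roots of unity `μ`, has the logarithmic potential `log |z^{p/2} Γ_+|` up to normalization. -/
theorem exists_measure_log_norm (hα : ∀ n, ‖α n‖ < 1) (hp : 0 < p) (hpe : Even p) :
    ∃ ν : Measure ℂ, IsProbabilityMeasure ν ∧ ν (bands α p)ᶜ = 0 ∧ ∀ z, ‖z‖ < 1 →
      ∫ w, Real.log ‖w - z‖ ∂ν =
        (Real.log ‖regGamma α p z‖ - Real.log ‖leadConst α p‖) / p := by
  choose x hx using fun (t : ℝ) (ht : t ∈ Set.Icc (-2 : ℝ) 2) => exists_roots hα hp hpe ht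
  have hnorm : ∀ N : ℕ, ∀ μ : (nthRootsFinset (N + 1) (1 : ℂ)), ‖(μ : ℂ)‖ = 1 := fun N μ =>
    Complex.norm_eq_one_of_pow_eq_one ((mem_nthRootsFinset N.succ_pos _).1 μ.2) N.succ_ne_zero
  have : CompactSpace (bands α p) := isCompact_iff_compactSpace.1 isCompact_bands
  have : Nonempty (Fin p) := ⟨⟨0, hp⟩⟩
  have : ∀ N : ℕ, Nonempty (nthRootsFinset (N + 1) (1 : ℂ)) := fun N =>
    ⟨⟨1, by rw [mem_nthRootsFinset N.succ_pos]; simp⟩⟩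
  choose m hm using fun N : ℕ => exists_uniform_measure
    (fun i : (nthRootsFinset (N + 1) (1 : ℂ)) × Fin p =>
      x (2 * (i.1 : ℂ).re) (two_re_mem_Icc (hnorm N i.1)) i.2)
  obtain ⟨ν, hν⟩ := exists_weak_limit m
  have hmeas : MeasurableSet (bands α p) := isCompact_bands.isClosed.measurableSet
  have hemb : MeasurableEmbedding (Subtype.val : bands α p → ℂ) :=
    MeasurableEmbedding.subtype_coe hmeas
  set ν' := Measure.map (Subtype.val : bands α p → ℂ) (ν : Measure (bands α p)) with hν'
  have hprob : IsProbabilityMeasure ν' :=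
    Measure.isProbabilityMeasure_map measurable_subtype_coe.aemeasurable
  have hsupp : ν' (bands α p)ᶜ = 0 := by
    rw [hν', Measure.map_apply measurable_subtype_coe hmeas.compl]
    convert measure_empty (μ := (ν : Measure (bands α p)))
    ext w; simp
  refine ⟨ν', hprob, hsupp, fun z hz1 => ?_⟩
  have hC0 : leadConst α p ≠ 0 := leadConst_ne_zero hα p
  rcases eq_or_ne z 0 with rfl | hz
  · rw [regGamma_zero hp, sub_self, zero_div]
    refine integral_eq_zero_of_ae ?_
    have : ∀ᵐ w ∂ν', w ∈ bands α p := hsupp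
    filter_upwards [this] with w hw
    simp [hw.1]
  rw [hν', hemb.integral_map]
  -- As `|z| < 1`, the logarithm is continuous on the bands, so the weak limit applies to it.
  have hne : ∀ w : bands α p, (w : ℂ) - z ≠ 0 := by
    intro w h
    have := w.2.1
    rw [sub_eq_zero.1 h] at this
    exact hz1.ne this
  have hcont : Continuous fun w : bands α p => Real.log ‖(w : ℂ) - z‖ := by
    refine Continuous.log (by fun_prop) fun w => norm_ne_zero_iff.2 (hne w)
  refine hν _ hcont _ ?_
  have hgp := one_lt_norm_gammaPlus hα hp hpe hz hz1.ne
  have hlim := tendsto_log_prod (gammaPlus_mul_gammaMinus (α := α) (p := p) z) hgp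
  have hlim2 := (hlim.add_const (Real.log ‖z ^ (p / 2)‖ - Real.log ‖leadConst α p‖)).div_const
    (p : ℝ)
  have hzq : ‖z ^ (p / 2)‖ ≠ 0 := norm_ne_zero_iff.2 (pow_ne_zero _ hz)
  have hval : (Real.log ‖gammaPlus α p z‖ + (Real.log ‖z ^ (p / 2)‖ - Real.log ‖leadConst α p‖))
      / p = (Real.log ‖regGamma α p z‖ - Real.log ‖leadConst α p‖) / p := by
    rw [regGamma_eq hα hp hpe hz hz1, norm_mul,
      Real.log_mul hzq (norm_ne_zero_iff.2 (gammaPlus_ne_zero z))]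
    ring
  rw [hval] at hlim2
  refine hlim2.congr fun N => ?_
  rw [hm N _ hcont, Fintype.card_prod, Fintype.card_fin, Fintype.card_coe,
    (Complex.isPrimitiveRoot_exp (N + 1) N.succ_ne_zero).card_nthRootsFinset, Fintype.sum_prod_type]
  have hinner : ∀ μ : (nthRootsFinset (N + 1) (1 : ℂ)),
      ∑ j, Real.log ‖(x (2 * (μ : ℂ).re) (two_re_mem_Icc (hnorm N μ)) j : ℂ) - z‖ =
        Real.log ‖floquetDiscr α p z - ((2 * (μ : ℂ).re : ℝ) : ℂ)‖ +
          (Real.log ‖z ^ (p / 2)‖ - Real.log ‖leadConst α p‖) := by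
    intro μ
    have h1 := hx (2 * (μ : ℂ).re) (two_re_mem_Icc (hnorm N μ)) z
    have hd : floquetDiscr α p z - ((2 * (μ : ℂ).re : ℝ) : ℂ) ≠ 0 :=
      sub_ne_zero.2 (floquetDiscr_ne_real hα hp hpe hz hz1 (two_re_mem_Icc (hnorm N μ)))
    rw [eval_discrPoly z hz] at h1
    have h2 : z ^ (p / 2) * (floquetDiscr α p z - ((2 * (μ : ℂ).re : ℝ) : ℂ)) =
        leadConst α p * ∏ j, (z - x (2 * (μ : ℂ).re) (two_re_mem_Icc (hnorm N μ)) j) := by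
      rw [← h1]; ring
    have h3 := congrArg (fun u : ℂ => Real.log ‖u‖) h2
    simp only [norm_mul, norm_prod] at h3
    have h4 : ∀ j, ‖z - x (2 * (μ : ℂ).re) (two_re_mem_Icc (hnorm N μ)) j‖ ≠ 0 := fun j => by
      rw [norm_sub_rev]; exact norm_ne_zero_iff.2 (hne _)
    rw [Real.log_mul hzq (norm_ne_zero_iff.2 hd), Real.log_mul (norm_ne_zero_iff.2 hC0)
      (Finset.prod_ne_zero_iff.2 fun j _ => h4 j), Real.log_prod fun j _ => h4 j] at h3
    simp only [norm_sub_rev z] at h3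
    linarith
  simp only [hinner]
  rw [Finset.sum_add_distrib, Finset.sum_const, Finset.card_univ, Fintype.card_coe,
    (Complex.isPrimitiveRoot_exp (N + 1) N.succ_ne_zero).card_nthRootsFinset,
    ← prod_norm_sub_two_re N.succ_pos (gammaPlus_mul_gammaMinus z), gammaPlus_add_gammaMinus,
    Real.log_prod, Finset.sum_coe_sort (nthRootsFinset (N + 1) (1 : ℂ))
      (fun μ => Real.log ‖floquetDiscr α p z - ((2 * μ.re : ℝ) : ℂ)‖)]
  · have e1 : (p : ℝ) ≠ 0 := by exact_mod_cast hp.ne'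
    have e3 : ((N + 1 : ℕ) : ℝ) ≠ 0 := by positivity
    rw [nsmul_eq_mul, Nat.cast_mul]
    field_simp
  · intro μ hμ
    exact norm_ne_zero_iff.2 (sub_ne_zero.2 (floquetDiscr_ne_real hα hp hpe hz hz1
      (two_re_mem_Icc (hnorm N ⟨μ, hμ⟩))))

end Floquet

/-! ### Logarithmic kernels and moments of measures on the circle -/

section Kernel

lemma one_sub_le_norm {z w : ℂ} (hw : ‖w‖ = 1) : 1 - ‖z‖ ≤ ‖1 - z * (starRingEnd ℂ) w‖ := by
  have := norm_sub_norm_le 1 (z * (starRingEnd ℂ) w)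
  rwa [norm_one, norm_mul, RCLike.norm_conj, hw, mul_one] at this

lemma norm_one_sub_le_two {z w : ℂ} (hz : ‖z‖ ≤ 1) (hw : ‖w‖ = 1) :
    ‖1 - z * (starRingEnd ℂ) w‖ ≤ 2 := by
  have := norm_sub_le 1 (z * (starRingEnd ℂ) w)
  rw [norm_one, norm_mul, RCLike.norm_conj, hw, mul_one] at this
  linarith

lemma norm_one_sub_eq {z w : ℂ} (hw : ‖w‖ = 1) :
    ‖1 - z * (starRingEnd ℂ) w‖ = ‖w - z‖ := by
  have h : w * (starRingEnd ℂ) w = 1 := by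
    rw [Complex.mul_conj, Complex.normSq_eq_norm_sq, hw]; norm_num
  have h2 : 1 - z * (starRingEnd ℂ) w = (w - z) * (starRingEnd ℂ) w := by
    rw [sub_mul, h]
  rw [h2, norm_mul, RCLike.norm_conj, hw, mul_one]

lemma abs_log_norm_le {z w : ℂ} (hz : ‖z‖ < 1) (hw : ‖w‖ = 1) :
    |Real.log ‖1 - z * (starRingEnd ℂ) w‖| ≤ Real.log 2 - Real.log (1 - ‖z‖) := by
  have h1 := one_sub_le_norm (z := z) hw
  have h2 := norm_one_sub_le_two hz.le hw
  have h0 : 0 < 1 - ‖z‖ := by linarith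
  have h3 := Real.log_le_log h0 h1
  have h4 := Real.log_le_log (h0.trans_le h1) h2
  have h5 : Real.log (1 - ‖z‖) ≤ 0 := Real.log_nonpos h0.le (by linarith [norm_nonneg z])
  have h6 : 0 ≤ Real.log 2 := Real.log_nonneg (by norm_num)
  rw [abs_le]
  constructor <;> linarith

lemma measurable_log_one_sub (z : ℂ) :
    Measurable fun w : ℂ => Complex.log (1 - z * (starRingEnd ℂ) w) := by
  refine Complex.measurable_log.comp ?_
  exact ((continuous_const.mul Complex.continuous_conj).measurable).const_sub 1

variable {μ ν : Measure ℂ}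

lemma integrable_log_one_sub [IsFiniteMeasure μ] (hμ : ∀ᵐ w ∂μ, ‖w‖ = 1) {z : ℂ} (hz : ‖z‖ < 1) :
    Integrable (fun w => Complex.log (1 - z * (starRingEnd ℂ) w)) μ := by
  refine Integrable.of_bound (measurable_log_one_sub z).aestronglyMeasurable
    (Real.log 2 - Real.log (1 - ‖z‖) + Real.pi) ?_
  filter_upwards [hμ] with w hw
  refine (Complex.norm_le_abs_re_add_abs_im _).trans (add_le_add ?_ ?_)
  · rw [Complex.log_re]; exact abs_log_norm_le hz hw
  · rw [Complex.log_im]; exact Complex.abs_arg_le_pi _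

lemma integral_log_norm_eq_re [IsFiniteMeasure μ] (hμ : ∀ᵐ w ∂μ, ‖w‖ = 1) {z : ℂ}
    (hz : ‖z‖ < 1) : ∫ w, Real.log ‖1 - z * (starRingEnd ℂ) w‖ ∂μ =
      (∫ w, Complex.log (1 - z * (starRingEnd ℂ) w) ∂μ).re := by
  have h := integral_re (integrable_log_one_sub hμ hz)
  simp only [RCLike.re_to_complex, Complex.log_re] at h
  exact h

/-- The Taylor series of the logarithmic potential. The term `n = 0` is `0`, by division by zero. -/
lemma hasSum_integral_log [IsFiniteMeasure μ] (hμ : ∀ᵐ w ∂μ, ‖w‖ = 1) {z : ℂ} (hz : ‖z‖ < 1) :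
    HasSum (fun n : ℕ => z ^ n / n * (starRingEnd ℂ) (∫ w, w ^ n ∂μ))
      (-∫ w, Complex.log (1 - z * (starRingEnd ℂ) w) ∂μ) := by
  set F : ℕ → ℂ → ℂ := fun n w => (z * (starRingEnd ℂ) w) ^ n / n with hF
  have hb : ∀ n, ∀ᵐ w ∂μ, ‖F n w‖ ≤ ‖z‖ ^ n := by
    intro n
    filter_upwards [hμ] with w hw
    rw [hF]
    simp only [norm_div, norm_pow, norm_mul, RCLike.norm_conj, hw, mul_one, Complex.norm_natCast]
    rcases Nat.eq_zero_or_pos n with rfl | hn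
    · simp
    · exact div_le_self (by positivity) (by exact_mod_cast hn)
  have hm : ∀ n, AEStronglyMeasurable (F n) μ := fun n => by
    refine Continuous.aestronglyMeasurable ?_
    exact ((continuous_const.mul Complex.continuous_conj).pow n).div_const _
  have hint : ∀ n, Integrable (F n) μ := fun n => Integrable.of_bound (hm n) _ (hb n)
  have hsum : Summable fun n => ∫ w, ‖F n w‖ ∂μ := by
    refine Summable.of_nonneg_of_le (fun n => integral_nonneg fun _ => norm_nonneg _)
      (fun n => ?_) ((summable_geometric_of_lt_one (norm_nonneg z) hz).mul_left (μ.real Set.univ))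
    have := integral_mono_ae (hint n).norm (integrable_const (‖z‖ ^ n)) (hb n)
    simpa using this
  have h := hasSum_integral_of_summable_integral_norm hint hsum
  have h1 : ∫ w, ∑' n, F n w ∂μ = -∫ w, Complex.log (1 - z * (starRingEnd ℂ) w) ∂μ := by
    rw [← integral_neg]
    refine integral_congr_ae ?_
    filter_upwards [hμ] with w hw
    exact (Complex.hasSum_taylorSeries_neg_log (by simpa [hw] using hz)).tsum_eq
  rw [h1] at h
  refine (congrArg (HasSum · _) (funext fun n => ?_)).mpr h
  rw [← integral_conj]
  simp only [hF, mul_pow, map_pow, mul_div_right_comm]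
  exact (integral_const_mul _ _).symm

lemma norm_moment_le [IsProbabilityMeasure μ] (hμ : ∀ᵐ w ∂μ, ‖w‖ = 1) (n : ℕ) :
    ‖∫ w, w ^ n ∂μ‖ ≤ 1 := by
  have := norm_integral_le_of_norm_le_const (μ := μ) (f := fun w : ℂ => w ^ n) (C := 1)
    (hμ.mono fun w hw => by simp [hw])
  simpa using this

/-- The mutual energy of `μ` and `ν` for the kernel `-log |1 - r z conj w|`; on the circle this is a
regularization, smooth for `r < 1`, of `-log |z - w|`. -/
noncomputable def abelEnergy (r : ℝ) (μ ν : Measure ℂ) : ℝ :=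
  ∫ z, ∫ w, -Real.log ‖1 - (r : ℂ) * z * (starRingEnd ℂ) w‖ ∂ν ∂μ

lemma norm_radius_mul {r : ℝ} (hr : r ∈ Set.Ioo (0 : ℝ) 1) {z : ℂ} (hz : ‖z‖ = 1) :
    ‖(r : ℂ) * z‖ = r := (radius_mem hz hr).2.1

lemma hasSum_abelEnergy [IsProbabilityMeasure μ] [IsProbabilityMeasure ν]
    (hμ : ∀ᵐ w ∂μ, ‖w‖ = 1) (hν : ∀ᵐ w ∂ν, ‖w‖ = 1) {r : ℝ} (hr : r ∈ Set.Ioo (0 : ℝ) 1) :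
    HasSum (fun n : ℕ => r ^ n / n * ((∫ w, w ^ n ∂μ) * (starRingEnd ℂ) (∫ w, w ^ n ∂ν)).re)
      (abelEnergy r μ ν) := by
  set a : ℕ → ℂ := fun n => (starRingEnd ℂ) (∫ w, w ^ n ∂ν) with ha
  have ha1 : ∀ n, ‖a n‖ ≤ 1 := fun n => by
    rw [ha]; simpa using norm_moment_le hν n
  set F : ℕ → ℂ → ℝ := fun n z => (((r : ℂ) * z) ^ n / n * a n).re with hF
  have hbC : ∀ n, ∀ᵐ z ∂μ, ‖((r : ℂ) * z) ^ n / n * a n‖ ≤ r ^ n := by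
    intro n
    filter_upwards [hμ] with z hz
    rw [norm_mul, norm_div, norm_pow, norm_radius_mul hr hz, Complex.norm_natCast]
    have h1 : r ^ n / n ≤ r ^ n := by
      rcases Nat.eq_zero_or_pos n with rfl | hn
      · simp
      · exact div_le_self (pow_nonneg hr.1.le n) (by exact_mod_cast hn)
    have h2 : 0 ≤ r ^ n := pow_nonneg hr.1.le n
    calc r ^ n / n * ‖a n‖ ≤ r ^ n * 1 := mul_le_mul h1 (ha1 n) (norm_nonneg _) h2
      _ = r ^ n := mul_one _
  have hb : ∀ n, ∀ᵐ z ∂μ, ‖F n z‖ ≤ r ^ n := fun n =>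
    (hbC n).mono fun z hz => (Complex.abs_re_le_norm _).trans hz
  have hc : ∀ n, Continuous fun z : ℂ => ((r : ℂ) * z) ^ n / n * a n := fun n =>
    (((continuous_const.mul continuous_id).pow n).div_const _).mul continuous_const
  have hint : ∀ n, Integrable (F n) μ := fun n =>
    Integrable.of_bound (Complex.continuous_re.comp (hc n)).aestronglyMeasurable _ (hb n)
  have hsum : Summable fun n => ∫ w, ‖F n w‖ ∂μ := by
    refine Summable.of_nonneg_of_le (fun n => integral_nonneg fun _ => norm_nonneg _)
      (fun n => ?_) (summable_geometric_of_lt_one hr.1.le hr.2)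
    have := integral_mono_ae (hint n).norm (integrable_const (r ^ n)) (hb n)
    simpa using this
  have h := hasSum_integral_of_summable_integral_norm hint hsum
  have h1 : ∫ z, ∑' n, F n z ∂μ = abelEnergy r μ ν := by
    refine integral_congr_ae ?_
    filter_upwards [hμ] with z hz
    have hz1 : ‖(r : ℂ) * z‖ < 1 := (norm_radius_mul hr hz).trans_lt hr.2
    have h2 := Complex.hasSum_re (hasSum_integral_log hν hz1)
    rw [integral_neg, integral_log_norm_eq_re hν hz1]
    simpa [hF, ha] using h2.tsum_eq
  rw [h1] at h
  refine (congrArg (HasSum · _) (funext fun n => ?_)).mpr h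
  have hint' : Integrable (fun z : ℂ => ((r : ℂ) * z) ^ n / n * a n) μ :=
    Integrable.of_bound (hc n).aestronglyMeasurable _ (hbC n)
  have h3 := integral_re hint'
  simp only [RCLike.re_to_complex] at h3
  rw [hF, h3, integral_mul_const, integral_div]
  simp only [mul_pow]
  rw [integral_const_mul]
  have h4 : (r : ℂ) ^ n * (∫ w, w ^ n ∂μ) / n * a n =
      ((r ^ n / n : ℝ) : ℂ) * ((∫ w, w ^ n ∂μ) * a n) := by
    push_cast; ring
  rw [h4, Complex.re_ofReal_mul]

/-- Positivity of the regularized energy of a difference of two probability measures, with a bound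
for the single moments. -/
lemma le_abelEnergy_sub [IsProbabilityMeasure μ] [IsProbabilityMeasure ν]
    (hμ : ∀ᵐ w ∂μ, ‖w‖ = 1) (hν : ∀ᵐ w ∂ν, ‖w‖ = 1) {r : ℝ} (hr : r ∈ Set.Ioo (0 : ℝ) 1) (n : ℕ) :
    r ^ n / n * ‖∫ w, w ^ n ∂μ - ∫ w, w ^ n ∂ν‖ ^ 2 ≤
      abelEnergy r μ μ - 2 * abelEnergy r μ ν + abelEnergy r ν ν := by
  have h := ((hasSum_abelEnergy hμ hμ hr).sub ((hasSum_abelEnergy hμ hν hr).mul_left 2)).add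
    (hasSum_abelEnergy hν hν hr)
  have h1 : ∀ k : ℕ, r ^ k / k * ((∫ w, w ^ k ∂μ) * (starRingEnd ℂ) (∫ w, w ^ k ∂μ)).re -
      2 * (r ^ k / k * ((∫ w, w ^ k ∂μ) * (starRingEnd ℂ) (∫ w, w ^ k ∂ν)).re) +
      r ^ k / k * ((∫ w, w ^ k ∂ν) * (starRingEnd ℂ) (∫ w, w ^ k ∂ν)).re =
      r ^ k / k * ‖∫ w, w ^ k ∂μ - ∫ w, w ^ k ∂ν‖ ^ 2 := by
    intro k
    generalize ∫ w, w ^ k ∂μ = a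
    generalize ∫ w, w ^ k ∂ν = b
    rw [← Complex.normSq_eq_norm_sq, Complex.normSq_apply]
    simp only [Complex.mul_re, Complex.conj_re, Complex.conj_im, Complex.sub_re, Complex.sub_im]
    ring
  simp only [h1] at h
  exact le_hasSum h n fun k _ => mul_nonneg
    (div_nonneg (pow_nonneg hr.1.le k) (Nat.cast_nonneg k)) (sq_nonneg _)

end Kernel

/-! ### The logarithmic energy as a limit of regularized energies -/

section Energy

open Classical in
/-- The kernel `log 2 - log |z - w|`, equal to `∞` on the diagonal. The shift by `log 2` makes it
nonnegative on the unit circle; elsewhere `ENNReal.ofReal` truncates it. -/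
noncomputable def energyKernel (q : ℂ × ℂ) : ENNReal :=
  if q.1 = q.2 then ⊤ else ENNReal.ofReal (Real.log 2 - Real.log (dist q.1 q.2))

lemma measurable_energyKernel : Measurable energyKernel := by
  refine Measurable.ite (measurableSet_eq_fun measurable_fst measurable_snd) measurable_const ?_
  exact ENNReal.measurable_ofReal.comp
    ((Real.measurable_log.comp measurable_dist).const_sub _)

lemma energyKernel_add {z w : ℂ} (hz : ‖z‖ = 1) (hw : ‖w‖ = 1) :
    energyKernel (z, w) + (ENNReal.log (edist z w)).toENNReal =
      (-ENNReal.log (edist z w)).toENNReal + ENNReal.ofReal (Real.log 2) := by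
  rw [energyKernel]
  split_ifs with h
  · simp only at h
    subst h
    simp
  · have hd : 0 < dist z w := dist_pos.2 h
    have hd2 : dist z w ≤ 2 := by
      rw [dist_eq_norm]
      have := norm_sub_le z w
      linarith
    have hl : Real.log (dist z w) ≤ Real.log 2 := Real.log_le_log hd hd2
    have h2 : 0 ≤ Real.log 2 := Real.log_nonneg (by norm_num)
    rw [edist_dist, ENNReal.log_ofReal_of_pos hd, ← EReal.coe_neg, EReal.real_coe_toENNReal,
      EReal.real_coe_toENNReal]
    rcases le_total 0 (Real.log (dist z w)) with h0 | h0
    · rw [ENNReal.ofReal_of_nonpos (show -Real.log (dist z w) ≤ 0 by linarith), zero_add,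
        ← ENNReal.ofReal_add (by simpa using hl) h0]
      congr 1; ring
    · rw [ENNReal.ofReal_of_nonpos h0, add_zero, ← ENNReal.ofReal_add (by linarith) h2]
      congr 1; ring

/-- Rearrangement of `X + B = A + c` into a difference of extended reals, `A` and `X` being possibly
infinite. -/
lemma ereal_sub_eq {A B X c : ENNReal} (hB : B ≠ ⊤) (hc : c ≠ ⊤) (h : X + B = A + c) :
    (A : EReal) - B = X - c := by
  lift B to NNReal using hB
  lift c to NNReal using hc
  rcases eq_or_ne A ⊤ with rfl | hA
  · have hX : X = ⊤ := by simpa using h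
    rw [hX]
    have : ∀ b : NNReal, ((⊤ : ENNReal) : EReal) - ((b : ENNReal) : EReal) = ⊤ := fun b => by
      rw [EReal.coe_ennreal_top]
      exact EReal.top_sub_coe (b : ℝ)
    rw [this, this]
  · have hX : X ≠ ⊤ := by
      rintro rfl
      rw [top_add] at h
      exact ENNReal.add_ne_top.2 ⟨hA, ENNReal.coe_ne_top⟩ h.symm
    lift A to NNReal using hA
    lift X to NNReal using hX
    have h1 : (X : ℝ) + B = A + c := by exact_mod_cast h
    change ((A : ℝ) : EReal) - ((B : ℝ) : EReal) = ((X : ℝ) : EReal) - ((c : ℝ) : EReal)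
    rw [← EReal.coe_sub, ← EReal.coe_sub]
    congr 1
    linarith

variable {μ ν : Measure ℂ}

lemma ae_prod_norm [IsProbabilityMeasure μ] (hμ : ∀ᵐ w ∂μ, ‖w‖ = 1) :
    ∀ᵐ q ∂(μ.prod μ), ‖q.1‖ = 1 ∧ ‖q.2‖ = 1 :=
  (Measure.quasiMeasurePreserving_fst.ae hμ).and (Measure.quasiMeasurePreserving_snd.ae hμ)

/-- On the circle the energy is the integral of one nonnegative kernel, minus `log 2`. -/
lemma logEnergy_eq [IsProbabilityMeasure μ] (hμ : ∀ᵐ w ∂μ, ‖w‖ = 1) :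
    logEnergy μ = ((∫⁻ q, energyKernel q ∂(μ.prod μ) : ENNReal) : EReal) -
      ((ENNReal.ofReal (Real.log 2) : ENNReal) : EReal) := by
  have hm1 : Measurable fun q : ℂ × ℂ => (-ENNReal.log (edist q.1 q.2)).toENNReal :=
    (ENNReal.measurable_log.comp measurable_edist).neg.ereal_toENNReal
  have hm2 : Measurable fun q : ℂ × ℂ => (ENNReal.log (edist q.1 q.2)).toENNReal :=
    (ENNReal.measurable_log.comp measurable_edist).ereal_toENNReal
  rw [logEnergy, ← lintegral_prod _ hm1.aemeasurable, ← lintegral_prod _ hm2.aemeasurable]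
  refine ereal_sub_eq ?_ ENNReal.ofReal_ne_top ?_
  · refine ne_of_lt (lt_of_le_of_lt (lintegral_mono_ae (g := fun _ => ENNReal.ofReal (Real.log 2))
      ?_) (by simp))
    filter_upwards [ae_prod_norm hμ] with q hq
    have h1 : edist q.1 q.2 ≤ ENNReal.ofReal 2 := by
      rw [edist_dist]
      refine ENNReal.ofReal_le_ofReal ?_
      rw [dist_eq_norm]
      have := norm_sub_le q.1 q.2
      linarith [hq.1, hq.2]
    have h2 := ENNReal.log_monotone h1
    rw [ENNReal.log_ofReal_of_pos two_pos] at h2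
    exact EReal.toENNReal_le_toENNReal h2
  · rw [← lintegral_add_right _ hm2]
    have : ∫⁻ q, ((-ENNReal.log (edist q.1 q.2)).toENNReal + ENNReal.ofReal (Real.log 2))
        ∂(μ.prod μ) = ∫⁻ q, (-ENNReal.log (edist q.1 q.2)).toENNReal ∂(μ.prod μ) +
          ENNReal.ofReal (Real.log 2) := by
      rw [lintegral_add_right _ measurable_const]; simp
    rw [← this]
    refine lintegral_congr_ae ?_
    filter_upwards [ae_prod_norm hμ] with q hq using energyKernel_add hq.1 hq.2

lemma measurable_abelKernel (r : ℝ) : Measurable fun q : ℂ × ℂ =>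
    -Real.log ‖1 - (r : ℂ) * q.1 * (starRingEnd ℂ) q.2‖ := by
  refine (Real.measurable_log.comp (Continuous.measurable ?_)).neg
  have : Continuous fun q : ℂ × ℂ => (starRingEnd ℂ) q.2 :=
    Complex.continuous_conj.comp continuous_snd
  fun_prop

lemma abs_abelKernel_le {r : ℝ} (hr : r ∈ Set.Ioo (0 : ℝ) 1) {z w : ℂ} (hz : ‖z‖ = 1)
    (hw : ‖w‖ = 1) : |-Real.log ‖1 - (r : ℂ) * z * (starRingEnd ℂ) w‖| ≤
      Real.log 2 - Real.log (1 - r) := by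
  rw [abs_neg]
  have h := norm_radius_mul hr hz
  have := abs_log_norm_le (h.trans_lt hr.2) hw
  rwa [h] at this

lemma neg_log_two_le_abelKernel {r : ℝ} (hr : r ∈ Set.Ioo (0 : ℝ) 1) {z w : ℂ} (hz : ‖z‖ = 1)
    (hw : ‖w‖ = 1) : -Real.log 2 ≤ -Real.log ‖1 - (r : ℂ) * z * (starRingEnd ℂ) w‖ := by
  have h := norm_radius_mul hr hz
  refine neg_le_neg (Real.log_le_log ?_ (norm_one_sub_le_two (h.trans_lt hr.2).le hw))
  have := one_sub_le_norm (z := (r : ℂ) * z) hw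
  rw [h] at this
  linarith [hr.2]

lemma integrable_abelKernel [IsProbabilityMeasure μ] (hμ : ∀ᵐ w ∂μ, ‖w‖ = 1) {r : ℝ}
    (hr : r ∈ Set.Ioo (0 : ℝ) 1) : Integrable (fun q : ℂ × ℂ =>
      -Real.log ‖1 - (r : ℂ) * q.1 * (starRingEnd ℂ) q.2‖) (μ.prod μ) := by
  refine Integrable.of_bound (measurable_abelKernel r).aestronglyMeasurable
    (Real.log 2 - Real.log (1 - r)) ?_
  filter_upwards [ae_prod_norm hμ] with q hq using abs_abelKernel_le hr hq.1 hq.2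

lemma abelEnergy_eq_prod [IsProbabilityMeasure μ] (hμ : ∀ᵐ w ∂μ, ‖w‖ = 1) {r : ℝ}
    (hr : r ∈ Set.Ioo (0 : ℝ) 1) : abelEnergy r μ μ =
      ∫ q, -Real.log ‖1 - (r : ℂ) * q.1 * (starRingEnd ℂ) q.2‖ ∂(μ.prod μ) :=
  (integral_prod _ (integrable_abelKernel hμ hr)).symm

/-- The regularized kernel tends to the logarithmic kernel as `r ↑ 1`. -/
lemma tendsto_energyKernel {z w : ℂ} (hz : ‖z‖ = 1) (hw : ‖w‖ = 1) :
    Tendsto (fun r : ℝ => ENNReal.ofReal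
      (Real.log 2 + -Real.log ‖1 - (r : ℂ) * z * (starRingEnd ℂ) w‖)) (𝓝[<] 1)
      (𝓝 (energyKernel (z, w))) := by
  have hcont : Tendsto (fun r : ℝ => ‖1 - (r : ℂ) * z * (starRingEnd ℂ) w‖) (𝓝[<] 1)
      (𝓝 ‖1 - z * (starRingEnd ℂ) w‖) :=
    (((tendsto_radius z).mul_const _).const_sub 1).norm
  rw [energyKernel]
  split_ifs with h
  · simp only at h
    subst h
    have h1 : ‖1 - z * (starRingEnd ℂ) z‖ = 0 := by rw [norm_one_sub_eq hz]; simp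
    rw [h1] at hcont
    refine ENNReal.tendsto_ofReal_atTop.comp (tendsto_atTop_add_const_left _ _ ?_)
    refine tendsto_neg_atBot_atTop.comp (Real.tendsto_log_nhdsNE_zero.comp
      (tendsto_nhdsWithin_iff.2 ⟨hcont, ?_⟩))
    filter_upwards [eventually_mem_Ioo] with r hr
    have := one_sub_le_norm (z := (r : ℂ) * z) hz
    rw [norm_radius_mul hr hz] at this
    exact (lt_of_lt_of_le (by linarith [hr.2]) this).ne'
  · simp only at h
    have h1 : ‖1 - z * (starRingEnd ℂ) w‖ = dist z w := by
      rw [norm_one_sub_eq hw, ← dist_eq_norm, dist_comm]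
    rw [h1] at hcont
    have h2 := (Real.continuousAt_log (dist_pos.2 h).ne').tendsto.comp hcont
    exact ENNReal.tendsto_ofReal (h2.neg.const_add (Real.log 2))

/-- Fatou: the energy is at most the limit of the regularized energies. -/
lemma lintegral_energyKernel_le [IsProbabilityMeasure μ] (hμ : ∀ᵐ w ∂μ, ‖w‖ = 1) {V : ℝ}
    (hV : Tendsto (fun r => abelEnergy r μ μ) (𝓝[<] 1) (𝓝 V)) :
    ∫⁻ q, energyKernel q ∂(μ.prod μ) ≤ ENNReal.ofReal (Real.log 2 + V) := by
  set G : ℝ → ℂ × ℂ → ENNReal := fun r q => ENNReal.ofReal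
      (Real.log 2 + -Real.log ‖1 - (r : ℂ) * q.1 * (starRingEnd ℂ) q.2‖) with hG
  have hGm : ∀ r, Measurable (G r) := fun r =>
    ENNReal.measurable_ofReal.comp ((measurable_abelKernel r).const_add _)
  have hlim : Tendsto (fun r => ∫⁻ q, G r q ∂(μ.prod μ)) (𝓝[<] 1)
      (𝓝 (ENNReal.ofReal (Real.log 2 + V))) := by
    refine (ENNReal.tendsto_ofReal (hV.const_add (Real.log 2))).congr' ?_
    filter_upwards [eventually_mem_Ioo] with r hr
    have hi := integrable_abelKernel hμ hr
    have h1 := ofReal_integral_eq_lintegral_ofReal ((integrable_const (Real.log 2)).add hi) (by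
      filter_upwards [ae_prod_norm hμ] with q hq
      have := neg_log_two_le_abelKernel hr hq.1 hq.2
      simp only [Pi.add_apply, Pi.zero_apply]
      linarith)
    simp only [Pi.add_apply] at h1
    rw [integral_add (integrable_const _) hi, ← abelEnergy_eq_prod hμ hr] at h1
    simpa using h1
  calc ∫⁻ q, energyKernel q ∂(μ.prod μ)
      = ∫⁻ q, liminf (fun r => G r q) (𝓝[<] 1) ∂(μ.prod μ) := by
        refine lintegral_congr_ae ?_
        filter_upwards [ae_prod_norm hμ] with q hq
        exact (tendsto_energyKernel hq.1 hq.2).liminf_eq.symm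
    _ ≤ liminf (fun r => ∫⁻ q, G r q ∂(μ.prod μ)) (𝓝[<] 1) := lintegral_liminf_le hGm
    _ = _ := hlim.liminf_eq

/-- If the energy is finite, it is the limit of the regularized energies, by dominated
convergence. -/
lemma tendsto_abelEnergy [IsProbabilityMeasure μ] (hμ : ∀ᵐ w ∂μ, ‖w‖ = 1)
    (hfin : ∫⁻ q, energyKernel q ∂(μ.prod μ) ≠ ⊤) :
    Tendsto (fun r => abelEnergy r μ μ) (𝓝[<] 1)
      (𝓝 ((∫⁻ q, energyKernel q ∂(μ.prod μ)).toReal - Real.log 2)) := by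
  have hlt : ∀ᵐ q ∂(μ.prod μ), energyKernel q < ⊤ := ae_lt_top measurable_energyKernel hfin
  have hint : Integrable (fun q => (energyKernel q).toReal) (μ.prod μ) :=
    integrable_toReal_of_lintegral_ne_top measurable_energyKernel.aemeasurable hfin
  rw [← integral_toReal measurable_energyKernel.aemeasurable hlt]
  have hlim : Tendsto (fun r : ℝ => ∫ q, (Real.log 2 +
      -Real.log ‖1 - (r : ℂ) * q.1 * (starRingEnd ℂ) q.2‖) ∂(μ.prod μ)) (𝓝[<] 1)
      (𝓝 (∫ q, (energyKernel q).toReal ∂(μ.prod μ))) := by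
    refine tendsto_integral_filter_of_dominated_convergence
      (fun q => (energyKernel q).toReal + Real.log 2) ?_ ?_
      (hint.add (integrable_const _)) ?_
    · exact Eventually.of_forall fun r =>
        ((measurable_abelKernel r).const_add _).aestronglyMeasurable
    · filter_upwards [eventually_mem_Ioo] with r hr
      filter_upwards [ae_prod_norm hμ, hlt] with q hq hqt
      have h1 := neg_log_two_le_abelKernel hr hq.1 hq.2
      rw [Real.norm_of_nonneg (by linarith)]
      have hne : q.1 ≠ q.2 := by
        intro h
        rw [energyKernel, if_pos h] at hqt
        exact lt_irrefl _ hqt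
      have hd : 0 < dist q.1 q.2 := dist_pos.2 hne
      have hd2 : dist q.1 q.2 ≤ 2 := by
        rw [dist_eq_norm]
        have := norm_sub_le q.1 q.2
        linarith [hq.1, hq.2]
      have hl : Real.log (dist q.1 q.2) ≤ Real.log 2 := Real.log_le_log hd hd2
      rw [energyKernel, if_neg hne, ENNReal.toReal_ofReal (by linarith)]
      -- `|1 - x| ≤ 2 |1 - r x|` for `|x| = 1`
      have h2 : dist q.1 q.2 / 2 ≤ ‖1 - (r : ℂ) * q.1 * (starRingEnd ℂ) q.2‖ := by
        have e1 : dist q.1 q.2 = ‖1 - q.1 * (starRingEnd ℂ) q.2‖ := by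
          rw [norm_one_sub_eq hq.2, ← dist_eq_norm, dist_comm]
        have e2 : 1 - q.1 * (starRingEnd ℂ) q.2 = (1 - (r : ℂ) * q.1 * (starRingEnd ℂ) q.2) +
            ((r : ℂ) * q.1 - q.1) * (starRingEnd ℂ) q.2 := by ring
        have e3 := norm_add_le (1 - (r : ℂ) * q.1 * (starRingEnd ℂ) q.2)
          (((r : ℂ) * q.1 - q.1) * (starRingEnd ℂ) q.2)
        rw [← e2, norm_mul, norm_radius_sub hq.1 hr, RCLike.norm_conj, hq.2, mul_one, ← e1] at e3
        have e4 := one_sub_le_norm (z := (r : ℂ) * q.1) hq.2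
        rw [norm_radius_mul hr hq.1] at e4
        linarith
      have h3 := Real.log_le_log (by positivity) h2
      rw [Real.log_div hd.ne' two_ne_zero] at h3
      linarith
    · filter_upwards [ae_prod_norm hμ, hlt] with q hq hqt
      have h1 := (ENNReal.tendsto_toReal hqt.ne).comp (tendsto_energyKernel hq.1 hq.2)
      refine h1.congr' ?_
      filter_upwards [eventually_mem_Ioo] with r hr
      have := neg_log_two_le_abelKernel hr hq.1 hq.2
      exact ENNReal.toReal_ofReal (by linarith)
  refine (hlim.sub_const (Real.log 2)).congr' ?_
  filter_upwards [eventually_mem_Ioo] with r hr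
  rw [integral_add (integrable_const _) (integrable_abelKernel hμ hr), ← abelEnergy_eq_prod hμ hr]
  simp

/-- A measure of finite energy has no atoms, since the kernel is `∞` on the diagonal. -/
lemma measure_singleton_eq_zero [IsProbabilityMeasure μ]
    (hfin : ∫⁻ q, energyKernel q ∂(μ.prod μ) ≠ ⊤) (x : ℂ) : μ {x} = 0 := by
  have hlt : ∀ᵐ q ∂(μ.prod μ), energyKernel q < ⊤ := ae_lt_top measurable_energyKernel hfin
  have h1 : (μ.prod μ) ({x} ×ˢ {x}) = 0 := by
    refine measure_mono_null ?_ hlt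
    rintro ⟨a, b⟩ ⟨ha, hb⟩
    simp only [Set.mem_singleton_iff] at ha hb
    subst ha hb
    simp [energyKernel]
  rw [Measure.prod_prod] at h1
  exact mul_self_eq_zero.1 h1

end Energy

/-! ### The equilibrium measure of the bands -/

section Equilibrium

variable {α : ℕ → ℂ} {p : ℕ} {μ ν : Measure ℂ}

lemma ae_norm_eq_one (hμ : μ (bands α p)ᶜ = 0) : ∀ᵐ w ∂μ, ‖w‖ = 1 := by
  have : ∀ᵐ w ∂μ, w ∈ bands α p := hμ
  exact this.mono fun w hw => hw.1

/-- Thouless' formula for the measure `ν` in the unit disk: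
`∫ log |1 - z conj w| dν(w) = (log |z^{p/2} Γ_+(z)| - log ∏ ρ_k⁻¹) / p`. For `|w| = 1`
this is the potential of `ν`, as `|1 - z conj w| = |z - w|`, but this form
of the kernel has an analytic logarithm in the disk. -/
def HasThoulessFormula (α : ℕ → ℂ) (p : ℕ) (ν : Measure ℂ) : Prop :=
  ∀ z, ‖z‖ < 1 → ∫ w, Real.log ‖1 - z * (starRingEnd ℂ) w‖ ∂ν =
    (Real.log ‖regGamma α p z‖ - Real.log ‖leadConst α p‖) / p

lemma exists_hasThoulessFormula (hα : ∀ n, ‖α n‖ < 1) (hp : 0 < p) (hpe : Even p) :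
    ∃ ν : Measure ℂ, IsProbabilityMeasure ν ∧ ν (bands α p)ᶜ = 0 ∧ HasThoulessFormula α p ν := by
  obtain ⟨ν, h1, h2, h3⟩ := exists_measure_log_norm hα hp hpe
  refine ⟨ν, h1, h2, fun z hz => ?_⟩
  rw [← h3 z hz]
  refine integral_congr_ae ?_
  filter_upwards [ae_norm_eq_one h2] with w hw
  rw [norm_one_sub_eq hw]

lemma tendsto_norm_regGamma (hα : ∀ n, ‖α n‖ < 1) (hp : 0 < p) (hpe : Even p) {ζ : ℂ}
    (hζ : ζ ∈ bands α p) :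
    Tendsto (fun r : ℝ => ‖regGamma α p (r * ζ)‖) (𝓝[<] 1) (𝓝 1) := by
  obtain ⟨g, hg, hlim⟩ := exists_tendsto_gammaPlus hα hp hpe hζ.1
  have hg1 : ‖g‖ = 1 := by
    obtain ⟨-, t, ht, htΔ⟩ := hζ
    exact norm_eq_one_of_root ht (by rw [← htΔ]; exact hg)
  have h := (((tendsto_radius ζ).pow (p / 2)).mul hlim).norm
  rw [norm_mul, norm_pow, hζ.1, one_pow, hg1, one_mul] at h
  refine h.congr' ?_
  filter_upwards [eventually_mem_Ioo] with r hr
  have hz := radius_mem hζ.1 hr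
  rw [regGamma_eq hα hp hpe hz.1 hz.2.2]

/-- The potential of `ν` is constant on the bands, in the regularized sense. -/
lemma tendsto_abelEnergy_of_thouless (hα : ∀ n, ‖α n‖ < 1) (hp : 0 < p) (hpe : Even p)
    [IsProbabilityMeasure μ] [IsProbabilityMeasure ν] (hμ : μ (bands α p)ᶜ = 0)
    (hν : ν (bands α p)ᶜ = 0) (hT : HasThoulessFormula α p ν) :
    Tendsto (fun r => abelEnergy r μ ν) (𝓝[<] 1) (𝓝 (Real.log ‖leadConst α p‖ / p)) := by
  have hp0 : (0 : ℝ) < p := by exact_mod_cast hp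
  have hl2 : 0 ≤ Real.log 2 := Real.log_nonneg (by norm_num)
  have hin : ∀ r ∈ Set.Ioo (0 : ℝ) 1, ∀ z : ℂ, ‖z‖ = 1 →
      ∫ w, -Real.log ‖1 - (r : ℂ) * z * (starRingEnd ℂ) w‖ ∂ν =
        (Real.log ‖leadConst α p‖ - Real.log ‖regGamma α p (r * z)‖) / p := by
    intro r hr z hz
    rw [integral_neg, hT _ (radius_mem hz hr).2.2]
    ring
  have hlim : Tendsto (fun r => abelEnergy r μ ν) (𝓝[<] 1)
      (𝓝 (∫ _, Real.log ‖leadConst α p‖ / p ∂μ)) := by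
    refine tendsto_integral_filter_of_dominated_convergence
      (fun _ => Real.log 2 + |Real.log ‖leadConst α p‖| / p) ?_ ?_ (integrable_const _) ?_
    · refine Eventually.of_forall fun r => ?_
      exact ((measurable_abelKernel r).stronglyMeasurable.integral_prod_right
        (ν := ν)).aestronglyMeasurable
    · filter_upwards [Ioo_mem_nhdsLT (show (1 / 2 : ℝ) < 1 by norm_num)] with r hr
      have hr' : r ∈ Set.Ioo (0 : ℝ) 1 := ⟨by linarith [hr.1], hr.2⟩
      filter_upwards [ae_norm_eq_one hμ] with z hz
      have hz' := radius_mem hz hr'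
      have hlow : -Real.log 2 ≤ ∫ w, -Real.log ‖1 - (r : ℂ) * z * (starRingEnd ℂ) w‖ ∂ν := by
        have hi : Integrable (fun w => -Real.log ‖1 - (r : ℂ) * z * (starRingEnd ℂ) w‖) ν := by
          have := (integrable_log_one_sub (ae_norm_eq_one hν) hz'.2.2).re.neg
          simp only [RCLike.re_to_complex, Complex.log_re] at this
          exact this
        have := integral_mono_ae (integrable_const (-Real.log 2)) hi
          ((ae_norm_eq_one hν).mono fun w hw => neg_log_two_le_abelKernel hr' hz hw)
        simpa using this
      have hup : ∫ w, -Real.log ‖1 - (r : ℂ) * z * (starRingEnd ℂ) w‖ ∂ν ≤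
          Real.log 2 + |Real.log ‖leadConst α p‖| / p := by
        -- For `r > 1/2` the lower bound `|Γ_+| ≥ 1` bounds the potential from above.
        have h1 : (1 / 2 : ℝ) ^ p ≤ ‖regGamma α p (r * z)‖ := by
          rw [regGamma_eq hα hp hpe hz'.1 hz'.2.2, norm_mul, norm_pow, hz'.2.1]
          calc (1 / 2 : ℝ) ^ p ≤ (1 / 2) ^ (p / 2) :=
                pow_le_pow_of_le_one (by norm_num) (by norm_num) (Nat.div_le_self p 2)
            _ ≤ r ^ (p / 2) := pow_le_pow_left₀ (by norm_num) hr.1.le _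
            _ ≤ _ := le_mul_of_one_le_right (pow_nonneg hr'.1.le _) (one_le_norm_gammaPlus _)
        have h2 := Real.log_le_log (by positivity) h1
        rw [Real.log_pow, one_div, Real.log_inv] at h2
        rw [hin r hr' z hz, div_le_iff₀ hp0, add_mul, div_mul_cancel₀ _ hp0.ne']
        linarith [le_abs_self (Real.log ‖leadConst α p‖)]
      rw [Real.norm_eq_abs, abs_le]
      exact ⟨by have := div_nonneg (abs_nonneg (Real.log ‖leadConst α p‖)) hp0.le; linarith, hup⟩
    · have hB : ∀ᵐ z ∂μ, z ∈ bands α p := hμ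
      filter_upwards [hB] with z hz
      have h1 := (Real.continuousAt_log one_ne_zero).tendsto.comp
        (tendsto_norm_regGamma hα hp hpe hz)
      rw [Real.log_one] at h1
      have h2 := (h1.const_sub (Real.log ‖leadConst α p‖)).div_const (p : ℝ)
      rw [sub_zero] at h2
      refine h2.congr' ?_
      filter_upwards [eventually_mem_Ioo] with r hr using (hin r hr z hz.1).symm
  simpa using hlim

/-- The measure of Thouless' formula has the least energy, and a measure of the same energy has the
same moments. -/
lemma logEnergy_le_and_moments (hα : ∀ n, ‖α n‖ < 1) (hp : 0 < p) (hpe : Even p)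
    [IsProbabilityMeasure μ] [IsProbabilityMeasure ν] (hμ : μ (bands α p)ᶜ = 0)
    (hν : ν (bands α p)ᶜ = 0) (hT : HasThoulessFormula α p ν) :
    logEnergy ν ≤ logEnergy μ ∧
      (logEnergy μ ≤ logEnergy ν → ∀ n : ℕ, ∫ w, w ^ n ∂μ = ∫ w, w ^ n ∂ν) := by
  have hμ1 := ae_norm_eq_one hμ
  have hν1 := ae_norm_eq_one hν
  have hl2 : 0 ≤ Real.log 2 := Real.log_nonneg (by norm_num)
  set V := Real.log ‖leadConst α p‖ / p with hV
  have hνν := tendsto_abelEnergy_of_thouless hα hp hpe hν hν hT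
  have hμν := tendsto_abelEnergy_of_thouless hα hp hpe hμ hν hT
  have hVle := lintegral_energyKernel_le hν1 hνν
  have hfinν : ∫⁻ q, energyKernel q ∂(ν.prod ν) ≠ ⊤ :=
    ne_top_of_le_ne_top ENNReal.ofReal_ne_top hVle
  have hVν : (∫⁻ q, energyKernel q ∂(ν.prod ν)).toReal - Real.log 2 = V :=
    tendsto_nhds_unique (tendsto_abelEnergy hν1 hfinν) hνν
  rw [logEnergy_eq hμ1, logEnergy_eq hν1]
  set X := ∫⁻ q, energyKernel q ∂(μ.prod μ) with hX
  set Y := ∫⁻ q, energyKernel q ∂(ν.prod ν) with hY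
  have hcoe : ∀ Z : ENNReal, Z ≠ ⊤ → (Z : EReal) - ((ENNReal.ofReal (Real.log 2) : ENNReal) : EReal)
      = ((Z.toReal - Real.log 2 : ℝ) : EReal) := by
    intro Z hZ
    lift Z to NNReal using hZ
    rw [EReal.coe_sub, EReal.coe_ennreal_ofReal, max_eq_left hl2]
    rfl
  by_cases hfin : X = ⊤
  · rw [hfin, hcoe Y hfinν]
    have htop : ((⊤ : ENNReal) : EReal) -
        ((ENNReal.ofReal (Real.log 2) : ENNReal) : EReal) = ⊤ := by
      rw [EReal.coe_ennreal_top, EReal.coe_ennreal_ofReal]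
      exact EReal.top_sub_coe _
    rw [htop]
    exact ⟨le_top, fun h => absurd (top_le_iff.1 h) (EReal.coe_ne_top _)⟩
  · rw [hcoe X hfin, hcoe Y hfinν, EReal.coe_le_coe_iff, EReal.coe_le_coe_iff, hVν]
    have hμμ := tendsto_abelEnergy hμ1 hfin
    rw [← hX] at hμμ
    have key : ∀ n : ℕ, 1 / n * ‖∫ w, w ^ n ∂μ - ∫ w, w ^ n ∂ν‖ ^ 2 ≤
        (X.toReal - Real.log 2) - V := by
      intro n
      have h1 : Tendsto (fun r : ℝ => r ^ n / n * ‖∫ w, w ^ n ∂μ - ∫ w, w ^ n ∂ν‖ ^ 2) (𝓝[<] 1)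
          (𝓝 (1 / n * ‖∫ w, w ^ n ∂μ - ∫ w, w ^ n ∂ν‖ ^ 2)) := by
        have hc : Continuous fun r : ℝ => r ^ n / n * ‖∫ w, w ^ n ∂μ - ∫ w, w ^ n ∂ν‖ ^ 2 := by
          fun_prop
        have := hc.tendsto 1
        rw [one_pow] at this
        exact this.mono_left nhdsWithin_le_nhds
      have h2 := (hμμ.sub (hμν.const_mul 2)).add hνν
      have h3 := le_of_tendsto_of_tendsto h1 h2
        (eventually_mem_Ioo.mono fun r hr => le_abelEnergy_sub hμ1 hν1 hr n)
      linarith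
    refine ⟨?_, fun hle n => ?_⟩
    · have h0 := key 0
      simp only [Nat.cast_zero, div_zero, zero_mul] at h0
      linarith
    · rcases Nat.eq_zero_or_pos n with rfl | hn
      · simp
      · have h1 := key n
        have hn' : (0 : ℝ) < 1 / n := by positivity
        have h2 : ‖∫ w, w ^ n ∂μ - ∫ w, w ^ n ∂ν‖ ^ 2 ≤ 0 := by
          by_contra hneg
          have := mul_pos hn' (not_le.1 hneg)
          linarith
        have h3 := pow_eq_zero_iff two_ne_zero |>.1 (le_antisymm h2 (sq_nonneg _))
        exact sub_eq_zero.1 (norm_eq_zero.1 h3)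

/-- The equilibrium measure of the bands exists, has no atoms, and satisfies Thouless' formula. -/
theorem equilibriumMeasure_bands (hα : ∀ n, ‖α n‖ < 1) (hp : 0 < p) (hpe : Even p) :
    IsProbabilityMeasure (equilibriumMeasure (bands α p)) ∧
    equilibriumMeasure (bands α p) (bands α p)ᶜ = 0 ∧
    (∀ x, equilibriumMeasure (bands α p) {x} = 0) ∧
    HasThoulessFormula α p (equilibriumMeasure (bands α p)) := by
  obtain ⟨ν, hνp, hν, hT⟩ := exists_hasThoulessFormula hα hp hpe
  have hν1 := ae_norm_eq_one hν
  have hfin : ∀ m : Measure ℂ, IsProbabilityMeasure m → m (bands α p)ᶜ = 0 → logEnergy m < ⊤ →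
      ∫⁻ q, energyKernel q ∂(m.prod m) ≠ ⊤ := by
    intro m hm hmB hlt htop
    rw [logEnergy_eq (ae_norm_eq_one hmB), htop, EReal.coe_ennreal_top,
      EReal.coe_ennreal_ofReal] at hlt
    exact hlt.ne (EReal.top_sub_coe _)
  have hνeq : IsEquilibriumMeasure (bands α p) ν := by
    refine ⟨hνp, hν, ?_, fun m hm hmB => (logEnergy_le_and_moments hα hp hpe hmB hν hT).1⟩
    have hX := lintegral_energyKernel_le hν1 (tendsto_abelEnergy_of_thouless hα hp hpe hν hν hT)
    rw [logEnergy_eq hν1]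
    refine lt_of_le_of_lt (EReal.sub_le_sub (EReal.coe_ennreal_le_coe_ennreal_iff.2 hX) le_rfl) ?_
    rw [EReal.coe_ennreal_ofReal, EReal.coe_ennreal_ofReal, ← EReal.coe_sub]
    exact EReal.coe_lt_top _
  have hex : ∃ μ, IsEquilibriumMeasure (bands α p) μ := ⟨ν, hνeq⟩
  have hμeq : IsEquilibriumMeasure (bands α p) (equilibriumMeasure (bands α p)) := by
    rw [equilibriumMeasure, dif_pos hex]; exact hex.choose_spec
  generalize equilibriumMeasure (bands α p) = μ at hμeq ⊢
  obtain ⟨hμp, hμB, hμfin, hμmin⟩ := hμeq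
  refine ⟨hμp, hμB, measure_singleton_eq_zero (hfin μ hμp hμB hμfin), fun z hz => ?_⟩
  have hμ1 := ae_norm_eq_one hμB
  have hmom := (logEnergy_le_and_moments hα hp hpe hμB hν hT).2 (hμmin ν hνp hν)
  have h1 := hasSum_integral_log hμ1 hz
  simp only [hmom] at h1
  have h2 := neg_injective (h1.unique (hasSum_integral_log hν1 hz))
  rw [← hT z hz, integral_log_norm_eq_re hμ1 hz, integral_log_norm_eq_re hν1 hz, h2]

end Equilibrium

/-! ### Boundary values of `Γ_+` -/

section Boundary

variable {α : ℕ → ℂ} {p : ℕ} {μ : Measure ℂ}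

lemma differentiableOn_integral_log [IsProbabilityMeasure μ] (hμ : ∀ᵐ w ∂μ, ‖w‖ = 1) :
    DifferentiableOn ℂ (fun z => ∫ w, Complex.log (1 - z * (starRingEnd ℂ) w) ∂μ)
      (Metric.ball 0 1) := by
  intro z hz
  have hz1 : ‖z‖ < 1 := by simpa using hz
  obtain ⟨R, hzR, hR⟩ := exists_between hz1
  have hR0 : 0 ≤ R := (norm_nonneg z).trans hzR.le
  have h1 : DifferentiableOn ℂ (fun z : ℂ => ∑' n : ℕ,
      z ^ n / n * (starRingEnd ℂ) (∫ w, w ^ n ∂μ)) (Metric.ball 0 R) := by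
    refine Complex.differentiableOn_tsum_of_summable_norm (u := fun n => R ^ n)
      (summable_geometric_of_lt_one hR0 hR) (fun n => ?_) Metric.isOpen_ball fun n z hz => ?_
    · exact (((differentiable_id.pow n).div_const _).mul_const _).differentiableOn
    · have hzn : ‖z‖ ≤ R := by
        have : ‖z‖ < R := by simpa using hz
        exact this.le
      rw [norm_mul, norm_div, norm_pow, Complex.norm_natCast, RCLike.norm_conj]
      have h2 : ‖z‖ ^ n / n ≤ R ^ n := by
        rcases Nat.eq_zero_or_pos n with rfl | hn
        · simp
        · exact (div_le_self (by positivity) (by exact_mod_cast hn)).trans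
            (pow_le_pow_left₀ (norm_nonneg z) hzn n)
      calc _ ≤ R ^ n * 1 := mul_le_mul h2 (norm_moment_le hμ n) (norm_nonneg _) (by positivity)
        _ = R ^ n := mul_one _
  have h2 : DifferentiableOn ℂ (fun z => ∫ w, Complex.log (1 - z * (starRingEnd ℂ) w) ∂μ)
      (Metric.ball 0 R) := by
    refine h1.neg.congr fun z hz => ?_
    have hzn : ‖z‖ < 1 := lt_trans (by simpa using hz) hR
    rw [Pi.neg_apply, (hasSum_integral_log hμ hzn).tsum_eq, neg_neg]
  have hmem : Metric.ball 0 R ∈ 𝓝 z := Metric.isOpen_ball.mem_nhds (by simpa using hzR)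
  exact (h2.differentiableAt hmem).differentiableWithinAt

lemma regGamma_ne_zero (hα : ∀ n, ‖α n‖ < 1) (hp : 0 < p) (hpe : Even p) {z : ℂ} (hz1 : ‖z‖ < 1) :
    regGamma α p z ≠ 0 := by
  rcases eq_or_ne z 0 with rfl | hz
  · rw [regGamma_zero hp]
    exact leadConst_ne_zero hα p
  · rw [regGamma_eq hα hp hpe hz hz1]
    exact mul_ne_zero (pow_ne_zero _ hz) (gammaPlus_ne_zero z)

/-- Thouless' formula for `Γ_+` itself: two zero-free analytic functions in the disk whose moduli
are proportional differ by a constant factor. -/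
lemma exists_regGamma_eq_exp (hα : ∀ n, ‖α n‖ < 1) (hp : 0 < p) (hpe : Even p)
    [IsProbabilityMeasure μ] (hμ : ∀ᵐ w ∂μ, ‖w‖ = 1) (hT : HasThoulessFormula α p μ) :
    ∃ c : ℂ, ∀ z, ‖z‖ < 1 → regGamma α p z =
      c * Complex.exp (p * ∫ w, Complex.log (1 - z * (starRingEnd ℂ) w) ∂μ) := by
  set L : ℂ → ℂ := fun z => ∫ w, Complex.log (1 - z * (starRingEnd ℂ) w) ∂μ with hL
  set f : ℂ → ℂ := fun z => regGamma α p z / Complex.exp (p * L z) with hf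
  have hd : DifferentiableOn ℂ f (Metric.ball 0 1) :=
    (differentiableOn_regGamma hα hp hpe).div
      ((differentiableOn_integral_log hμ).const_mul _).cexp fun z _ => Complex.exp_ne_zero _
  have hnorm : ∀ z ∈ Metric.ball (0 : ℂ) 1, ‖f z‖ = ‖leadConst α p‖ := by
    intro z hz
    have hz1 : ‖z‖ < 1 := by simpa using hz
    have h1 : (p * L z).re = Real.log ‖regGamma α p z‖ - Real.log ‖leadConst α p‖ := by
      have h2 := hT z hz1
      rw [integral_log_norm_eq_re hμ hz1] at h2
      have hp0 : (p : ℝ) ≠ 0 := by exact_mod_cast hp.ne'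
      rw [← Complex.ofReal_natCast, Complex.re_ofReal_mul, h2]
      field_simp
    have h3 := norm_pos_iff.2 (regGamma_ne_zero hα hp hpe hz1)
    have h4 := norm_pos_iff.2 (leadConst_ne_zero hα p)
    rw [hf, norm_div, Complex.norm_exp, h1, Real.exp_sub, Real.exp_log h3, Real.exp_log h4]
    field_simp
  refine ⟨f 0, fun z hz => ?_⟩
  have hmax : IsMaxOn (norm ∘ f) (Metric.ball 0 1) 0 := fun w hw => by
    simp [hnorm w hw, hnorm 0 (by simp)]
  have h := Complex.eqOn_of_isPreconnected_of_isMaxOn_norm (convex_ball (0 : ℂ) 1).isPreconnected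
    Metric.isOpen_ball hd (by simp) hmax (show z ∈ Metric.ball (0 : ℂ) 1 by simpa using hz)
  have h' : f z = f 0 := h
  rw [← h', hf]
  exact (div_mul_cancel₀ _ (Complex.exp_ne_zero _)).symm

/-- For distinct points of the circle `1 - z conj w` is in the right half-plane. -/
lemma mem_slitPlane_one_sub {z w : ℂ} (hz : ‖z‖ = 1) (hw : ‖w‖ = 1) (hzw : w ≠ z) :
    1 - z * (starRingEnd ℂ) w ∈ Complex.slitPlane := by
  refine Or.inl ?_
  have h1 : ‖z * (starRingEnd ℂ) w‖ = 1 := by rw [norm_mul, RCLike.norm_conj, hz, hw, mul_one]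
  have h2 : 1 - z * (starRingEnd ℂ) w ≠ 0 := by
    rw [← norm_ne_zero_iff, norm_one_sub_eq hw]
    exact norm_ne_zero_iff.2 (sub_ne_zero.2 hzw)
  generalize z * (starRingEnd ℂ) w = u at h1 h2
  have h3 : u.re ^ 2 + u.im ^ 2 = 1 := by
    have := Complex.normSq_eq_norm_sq u
    rw [h1, Complex.normSq_apply] at this
    linarith
  by_contra hn
  have h4 : 1 ≤ u.re := by simpa using hn
  have h5 : u.re = 1 := by nlinarith [sq_nonneg u.im]
  have h6 : u.im = 0 := by
    have : u.im ^ 2 = 0 := by rw [h5] at h3; linarith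
    exact pow_eq_zero_iff two_ne_zero |>.1 this
  exact h2 (Complex.ext (by simp [h5]) (by simp [h6]))

/-- The boundary values of the imaginary part of the complex logarithmic potential: as `arg` is
bounded, dominated convergence applies away from an atom at `ζ`. -/
lemma tendsto_im_integral_log [IsProbabilityMeasure μ] (hμ : ∀ᵐ w ∂μ, ‖w‖ = 1) {ζ : ℂ}
    (hζ : ‖ζ‖ = 1) (hatom : μ {ζ} = 0) :
    Tendsto (fun r : ℝ => (∫ w, Complex.log (1 - (r : ℂ) * ζ * (starRingEnd ℂ) w) ∂μ).im) (𝓝[<] 1)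
      (𝓝 (∫ w, Complex.arg (1 - ζ * (starRingEnd ℂ) w) ∂μ)) := by
  have hne : ∀ᵐ w ∂μ, w ≠ ζ := by
    rw [ae_iff]; simpa using hatom
  have h : Tendsto (fun r : ℝ => ∫ w, Complex.arg (1 - (r : ℂ) * ζ * (starRingEnd ℂ) w) ∂μ)
      (𝓝[<] 1) (𝓝 (∫ w, Complex.arg (1 - ζ * (starRingEnd ℂ) w) ∂μ)) := by
    refine tendsto_integral_filter_of_dominated_convergence (fun _ => Real.pi) ?_ ?_
      (integrable_const _) ?_
    · refine Eventually.of_forall fun r => ?_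
      have := Complex.measurable_im.comp (measurable_log_one_sub ((r : ℂ) * ζ))
      simp only [Function.comp_def, Complex.log_im] at this
      exact this.aestronglyMeasurable
    · exact Eventually.of_forall fun r => Eventually.of_forall fun w => Complex.abs_arg_le_pi _
    · filter_upwards [hμ, hne] with w hw hwζ
      exact (Complex.continuousAt_arg (mem_slitPlane_one_sub hζ hw hwζ)).tendsto.comp
        (((tendsto_radius ζ).mul_const _).const_sub 1)
  refine h.congr' ?_
  filter_upwards [eventually_mem_Ioo] with r hr
  have := integral_im (integrable_log_one_sub hμ (radius_mem hζ hr).2.2)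
  simp only [RCLike.im_to_complex, Complex.log_im] at this
  exact this

lemma arg_one_sub_exp {t : ℝ} (ht : t ∈ Set.Ioo 0 (2 * Real.pi)) :
    Complex.arg (1 - Complex.exp (t * Complex.I)) = (t - Real.pi) / 2 := by
  have hs : 0 < 2 * Real.sin (t / 2) := by
    have := Real.sin_pos_of_pos_of_lt_pi (x := t / 2) (by linarith [ht.1]) (by linarith [ht.2])
    linarith
  have h : 1 - Complex.exp (t * Complex.I) = ((2 * Real.sin (t / 2) : ℝ) : ℂ) *
      (Complex.cos (((t - Real.pi) / 2 : ℝ) : ℂ) +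
        Complex.sin (((t - Real.pi) / 2 : ℝ) : ℂ) * Complex.I) := by
    have h1 : Real.cos ((t - Real.pi) / 2) = Real.sin (t / 2) := by
      rw [sub_div, Real.cos_sub_pi_div_two]
    have h2 : Real.sin ((t - Real.pi) / 2) = -Real.cos (t / 2) := by
      rw [sub_div, Real.sin_sub_pi_div_two]
    rw [← Complex.ofReal_cos, ← Complex.ofReal_sin, h1, h2, Complex.exp_mul_I,
      ← Complex.ofReal_cos, ← Complex.ofReal_sin]
    have h3 : Real.cos t = 1 - 2 * Real.sin (t / 2) ^ 2 := by
      have := Real.cos_sq_add_sin_sq (t / 2)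
      have h4 := Real.cos_two_mul (t / 2)
      rw [mul_div_cancel₀ t two_ne_zero] at h4
      rw [h4]; linarith
    have h4 : Real.sin t = 2 * Real.sin (t / 2) * Real.cos (t / 2) := by
      have h4 := Real.sin_two_mul (t / 2)
      rwa [mul_div_cancel₀ t two_ne_zero] at h4
    rw [h3, h4]
    push_cast
    ring
  rw [h]
  exact Complex.arg_mul_cos_add_sin_mul_I hs
    ⟨by linarith [ht.1, Real.pi_pos], by linarith [ht.2, Real.pi_pos]⟩

lemma injOn_exp_Ico (x : ℝ) :
    Set.InjOn (fun φ : ℝ => Complex.exp (φ * Complex.I)) (Set.Ico x (x + 2 * Real.pi)) := by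
  intro a ha b hb hab
  obtain ⟨n, hn⟩ := Complex.exp_eq_exp_iff_exists_int.1 hab
  have h1 : (a : ℂ) = b + n * (2 * Real.pi) := by
    have : (a : ℂ) * Complex.I = (b + n * (2 * Real.pi)) * Complex.I := by rw [hn]; ring
    exact mul_right_cancel₀ Complex.I_ne_zero this
  have h2 : a = b + n * (2 * Real.pi) := by exact_mod_cast h1
  have hpi := Real.pi_pos
  have h3 : (n : ℝ) < 1 := by
    by_contra hc
    nlinarith [ha.2, hb.1]
  have h4 : (-1 : ℝ) < n := by
    by_contra hc
    nlinarith [ha.1, hb.2]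
  have h5 : n < 1 := by exact_mod_cast h3
  have h6 : -1 < n := by exact_mod_cast h4
  have h7 : n = 0 := by omega
  rw [h2, h7]; simp

lemma exists_angle (x : ℝ) {w : ℂ} (hw : ‖w‖ = 1) :
    ∃ φ ∈ Set.Ico x (x + 2 * Real.pi), Complex.exp (φ * Complex.I) = w := by
  obtain ⟨ψ, hψ⟩ := (Complex.norm_eq_one_iff w).1 hw
  refine ⟨toIcoMod Real.two_pi_pos x ψ, toIcoMod_mem_Ico _ _ _, ?_⟩
  rw [← hψ, toIcoMod]
  refine Complex.exp_eq_exp_iff_exists_int.2 ⟨-toIcoDiv Real.two_pi_pos x ψ, ?_⟩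
  push_cast
  simp
  ring

/-- On the circle `arg (1 - e^{iθ} conj w)` grows like `θ / 2`, with a jump of `-π` where `e^{iθ}`
passes `w`. -/
lemma arg_sub_arg {x θ : ℝ} (hθ : θ ∈ Set.Icc x (x + 2 * Real.pi)) {w : ℂ} (hw : ‖w‖ = 1)
    (hw1 : w ≠ Complex.exp (x * Complex.I)) (hw2 : w ≠ Complex.exp (θ * Complex.I)) :
    Complex.arg (1 - Complex.exp (θ * Complex.I) * (starRingEnd ℂ) w) -
      Complex.arg (1 - Complex.exp (x * Complex.I) * (starRingEnd ℂ) w) =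
    (θ - x) / 2 - ((fun φ : ℝ => Complex.exp (φ * Complex.I)) '' Set.Ioo x θ).indicator
      (fun _ => Real.pi) w := by
  obtain ⟨φ, hφ, rfl⟩ := exists_angle x hw
  have hφx : φ ≠ x := by rintro rfl; exact hw1 rfl
  have hφθ : φ ≠ θ := by rintro rfl; exact hw2 rfl
  have hφ1 : x < φ := lt_of_le_of_ne hφ.1 hφx.symm
  have hconj : ∀ y : ℝ, Complex.exp (y * Complex.I) *
      (starRingEnd ℂ) (Complex.exp (φ * Complex.I)) =
      Complex.exp (((y - φ : ℝ) : ℂ) * Complex.I) := by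
    intro y
    rw [← Complex.exp_conj, ← Complex.exp_add]
    congr 1
    simp
    ring
  have hper : ∀ y : ℝ, Complex.exp ((y : ℂ) * Complex.I) =
      Complex.exp (((y + 2 * Real.pi : ℝ) : ℂ) * Complex.I) := by
    intro y
    push_cast
    rw [add_mul, Complex.exp_periodic]
  have hx : Complex.arg (1 - Complex.exp (x * Complex.I) *
      (starRingEnd ℂ) (Complex.exp (φ * Complex.I))) = (x - φ + 2 * Real.pi - Real.pi) / 2 := by
    have hmem : x - φ + 2 * Real.pi ∈ Set.Ioo 0 (2 * Real.pi) :=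
      ⟨by linarith [hφ.2], by linarith⟩
    rw [hconj, hper (x - φ), arg_one_sub_exp hmem]
  rw [hx, hconj]
  rcases lt_or_gt_of_ne hφθ with h | h
  · have hφm : φ ∈ Set.Ioo x θ := ⟨hφ1, h⟩
    rw [Set.indicator_of_mem (Set.mem_image_of_mem _ hφm),
      arg_one_sub_exp ⟨by linarith, by linarith [hθ.2]⟩]
    ring
  · have hmem : θ - φ + 2 * Real.pi ∈ Set.Ioo 0 (2 * Real.pi) :=
      ⟨by linarith [hφ.2, hθ.1], by linarith⟩
    rw [Set.indicator_of_notMem, hper (θ - φ), arg_one_sub_exp hmem]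
    · ring
    · rintro ⟨ψ, hψ, he⟩
      have hψ' : ψ ∈ Set.Ico x (x + 2 * Real.pi) := ⟨hψ.1.le, by linarith [hψ.2, hθ.2]⟩
      have := injOn_exp_Ico x hψ' hφ he
      linarith [hψ.2]

lemma integral_arg_sub [IsProbabilityMeasure μ] (hμ : ∀ᵐ w ∂μ, ‖w‖ = 1)
    (hatom : ∀ x, μ {x} = 0) {x θ : ℝ} (hθ : θ ∈ Set.Icc x (x + 2 * Real.pi)) :
    ∫ w, Complex.arg (1 - Complex.exp (θ * Complex.I) * (starRingEnd ℂ) w) ∂μ -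
      ∫ w, Complex.arg (1 - Complex.exp (x * Complex.I) * (starRingEnd ℂ) w) ∂μ =
    (θ - x) / 2 - Real.pi *
      μ.real ((fun φ : ℝ => Complex.exp (φ * Complex.I)) '' Set.Ioo x θ) := by
  have hS : MeasurableSet ((fun φ : ℝ => Complex.exp (φ * Complex.I)) '' Set.Ioo x θ) := by
    refine measurableSet_Ioo.image_of_continuousOn_injOn (by fun_prop) ?_
    have hsub : Set.Ioo x θ ⊆ Set.Ico x (x + 2 * Real.pi) :=
      fun y hy => ⟨hy.1.le, hy.2.trans_le hθ.2⟩
    exact (injOn_exp_Ico x).mono hsub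
  have hint : ∀ z : ℂ, Integrable (fun w => Complex.arg (1 - z * (starRingEnd ℂ) w)) μ := by
    intro z
    have := Complex.measurable_im.comp (measurable_log_one_sub z)
    simp only [Function.comp_def, Complex.log_im] at this
    exact Integrable.of_bound this.aestronglyMeasurable Real.pi
      (Eventually.of_forall fun w => Complex.abs_arg_le_pi _)
  have hne : ∀ z : ℂ, ∀ᵐ w ∂μ, w ≠ z := fun z => by
    rw [ae_iff]; simpa using hatom z
  rw [← integral_sub (hint _) (hint _)]
  have h1 : ∫ w, (Complex.arg (1 - Complex.exp (θ * Complex.I) * (starRingEnd ℂ) w) -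
      Complex.arg (1 - Complex.exp (x * Complex.I) * (starRingEnd ℂ) w)) ∂μ =
      ∫ w, ((θ - x) / 2 - ((fun φ : ℝ => Complex.exp (φ * Complex.I)) '' Set.Ioo x θ).indicator
      (fun _ => Real.pi) w) ∂μ := by
    refine integral_congr_ae ?_
    filter_upwards [hμ, hne _, hne _] with w hw hw1 hw2 using arg_sub_arg hθ hw hw1 hw2
  rw [h1, integral_sub (integrable_const _) ((integrable_const _).indicator hS),
    integral_indicator_const _ hS]
  simp [mul_comm]

/-- The boundary values of `Γ_+` on the bands, up to a constant factor. -/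
lemma exists_tendsto_gammaPlus_eq (hα : ∀ n, ‖α n‖ < 1) (hp : 0 < p) (hpe : Even p)
    [IsProbabilityMeasure μ] (hμ : ∀ᵐ w ∂μ, ‖w‖ = 1) (hatom : ∀ x, μ {x} = 0)
    (hT : HasThoulessFormula α p μ) : ∃ c : ℂ, ∀ ζ ∈ bands α p,
      Tendsto (fun r : ℝ => gammaPlus α p (r * ζ)) (𝓝[<] 1) (𝓝 ((ζ ^ (p / 2))⁻¹ * (c *
        Complex.exp (((p * ∫ w, Complex.arg (1 - ζ * (starRingEnd ℂ) w) ∂μ : ℝ) : ℂ) *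
          Complex.I)))) := by
  obtain ⟨c, hc⟩ := exists_regGamma_eq_exp hα hp hpe hμ hT
  have hC := norm_pos_iff.2 (leadConst_ne_zero hα p)
  have hp0 : (p : ℝ) ≠ 0 := by exact_mod_cast hp.ne'
  refine ⟨c * (‖leadConst α p‖⁻¹ : ℝ), fun ζ hζ => ?_⟩
  have hζ0 : ζ ≠ 0 := by
    rintro rfl
    simpa using hζ.1
  have him := tendsto_im_integral_log hμ hζ.1 (hatom ζ)
  have hre := (tendsto_norm_regGamma hα hp hpe hζ).mul_const ‖leadConst α p‖⁻¹
  rw [one_mul] at hre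
  have h1 := (((tendsto_radius ζ).pow (p / 2)).inv₀ (pow_ne_zero _ hζ0)).mul
    (((Complex.continuous_ofReal.tendsto _).comp hre).mul
      ((Complex.continuous_exp.tendsto _).comp
        (((Complex.continuous_ofReal.tendsto _).comp (him.const_mul (p : ℝ))).mul_const Complex.I))
      |>.const_mul c)
  rw [mul_assoc c]
  refine h1.congr' ?_
  filter_upwards [eventually_mem_Ioo] with r hr
  have hz := radius_mem hζ.1 hr
  have h2 := regGamma_eq hα hp hpe hz.1 hz.2.2
  rw [hc _ hz.2.2] at h2
  have h3 : gammaPlus α p (r * ζ) = (((r : ℂ) * ζ) ^ (p / 2))⁻¹ *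
      (c * Complex.exp (p * ∫ w, Complex.log (1 - (r : ℂ) * ζ * (starRingEnd ℂ) w) ∂μ)) := by
    rw [h2, inv_mul_cancel_left₀ (pow_ne_zero _ hz.1)]
  rw [h3]
  set L := ∫ w, Complex.log (1 - (r : ℂ) * ζ * (starRingEnd ℂ) w) ∂μ with hL
  have h4 : Real.exp (p * L.re) = ‖regGamma α p (r * ζ)‖ * ‖leadConst α p‖⁻¹ := by
    have h5 := hT _ hz.2.2
    rw [integral_log_norm_eq_re hμ hz.2.2, ← hL] at h5
    rw [h5, mul_div_cancel₀ _ hp0, Real.exp_sub, Real.exp_log hC,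
      Real.exp_log (norm_pos_iff.2 (regGamma_ne_zero hα hp hpe hz.2.2)), div_eq_mul_inv]
  have h5 : (p : ℂ) * L = ((p * L.re : ℝ) : ℂ) + ((p * L.im : ℝ) : ℂ) * Complex.I := by
    conv_lhs => rw [← Complex.re_add_im L]
    push_cast
    ring
  rw [h5, Complex.exp_add, ← Complex.ofReal_exp, h4]
  rfl

/-- The boundary values of `Γ_+` on the bands. The constant factor in `exists_tendsto_gammaPlus_eq`
is determined at `x₁`, where `Δ = 2` and hence `Γ_+ = 1`. -/
theorem radialLimit_gammaPlus (hα : ∀ n, ‖α n‖ < 1) (hp : 0 < p) (hpe : Even p) {x₁ θ : ℝ}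
    (hx : floquetDiscr α p (Complex.exp (x₁ * Complex.I)) = 2)
    (hθ : θ ∈ Set.Icc x₁ (x₁ + 2 * Real.pi)) (hB : Complex.exp (θ * Complex.I) ∈ bands α p) :
    RadialLimit (gammaPlus α p) (Complex.exp (θ * Complex.I))
      ((Complex.exp (-(Complex.I * Real.pi * p * kFun α p x₁ θ)) : ℂ) : OnePoint ℂ) := by
  obtain ⟨hμp, hμB, hatom, hT⟩ := equilibriumMeasure_bands hα hp hpe
  rw [kFun]
  generalize equilibriumMeasure (bands α p) = μ at hμp hμB hatom hT ⊢
  have hμ := ae_norm_eq_one hμB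
  obtain ⟨c, hc⟩ := exists_tendsto_gammaPlus_eq hα hp hpe hμ hatom hT
  have hx1 : ‖Complex.exp (x₁ * Complex.I)‖ = 1 := Complex.norm_exp_ofReal_mul_I x₁
  have hxB : Complex.exp (x₁ * Complex.I) ∈ bands α p :=
    ⟨hx1, 2, by norm_num, by rw [hx]; norm_num⟩
  obtain ⟨g, hg, hlim⟩ := exists_tendsto_gammaPlus hα hp hpe hx1
  have hg1 : g = 1 := by
    rw [hx] at hg
    have : (g - 1) ^ 2 = 0 := by linear_combination hg
    exact sub_eq_zero.1 (pow_eq_zero_iff two_ne_zero |>.1 this)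
  have h1 := tendsto_nhds_unique (hc _ hxB) hlim
  rw [hg1] at h1
  refine tendsto_coe_iff.2 ?_
  convert hc _ hB using 2
  have hdiff := integral_arg_sub hμ hatom hθ
  set β := ∫ w, Complex.arg (1 - Complex.exp (θ * Complex.I) * (starRingEnd ℂ) w) ∂μ
  set β₁ := ∫ w, Complex.arg (1 - Complex.exp (x₁ * Complex.I) * (starRingEnd ℂ) w) ∂μ
  set k := μ.real ((fun φ : ℝ => Complex.exp (φ * Complex.I)) '' Set.Ioo x₁ θ)
  have hpc : ((p / 2 : ℕ) : ℂ) = p / 2 := by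
    obtain ⟨q, rfl⟩ := hpe
    rw [← two_mul, Nat.mul_div_cancel_left q two_pos]
    push_cast; ring
  have hpow : ∀ y : ℝ, (Complex.exp (y * Complex.I) ^ (p / 2))⁻¹ =
      Complex.exp (-(p / 2 * (y * Complex.I))) := fun y => by
    rw [← Complex.exp_nat_mul, hpc, Complex.exp_neg]
  rw [hpow] at h1 ⊢
  have hcval : c = Complex.exp (p / 2 * (x₁ * Complex.I)) *
      Complex.exp (-(((p * β₁ : ℝ) : ℂ) * Complex.I)) := by
    have e1 := Complex.exp_ne_zero (p / 2 * (x₁ * Complex.I))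
    have e2 := Complex.exp_ne_zero (((p * β₁ : ℝ) : ℂ) * Complex.I)
    rw [Complex.exp_neg] at h1 ⊢
    field_simp at h1 ⊢
    exact h1
  rw [hcval, ← Complex.exp_add, ← Complex.exp_add, ← Complex.exp_add]
  congr 1
  have hβ : (β : ℂ) = β₁ + ((θ - x₁) / 2 - Real.pi * k) := by
    have : β = β₁ + ((θ - x₁) / 2 - Real.pi * k) := by linarith
    rw [this]; push_cast; ring
  push_cast
  rw [hβ]
  ring

end Boundary

end PeriodicOPUC

theorem proposition3p4 (α : ℕ → ℂ) (p : ℕ) (hp : 0 < p) (hpe : Even p)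
    (hα : ∀ n, ‖α n‖ < 1) (hper : ∀ n, α (n + p) = α n) :
    (∀ x₁ θ : ℝ, floquetDiscr α p (Complex.exp (x₁ * Complex.I)) = 2 →
      θ ∈ Set.Icc x₁ (x₁ + 2 * Real.pi) → Complex.exp (θ * Complex.I) ∈ bands α p →
      RadialLimit (gammaPlus α p) (Complex.exp (θ * Complex.I))
        ((Complex.exp (-(Complex.I * Real.pi * p * kFun α p x₁ θ)) : ℂ) : OnePoint ℂ)) ∧
    (∀ b : ℕ, ∀ ζ ∈ bands α p, ∃ J J' : OnePoint ℂ,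
      RadialLimit (jost α p b) ζ J ∧ RadialLimit (jostTilde α p b) ζ J' ∧
      ¬ (J = ((0 : ℂ) : OnePoint ℂ) ∧ J' = ((0 : ℂ) : OnePoint ℂ))) ∧
    (∀ b : ℕ, ∀ ζ ∈ bandsInterior α p, ∃ w : ℂ, w ≠ 0 ∧
      RadialLimit (jostTilde α p b) ζ (w : OnePoint ℂ)) :=
  ⟨fun _ _ hx hθ hB => radialLimit_gammaPlus hα hp hpe hx hθ hB,
    fun b _ hζ => exists_radialLimit_jost hα hp hpe b hζ.1,
    fun b _ hζ => exists_radialLimit_jostTilde_ne_zero hα hp hpe b hζ⟩
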